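/- **Theorem (Existence of an optimizer).** Let $T>0$, $\ell>0$, $X=[0,\ell]$ and $p\in[1,\infty)$. Let $v\in C^1([0,T]\times\mathbb R;\mathbb R_{>0})$, let $b,d\in C^1(X;X)$ with $b\le d$, let $0<\lambda_{\min}\le\lambda_{\max}$ and $L\ge 0$, and let $\rho_0,q_0\in L^\infty((0,\ell))$ and $u^1,u^2\in L^\infty((0,T))$ with $\rho_0\ge 0$ and $u^1\ge0$ almost everywhere. Consider the coupled system on $(0,T)\times(0,\ell)$ $$\partial_t\rho(t,x)+\partial_x\Big(v\big(t,\textstyle\int_0^\ell\rho(t,s)\,ds\big)\rho(t,x)\Big)=0,\quad \rho(0,x)=\rho_0(x),\quad v\big(t,\textstyle\int_0^\ell\rho(t,s)\,ds\big)\rho(t,0)=u^1(t),$$ $$\partial_t q(t,x)+\partial_x\Big(\lambda\big(t,x,\textstyle\int_{b(x)}^{d(x)}\rho(t,s)\,ds\big)q(t,x)\Big)=0,\quad q(0,x)=q_0(x),\quad \lambda\big(t,0,\textstyle\int_{b(0)}^{d(0)}\rho(t,s)\,ds\big)q(t,0)=u^2(t),$$ where solutions $\rho,q\in C([0,T];L^p((0,\ell)))\cap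 L^\infty((0,T)\times(0,\ell))$ are understood in the weak sense: a problem $\partial_t r+\partial_x(wr)=0$, $r(0,\cdot)=r_0$, $w(\cdot,0)r(\cdot,0)=u$ means that $$\int_0^T\!\!\int_0^\ell r\,(\partial_t\varphi+w\,\partial_x\varphi)\,dx\,dt+\int_0^\ell r_0(x)\varphi(0,x)\,dx+\int_0^T u(t)\varphi(t,0)\,dt=0$$ for all $\varphi\in C^1(\mathbb R^2)$ with $\varphi(T,x)=0$ for $x\in[0,\ell]$ and $\varphi(t,\ell)=0$ for $t\in[0,T]$. Let $\Lambda$ be the set of all $\lambda\in C([0,T]\times X\times\mathbb R_{\ge0};\mathbb R)$ such that $\lambda_{\min}\le\lambda\le\lambda_{\max}$ and $$|\lambda(t,x,y)-\lambda(\tilde t,\tilde x,\tilde y)|\le L\,(|x-\tilde x|+|y-\tilde y|+|t-\tilde t|)$$ for all $t,\tilde t\in[0,T]$, $x,\tilde x\in X$, $y,\tilde y\ge0$. Put $$J_1(q,\rho)=\int_0^T\left[\int_0^\ell x^2q(t,x)\,dx-\Big(\int_0^\ell xq(t,x)\,dx\Big)^2\right]dt,$$ $$J_2(q,\rho)=\int_0^T\left[\int_0^\ell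 x^2q(t,x)(1+\rho(t,x))\,dx-\Big(\int_0^\ell xq(t,x)(1+\rho(t,x))\,dx\Big)^2\right]dt.$$ Then for each $i\in\{1,2\}$ the problem of minimizing $J_i(q,\rho)$ over all $\lambda\in\Lambda$ and all weak solutions $(\rho,q)$ of the coupled system with velocity $\lambda$ has a solution: there are $\lambda_*\in\Lambda$ and a weak solution $(\rho_*,q_*)$ for $\lambda_*$ with $J_i(q_*,\rho_*)\le J_i(q,\rho)$ for every $\lambda\in\Lambda$ and every weak solution $(\rho,q)$ for $\lambda$. -/

import Mathlib

open MeasureTheory Set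
open scoped ENNReal

noncomputable section

namespace Platooning

/-- Lebesgue measure on the open road `(0, ℓ)`. -/
abbrev roadMeasure (ℓ : ℝ) : Measure ℝ := volume.restrict (Ioo 0 ℓ)

/-- Membership in `C([0,T]; L^p(0,ℓ)) ∩ L^∞((0,T) × (0,ℓ))`
(values at times outside `[0,T]` play no role). -/
structure IsDensity (T ℓ : ℝ) (p : ℝ≥0∞) [Fact (1 ≤ p)]
    (r : ℝ → Lp ℝ p (roadMeasure ℓ)) : Prop where
  continuousOn : ContinuousOn r (Icc 0 T)
  essBounded : ∃ M : ℝ, ∀ t ∈ Icc 0 T, ∀ᵐ x ∂(roadMeasure ℓ), |r t x| ≤ M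

/-- Weak formulation of the initial-boundary value problem
`∂ₜ r + ∂ₓ (w r) = 0` on `(0,T) × (0,ℓ)`, `r(0,x) = r₀(x)`, `w(t,0) r(t,0) = u(t)`,
tested with `C¹` functions vanishing at the final time and at the exit of the road. -/
def IsWeakSolution (T ℓ : ℝ) (w : ℝ → ℝ → ℝ) (r₀ u : ℝ → ℝ) (r : ℝ → ℝ → ℝ) : Prop :=
  ∀ φ : ℝ × ℝ → ℝ, ContDiff ℝ 1 φ →
    (∀ x ∈ Icc 0 ℓ, φ (T, x) = 0) → (∀ t ∈ Icc 0 T, φ (t, ℓ) = 0) →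
    (∫ t in 0..T, ∫ x in 0..ℓ,
        r t x * (fderiv ℝ φ (t, x) (1, 0) + w t x * fderiv ℝ φ (t, x) (0, 1)))
      + (∫ x in 0..ℓ, r₀ x * φ (0, x)) + (∫ t in 0..T, u t * φ (t, 0)) = 0

/-- The overall traffic density `ρ`: its velocity depends on the total load of the road. -/
def SolvesTraffic (T ℓ : ℝ) (v : ℝ → ℝ → ℝ) (ρ₀ u₁ : ℝ → ℝ) (ρ : ℝ → ℝ → ℝ) : Prop :=
  IsWeakSolution T ℓ (fun t _ => v t (∫ s in 0..ℓ, ρ t s)) ρ₀ u₁ ρ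

/-- The truck density `q`: its velocity is `lam (t, x, ∫_{b(x)}^{d(x)} ρ(t,s) ds)`. -/
def SolvesTruck (T ℓ : ℝ) (b d : ℝ → ℝ) (lam : ℝ → ℝ → ℝ → ℝ) (q₀ u₂ : ℝ → ℝ)
    (ρ q : ℝ → ℝ → ℝ) : Prop :=
  IsWeakSolution T ℓ (fun t x => lam t x (∫ s in (b x)..(d x), ρ t s)) q₀ u₂ q

/-- The set `Λ` of admissible speeds on `[0,T] × [0,ℓ] × [0,∞)`. By continuity it makes no
difference whether the bounds are required for `y ≥ 0` or only for `y > 0`. -/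
structure IsAdmissibleSpeed (T ℓ lmin lmax L : ℝ) (lam : ℝ → ℝ → ℝ → ℝ) : Prop where
  continuousOn : ContinuousOn (fun z : ℝ × ℝ × ℝ => lam z.1 z.2.1 z.2.2)
    (Icc 0 T ×ˢ Icc 0 ℓ ×ˢ Ici 0)
  mem_Icc : ∀ t ∈ Icc 0 T, ∀ x ∈ Icc 0 ℓ, ∀ y, 0 ≤ y → lam t x y ∈ Icc lmin lmax
  lipschitz : ∀ t ∈ Icc 0 T, ∀ t' ∈ Icc 0 T, ∀ x ∈ Icc 0 ℓ, ∀ x' ∈ Icc 0 ℓ,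
    ∀ y y' : ℝ, 0 ≤ y → 0 ≤ y' →
      |lam t x y - lam t' x' y'| ≤ L * (|x - x'| + |y - y'| + |t - t'|)

/-- The variance functional of the truck density. -/
def J₁ (T ℓ : ℝ) (q : ℝ → ℝ → ℝ) : ℝ :=
  ∫ t in 0..T, ((∫ x in 0..ℓ, x ^ 2 * q t x) - (∫ x in 0..ℓ, x * q t x) ^ 2)

/-- The variance functional weighted by the overall traffic density. -/
def J₂ (T ℓ : ℝ) (q ρ : ℝ → ℝ → ℝ) : ℝ :=
  ∫ t in 0..T, ((∫ x in 0..ℓ, x ^ 2 * q t x * (1 + ρ t x))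
    - (∫ x in 0..ℓ, x * q t x * (1 + ρ t x)) ^ 2)

/-- A control together with the two densities that it governs. -/
@[ext]
structure Candidate (ℓ : ℝ) (p : ℝ≥0∞) where
  /-- the truck velocity -/
  lam : ℝ → ℝ → ℝ → ℝ
  /-- the overall traffic density -/
  ρ : ℝ → Lp ℝ p (roadMeasure ℓ)
  /-- the truck density -/
  q : ℝ → Lp ℝ p (roadMeasure ℓ)

/-- Feasible candidates: the control lies in `Λ` and the densities are weak solutions of the
coupled system of partial differential equations. -/
def feasible (T ℓ : ℝ) (p : ℝ≥0∞) [Fact (1 ≤ p)] (v : ℝ → ℝ → ℝ) (b d : ℝ → ℝ)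
    (lmin lmax L : ℝ) (ρ₀ u₁ q₀ u₂ : ℝ → ℝ) : Set (Candidate ℓ p) :=
  {c | IsAdmissibleSpeed T ℓ lmin lmax L c.lam ∧
    IsDensity T ℓ p c.ρ ∧ SolvesTraffic T ℓ v ρ₀ u₁ (fun t => c.ρ t) ∧
    IsDensity T ℓ p c.q ∧
      SolvesTruck T ℓ b d c.lam q₀ u₂ (fun t => c.ρ t) (fun t => c.q t)}

end Platooning

end

/-!
Both equations are solved along characteristics. Label the mass by the point `y` at which its
characteristic, prolonged backwards, enters: `y > 0` for initial data, `y = -s < 0` for mass that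
enters at time `s`. If `Z_w(t, y)` denotes the position at time `t` of the label `y`, then the
solution with velocity `w` is the density of the push-forward under `Z_w(t, ·)` of the label data
`f`, and energy estimates for the primitive in space show that it is the only weak solution.

The velocity of `ρ` depends only on the total load, so `ρ` is determined by the fixed point equation
`W(t) = ∫ f(y) 1_{(0,ℓ)}(Z_W(t, y)) dy` for the load, which is contractive in a time-weighted norm.
Hence `ρ` is the same for all candidates. On the range of arguments at which the solutions evaluate
it, `Λ` is compact in the sup norm by Arzelà–Ascoli, and uniform convergence of the velocities gives
pointwise convergence of the characteristics. Since these compress lengths by a bounded factor,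
`∫ q(t, x) h(x) dx = ∫ f(y) h(Z(t, y)) dy` converges for every integrable `h`, although `h ∘ Z` need
not converge pointwise. The moments in the costs are of this form, so the costs are continuous on a
compact set.
-/

namespace Platooning
open Filter Topology
open scoped NNReal BoundedContinuousFunction

/-! ### Transport of densities by maps of bounded compression -/

/-- `Z` is a measurable embedding that concentrates the measure `μ` by at most the factor `C`
relative to `ν`; such maps transport bounded densities to bounded densities. -/
structure HasBoundedCompression {α β : Type*} [MeasurableSpace α] [MeasurableSpace β] (C : ℝ≥0)
    (μ : Measure α) (ν : Measure β) (Z : α → β) : Prop where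
  measurableEmbedding : MeasurableEmbedding Z
  map_le : μ.map Z ≤ (C : ℝ≥0∞) • ν

lemma hasBoundedCompression_of_antilipschitz {C : ℝ≥0} {Z : ℝ → ℝ} (hc : Continuous Z)
    (hZ : AntilipschitzWith C Z) : HasBoundedCompression C volume volume Z where
  measurableEmbedding := hc.measurableEmbedding hZ.injective
  map_le := Measure.le_iff.2 fun s hs => by
    rw [Measure.map_apply hc.measurable hs, Measure.smul_apply, ← hausdorffMeasure_real]
    simpa using hZ.hausdorffMeasure_preimage_le zero_le_one s

/-- The density with respect to `ν` of the image under `Z` of the signed measure `f μ`. -/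
noncomputable def pushDensity {α β : Type*} [MeasurableSpace α] [MeasurableSpace β]
    (μ : Measure α) (ν : Measure β) (Z : α → β) (f : α → ℝ) (x : β) : ℝ :=
  ((μ.map Z).rnDeriv ν x).toReal * Function.extend Z f 0 x

section PushDensity
variable {α β : Type*} [MeasurableSpace α] [MeasurableSpace β] {μ : Measure α} {ν : Measure β}
  {C : ℝ≥0} {Z : α → β} {f : α → ℝ}

namespace HasBoundedCompression

lemma absolutelyContinuous (hZ : HasBoundedCompression C μ ν Z) : μ.map Z ≪ ν :=
  (Measure.absolutelyContinuous_of_le hZ.map_le).trans Measure.smul_absolutelyContinuous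

lemma ae_toReal_rnDeriv_le [SigmaFinite ν] (hZ : HasBoundedCompression C μ ν Z) :
    ∀ᵐ x ∂ν, ((μ.map Z).rnDeriv ν x).toReal ≤ C := by
  have hle : (μ.map Z).rnDeriv ν ≤ᵐ[ν] fun _ => (C : ℝ≥0∞) := by
    refine ae_le_of_forall_setLIntegral_le_of_sigmaFinite (Measure.measurable_rnDeriv _ _)
      fun s _ _ => (Measure.setLIntegral_rnDeriv_le s).trans ?_
    simpa using hZ.map_le s
  exact hle.mono fun x hx => ENNReal.toReal_le_coe_of_le_coe hx

lemma integrable_comp (hZ : HasBoundedCompression C μ ν Z) {h : β → ℝ} (hh : Integrable h ν) :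
    Integrable (fun y => h (Z y)) μ :=
  hZ.measurableEmbedding.integrable_map_iff.1
    ((hh.smul_measure (c := (C : ℝ≥0∞)) ENNReal.coe_ne_top).mono_measure hZ.map_le)

lemma integral_comp_le (hZ : HasBoundedCompression C μ ν Z) {h : β → ℝ} (hh : Integrable h ν)
    (h_nonneg : ∀ x, 0 ≤ h x) : ∫ y, h (Z y) ∂μ ≤ C * ∫ x, h x ∂ν :=
  calc ∫ y, h (Z y) ∂μ = ∫ x, h x ∂(μ.map Z) := (hZ.measurableEmbedding.integral_map h).symm
    _ ≤ ∫ x, h x ∂((C : ℝ≥0∞) • ν) := integral_mono_measure hZ.map_le (.of_forall h_nonneg)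
        (hh.smul_measure ENNReal.coe_ne_top)
    _ = C * ∫ x, h x ∂ν := by simp [NNReal.smul_def]

lemma ae_abs_pushDensity_le [SigmaFinite ν] (hZ : HasBoundedCompression C μ ν Z) {M : ℝ}
    (hM0 : 0 ≤ M) (hM : ∀ y, |f y| ≤ M) :
    ∀ᵐ x ∂ν, |pushDensity μ ν Z f x| ≤ C * M := by
  filter_upwards [hZ.ae_toReal_rnDeriv_le] with x hx
  rw [pushDensity, abs_mul, abs_of_nonneg ENNReal.toReal_nonneg]
  refine mul_le_mul hx ?_ (abs_nonneg _) C.2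
  by_cases hxZ : ∃ y, Z y = x
  · obtain ⟨y, rfl⟩ := hxZ
    rw [hZ.measurableEmbedding.injective.extend_apply]
    exact hM y
  · simpa [Function.extend_apply' _ _ _ hxZ] using hM0

variable [SigmaFinite μ] [SigmaFinite ν]

lemma integral_pushDensity_mul (hZ : HasBoundedCompression C μ ν Z) (f : α → ℝ) (h : β → ℝ) :
    ∫ x, pushDensity μ ν Z f x * h x ∂ν = ∫ y, f y * h (Z y) ∂μ := by
  have := hZ.measurableEmbedding.sigmaFinite_map (μ := μ)
  simp only [pushDensity, mul_assoc]
  rw [integral_toReal_rnDeriv_mul hZ.absolutelyContinuous, hZ.measurableEmbedding.integral_map]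
  simp only [hZ.measurableEmbedding.injective.extend_apply]

lemma integrable_pushDensity_mul_iff (hZ : HasBoundedCompression C μ ν Z) (f : α → ℝ) (h : β → ℝ) :
    Integrable (fun x => pushDensity μ ν Z f x * h x) ν ↔
      Integrable (fun y => f y * h (Z y)) μ := by
  have := hZ.measurableEmbedding.sigmaFinite_map (μ := μ)
  simp only [pushDensity, mul_assoc]
  rw [integrable_toReal_rnDeriv_mul_iff hZ.absolutelyContinuous,
    hZ.measurableEmbedding.integrable_map_iff]
  simp only [Function.comp_def, hZ.measurableEmbedding.injective.extend_apply]

lemma integrable_pushDensity (hZ : HasBoundedCompression C μ ν Z) (hf : Integrable f μ) :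
    Integrable (pushDensity μ ν Z f) ν := by
  simpa using (hZ.integrable_pushDensity_mul_iff f fun _ => 1).2 (by simpa using hf)

end HasBoundedCompression

lemma measurable_pushDensity (hZ : MeasurableEmbedding Z) (hf : Measurable f) :
    Measurable (pushDensity μ ν Z f) :=
  (Measure.measurable_rnDeriv _ _).ennreal_toReal.mul (hZ.measurable_extend hf measurable_const)

lemma pushDensity_nonneg (hZ : Function.Injective Z) (hf : ∀ y, 0 ≤ f y) (x : β) :
    0 ≤ pushDensity μ ν Z f x := by
  refine mul_nonneg ENNReal.toReal_nonneg ?_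
  by_cases hxZ : ∃ y, Z y = x
  · obtain ⟨y, rfl⟩ := hxZ
    rw [hZ.extend_apply]
    exact hf y
  · simp [Function.extend_apply' _ _ _ hxZ]

lemma HasBoundedCompression.abs_integral_mul_comp_sub_le (hZ : HasBoundedCompression C μ ν Z)
    {M : ℝ} (hf : AEStronglyMeasurable f μ) (hM0 : 0 ≤ M) (hM : ∀ᵐ y ∂μ, |f y| ≤ M) {g h : β → ℝ}
    (hg : Integrable g ν) (hh : Integrable h ν) :
    |(∫ y, f y * h (Z y) ∂μ) - ∫ y, f y * g (Z y) ∂μ| ≤ M * (C * ∫ x, |h x - g x| ∂ν) := by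
  have hmul {k : β → ℝ} (hk : Integrable k ν) : Integrable (fun y => f y * k (Z y)) μ :=
    (hZ.integrable_comp hk).bdd_mul hf hM
  have habs : Integrable (fun x => |h x - g x|) ν := (hh.sub hg).abs
  calc |(∫ y, f y * h (Z y) ∂μ) - ∫ y, f y * g (Z y) ∂μ|
      = |∫ y, f y * h (Z y) - f y * g (Z y) ∂μ| := by rw [integral_sub (hmul hh) (hmul hg)]
    _ ≤ ∫ y, |f y * h (Z y) - f y * g (Z y)| ∂μ := abs_integral_le_integral_abs
    _ ≤ ∫ y, M * |h (Z y) - g (Z y)| ∂μ := by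
        refine integral_mono_ae ((hmul hh).sub (hmul hg)).abs
          ((hZ.integrable_comp habs).const_mul M) ?_
        filter_upwards [hM] with y hy
        rw [← mul_sub, abs_mul]
        gcongr
    _ ≤ M * (C * ∫ x, |h x - g x| ∂ν) := by
        rw [integral_const_mul]
        exact mul_le_mul_of_nonneg_left
          (hZ.integral_comp_le habs fun _ => abs_nonneg _) hM0

section WeakContinuity
variable {ι : Type*} {l : Filter ι} [l.IsCountablyGenerated] {Zs : ι → α → β}

lemma tendsto_integral_mul_comp_of_hasCompactSupport [TopologicalSpace β]
    [OpensMeasurableSpace β] (hZs : ∀ᶠ n in l, Measurable (Zs n))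
    (hlim : ∀ᵐ y ∂μ, f y ≠ 0 → Tendsto (fun n => Zs n y) l (𝓝 (Z y))) (hf : Integrable f μ)
    {g : β → ℝ} (hg : Continuous g) (hg_supp : HasCompactSupport g) :
    Tendsto (fun n => ∫ y, f y * g (Zs n y) ∂μ) l (𝓝 (∫ y, f y * g (Z y) ∂μ)) := by
  obtain ⟨B, hB⟩ := hg_supp.exists_bound_of_continuous hg
  refine tendsto_integral_filter_of_dominated_convergence (fun y => |f y| * B) ?_ ?_
    (hf.abs.mul_const B) ?_
  · filter_upwards [hZs] with n hn
    exact hf.1.mul (hg.measurable.comp hn).aestronglyMeasurable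
  · refine .of_forall fun n => .of_forall fun y => ?_
    rw [norm_mul]
    exact mul_le_mul_of_nonneg_left (hB _) (norm_nonneg _)
  · filter_upwards [hlim] with y hy
    by_cases hfy : f y = 0
    · simpa [hfy] using tendsto_const_nhds
    · exact ((hg.tendsto _).comp (hy hfy)).const_mul _

-- Bounded compression transfers the `L¹` density of continuous test functions uniformly in `n`.
lemma tendsto_integral_mul_comp [TopologicalSpace β] [NormalSpace β] [R1Space β]
    [WeaklyLocallyCompactSpace β] [BorelSpace β] [ν.Regular]
    (hZs : ∀ᶠ n in l, HasBoundedCompression C μ ν (Zs n)) (hZ : HasBoundedCompression C μ ν Z)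
    (hlim : ∀ᵐ y ∂μ, f y ≠ 0 → Tendsto (fun n => Zs n y) l (𝓝 (Z y)))
    {M : ℝ} (hf : Integrable f μ) (hM0 : 0 ≤ M) (hM : ∀ᵐ y ∂μ, |f y| ≤ M)
    {h : β → ℝ} (hh : Integrable h ν) :
    Tendsto (fun n => ∫ y, f y * h (Zs n y) ∂μ) l (𝓝 (∫ y, f y * h (Z y) ∂μ)) := by
  rw [Metric.tendsto_nhds]
  intro ε hε
  obtain ⟨δ, hδ, hδε⟩ : ∃ δ > 0, M * (C * δ) < ε / 3 := by
    refine ⟨ε / 3 / (M * C + 1), by positivity, ?_⟩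
    have : 0 ≤ M * (C : ℝ) := by positivity
    rw [← mul_assoc, mul_div_assoc', div_lt_iff₀ (by positivity)]
    nlinarith
  obtain ⟨g, hg_supp, hgδ, hg, hg_int⟩ := hh.exists_hasCompactSupport_integral_sub_le hδ
  simp only [Real.norm_eq_abs] at hgδ
  have happrox {Z' : α → β} (hZ' : HasBoundedCompression C μ ν Z') :
      |(∫ y, f y * h (Z' y) ∂μ) - ∫ y, f y * g (Z' y) ∂μ| < ε / 3 :=
    (hZ'.abs_integral_mul_comp_sub_le hf.1 hM0 hM hg_int hh).trans_lt (hδε.trans_le' (by gcongr))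
  have hlim_g := tendsto_integral_mul_comp_of_hasCompactSupport
    (hZs.mono fun n hn => hn.measurableEmbedding.measurable) hlim hf hg hg_supp
  filter_upwards [hZs, Metric.tendsto_nhds.1 hlim_g (ε / 3) (by positivity)] with n hn hgn
  rw [Real.dist_eq] at hgn ⊢
  have h_n := abs_lt.1 (happrox hn)
  have h_lim := abs_lt.1 (happrox hZ)
  rw [abs_lt] at hgn ⊢
  constructor <;> linarith [h_n.1, h_n.2, h_lim.1, h_lim.2, hgn.1, hgn.2]

end WeakContinuity

end PushDensity

/-! ### Bounded curves in `L¹` -/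

/-- A curve `t ↦ r t` that on `S` is continuous with values in `L¹(μ)` and bounded by `M` almost
everywhere, uniformly in `t`. It is encoded by functions rather than by elements of `Lp`, so that
products and evaluations need no coercions. -/
structure IsBoundedL1Curve {τ α : Type*} [TopologicalSpace τ] [MeasurableSpace α] (S : Set τ)
    (μ : Measure α) (M : ℝ) (r : τ → α → ℝ) : Prop where
  aestronglyMeasurable : ∀ t ∈ S, AEStronglyMeasurable (r t) μ
  ae_abs_le : ∀ t ∈ S, ∀ᵐ x ∂μ, |r t x| ≤ M
  tendsto : ∀ t ∈ S, Tendsto (fun s => ∫ x, |r s x - r t x| ∂μ) (𝓝[S] t) (𝓝 0)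

namespace IsBoundedL1Curve
variable {τ α : Type*} [TopologicalSpace τ] [MeasurableSpace α] {S : Set τ} {μ : Measure α}
  {M M' : ℝ} {r r' : τ → α → ℝ}

lemma congr (h : IsBoundedL1Curve S μ M r) (hrr' : ∀ t ∈ S, r t =ᵐ[μ] r' t) :
    IsBoundedL1Curve S μ M r' where
  aestronglyMeasurable t ht := (h.aestronglyMeasurable t ht).congr (hrr' t ht)
  ae_abs_le t ht := by
    filter_upwards [h.ae_abs_le t ht, hrr' t ht] with x hx hxr
    rwa [← hxr]
  tendsto t ht := by
    refine (h.tendsto t ht).congr' ?_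
    filter_upwards [self_mem_nhdsWithin] with s hs
    refine integral_congr_ae ?_
    filter_upwards [hrr' s hs, hrr' t ht] with x hs ht
    rw [hs, ht]

lemma mono_bound (h : IsBoundedL1Curve S μ M r) (hM : M ≤ M') : IsBoundedL1Curve S μ M' r :=
  ⟨h.aestronglyMeasurable, fun t ht => (h.ae_abs_le t ht).mono fun _ hx => hx.trans hM, h.tendsto⟩

variable [IsFiniteMeasure μ]

lemma abs_integral_le (h : IsBoundedL1Curve S μ M r) {t : τ} (ht : t ∈ S) :
    |∫ x, r t x ∂μ| ≤ M * μ.real univ := by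
  rw [← Real.norm_eq_abs]
  exact norm_integral_le_of_norm_le_const (h.ae_abs_le t ht)

lemma integrable (h : IsBoundedL1Curve S μ M r) {t : τ} (ht : t ∈ S) : Integrable (r t) μ :=
  Integrable.of_bound (h.aestronglyMeasurable t ht) M (h.ae_abs_le t ht)

lemma integrable_abs_sub (h : IsBoundedL1Curve S μ M r) {s t : τ} (hs : s ∈ S) (ht : t ∈ S) :
    Integrable (fun x => |r s x - r t x|) μ :=
  ((h.integrable hs).sub (h.integrable ht)).abs

lemma of_continuousOn [FirstCountableTopology τ]
    (hr : ∀ t ∈ S, AEStronglyMeasurable (r t) μ) (hM : ∀ t ∈ S, ∀ᵐ x ∂μ, |r t x| ≤ M)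
    (hc : ∀ᵐ x ∂μ, ContinuousOn (fun t => r t x) S) : IsBoundedL1Curve S μ M r where
  aestronglyMeasurable := hr
  ae_abs_le := hM
  tendsto t ht := by
    rw [show (0 : ℝ) = ∫ x, |r t x - r t x| ∂μ by simp]
    refine tendsto_integral_filter_of_dominated_convergence (fun _ => M + M) ?_ ?_
      (integrable_const _) ?_
    · filter_upwards [self_mem_nhdsWithin] with s hs using ((hr s hs).sub (hr t ht)).norm
    · filter_upwards [self_mem_nhdsWithin] with s hs
      filter_upwards [hM s hs, hM t ht] with x hxs hxt
      rw [Real.norm_eq_abs, abs_abs]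
      exact (abs_sub _ _).trans (add_le_add hxs hxt)
    · filter_upwards [hc] with x hx
      exact ((hx t ht).sub tendsto_const_nhds).abs

lemma const [FirstCountableTopology τ] {g : α → ℝ} (hg : AEStronglyMeasurable g μ)
    (hM : ∀ᵐ x ∂μ, |g x| ≤ M) : IsBoundedL1Curve S μ M fun _ => g :=
  of_continuousOn (fun _ _ => hg) (fun _ _ => hM) (.of_forall fun _ => continuousOn_const)

lemma add (h : IsBoundedL1Curve S μ M r) (h' : IsBoundedL1Curve S μ M' r') :
    IsBoundedL1Curve S μ (M + M') fun t x => r t x + r' t x where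
  aestronglyMeasurable t ht := (h.aestronglyMeasurable t ht).add (h'.aestronglyMeasurable t ht)
  ae_abs_le t ht := by
    filter_upwards [h.ae_abs_le t ht, h'.ae_abs_le t ht] with x hx hx'
    exact (abs_add_le _ _).trans (add_le_add hx hx')
  tendsto t ht := by
    have hlim := (h.tendsto t ht).add (h'.tendsto t ht)
    rw [add_zero] at hlim
    refine squeeze_zero' (.of_forall fun s => integral_nonneg fun x => abs_nonneg _) ?_ hlim
    filter_upwards [self_mem_nhdsWithin] with s hs
    have hi := h.integrable_abs_sub hs ht
    have hi' := h'.integrable_abs_sub hs ht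
    rw [← integral_add hi hi']
    refine integral_mono_of_nonneg (.of_forall fun _ => abs_nonneg _) (hi.add hi')
      (.of_forall fun x => ?_)
    beta_reduce
    rw [add_sub_add_comm]
    exact abs_add_le _ _

lemma mul (h : IsBoundedL1Curve S μ M r) (h' : IsBoundedL1Curve S μ M' r') :
    IsBoundedL1Curve S μ (M * M') fun t x => r t x * r' t x where
  aestronglyMeasurable t ht := (h.aestronglyMeasurable t ht).mul (h'.aestronglyMeasurable t ht)
  ae_abs_le t ht := by
    filter_upwards [h.ae_abs_le t ht, h'.ae_abs_le t ht] with x hx hx'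
    rw [abs_mul]
    exact mul_le_mul hx hx' (abs_nonneg _) ((abs_nonneg _).trans hx)
  tendsto t ht := by
    have hlim := ((h.tendsto t ht).mul_const M').add ((h'.tendsto t ht).const_mul M)
    rw [zero_mul, mul_zero, add_zero] at hlim
    refine squeeze_zero' (.of_forall fun s => integral_nonneg fun x => abs_nonneg _) ?_ hlim
    filter_upwards [self_mem_nhdsWithin] with s hs
    have hi := (h.integrable_abs_sub hs ht).mul_const M'
    have hi' := (h'.integrable_abs_sub hs ht).const_mul M
    rw [← integral_mul_const, ← integral_const_mul, ← integral_add hi hi']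
    refine integral_mono_of_nonneg (.of_forall fun _ => abs_nonneg _) (hi.add hi') ?_
    filter_upwards [h.ae_abs_le t ht, h'.ae_abs_le s hs] with x hx hx'
    calc |r s x * r' s x - r t x * r' t x|
        = |(r s x - r t x) * r' s x + r t x * (r' s x - r' t x)| := by congr 1; ring
      _ ≤ |r s x - r t x| * |r' s x| + |r t x| * |r' s x - r' t x| := by
          rw [← abs_mul, ← abs_mul]
          exact abs_add_le _ _
      _ ≤ |r s x - r t x| * M' + M * |r' s x - r' t x| := by gcongr

lemma sub [FirstCountableTopology τ] (h : IsBoundedL1Curve S μ M r)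
    (h' : IsBoundedL1Curve S μ M' r') :
    IsBoundedL1Curve S μ (M + M') fun t x => r t x - r' t x := by
  have hneg : IsBoundedL1Curve S μ 1 fun _ _ => -1 :=
    const aestronglyMeasurable_const (.of_forall fun _ => by simp)
  simpa [sub_eq_add_neg] using h.add (hneg.mul h')

lemma continuousOn_integral (h : IsBoundedL1Curve S μ M r) :
    ContinuousOn (fun t => ∫ x, r t x ∂μ) S := by
  intro t ht
  rw [ContinuousWithinAt, tendsto_iff_dist_tendsto_zero]
  refine squeeze_zero' (.of_forall fun _ => dist_nonneg) ?_ (h.tendsto t ht)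
  filter_upwards [self_mem_nhdsWithin] with s hs
  rw [Real.dist_eq, ← integral_sub (h.integrable hs) (h.integrable ht)]
  exact abs_integral_le_integral_abs

end IsBoundedL1Curve

/-! ### The fundamental lemma of the calculus of variations -/

section FundamentalLemma
variable {a b : ℝ} {A B : ℝ → ℝ}

-- The test function is the primitive of `A - ∫ B` that vanishes at `b`.
lemma integral_sub_primitive_sq_eq_zero (hA : Continuous A) (hB : Continuous B)
    (h : ∀ α : ℝ → ℝ, ContDiff ℝ 1 α → α b = 0 →
      ∫ t in a..b, (deriv α t * A t + α t * B t) = 0) :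
    ∫ t in a..b, (A t - ∫ s in a..t, B s) ^ 2 = 0 := by
  set P : ℝ → ℝ := fun t => ∫ s in a..t, B s
  set D : ℝ → ℝ := fun t => A t - P t
  set α : ℝ → ℝ := fun t => ∫ s in b..t, D s with hα_def
  have hP (t : ℝ) : HasDerivAt P (B t) t := (hB.integral_hasStrictDerivAt a t).hasDerivAt
  have hP_cont : Continuous P := continuous_iff_continuousAt.2 fun t => (hP t).continuousAt
  have hD : Continuous D := hA.sub hP_cont
  have hα (t : ℝ) : HasDerivAt α (D t) t := (hD.integral_hasStrictDerivAt b t).hasDerivAt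
  have hα_deriv : deriv α = D := funext fun t => (hα t).deriv
  have hα_C1 : ContDiff ℝ 1 α :=
    contDiff_one_iff_deriv.2 ⟨fun t => (hα t).differentiableAt, hα_deriv ▸ hD⟩
  have hαb : α b = 0 := by simp [hα_def]
  have hDA : Continuous fun t => D t * A t := hD.mul hA
  have hDP : Continuous fun t => D t * P t := hD.mul hP_cont
  have hαB : Continuous fun t => α t * B t := hα_C1.continuous.mul hB
  have htest : (∫ t in a..b, D t * A t) + ∫ t in a..b, α t * B t = 0 := by
    rw [← intervalIntegral.integral_add (hDA.intervalIntegrable _ _)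
      (hαB.intervalIntegrable _ _), ← h α hα_C1 hαb, hα_deriv]
  have hparts : ∫ t in a..b, α t * B t = -∫ t in a..b, D t * P t := by
    rw [intervalIntegral.integral_mul_deriv_eq_deriv_mul (fun t _ => hα t) (fun t _ => hP t)
      (hD.intervalIntegrable _ _) (hB.intervalIntegrable _ _), hαb]
    simp [P]
  calc ∫ t in a..b, D t ^ 2 = ∫ t in a..b, (D t * A t - D t * P t) := by
        congr 1 with t
        rw [← mul_sub, ← sq]
    _ = 0 := by
        rw [intervalIntegral.integral_sub (hDA.intervalIntegrable _ _)
          (hDP.intervalIntegrable _ _)]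
        linarith

lemma eqOn_primitive_of_forall_test_of_continuous (hab : a < b) (hA : Continuous A)
    (hB : Continuous B) (h : ∀ α : ℝ → ℝ, ContDiff ℝ 1 α → α b = 0 →
      ∫ t in a..b, (deriv α t * A t + α t * B t) = 0) :
    EqOn A (fun t => ∫ s in a..t, B s) (Icc a b) := by
  intro t ht
  by_contra hne
  have hcont : Continuous fun t => (A t - ∫ s in a..t, B s) ^ 2 :=
    (hA.sub (intervalIntegral.continuous_primitive (fun _ _ => hB.intervalIntegrable _ _) a)).pow 2
  exact (intervalIntegral.integral_pos hab hcont.continuousOn (fun _ _ => sq_nonneg _)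
    ⟨t, ht, sq_pos_of_ne_zero (sub_ne_zero.2 hne)⟩).ne'
    (integral_sub_primitive_sq_eq_zero hA hB h)

lemma eqOn_primitive_of_forall_test (hab : a < b) (hA : ContinuousOn A (Icc a b))
    (hB : ContinuousOn B (Icc a b)) (h : ∀ α : ℝ → ℝ, ContDiff ℝ 1 α → α b = 0 →
      ∫ t in a..b, (deriv α t * A t + α t * B t) = 0) :
    EqOn A (fun t => ∫ s in a..t, B s) (Icc a b) := by
  have hext {f : ℝ → ℝ} {t : ℝ} (ht : t ∈ Icc a b) :
      IccExtend hab.le ((Icc a b).domRestrict f) t = f t := by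
    rw [IccExtend_of_mem _ _ ht, domRestrict_apply]
  have key := eqOn_primitive_of_forall_test_of_continuous hab
    (A := IccExtend hab.le ((Icc a b).domRestrict A))
    (B := IccExtend hab.le ((Icc a b).domRestrict B))
    (continuousOn_iff_continuous_domRestrict.1 hA).Icc_extend'
    (continuousOn_iff_continuous_domRestrict.1 hB).Icc_extend' fun α hα hαb => by
      rw [← h α hα hαb]
      refine intervalIntegral.integral_congr fun t ht => ?_
      rw [uIcc_of_le hab.le] at ht
      simp only [hext ht]
  intro t ht
  rw [← hext (f := A) ht, key ht]
  refine intervalIntegral.integral_congr fun s hs => hext ?_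
  rw [uIcc_of_le ht.1] at hs
  exact ⟨hs.1, hs.2.trans ht.2⟩

end FundamentalLemma

/-! ### Primitives on the road -/

lemma intervalIntegral_eq_integral_road {ℓ : ℝ} (hℓ : 0 ≤ ℓ) (f : ℝ → ℝ) :
    ∫ x in 0..ℓ, f x = ∫ x, f x ∂(roadMeasure ℓ) := by
  rw [intervalIntegral.integral_of_le hℓ, integral_Ioc_eq_integral_Ioo]

lemma integrable_road_of_continuous {ℓ : ℝ} {g : ℝ → ℝ} (hg : Continuous g) :
    Integrable g (roadMeasure ℓ) :=
  (hg.integrableOn_Icc (a := 0) (b := ℓ)).mono_set Ioo_subset_Icc_self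

/-- The primitive of `r` on the road that vanishes at the entrance, extended by constants beyond
both ends of the road. -/
noncomputable def roadPrimitive (ℓ : ℝ) (r : ℝ → ℝ) (x : ℝ) : ℝ :=
  ∫ y in 0..x, (Ioo 0 ℓ).indicator r y

section Primitive
variable {ℓ : ℝ} {r r' : ℝ → ℝ}

lemma intervalIntegrable_indicator_road (hr : Integrable r (roadMeasure ℓ)) (a b : ℝ) :
    IntervalIntegrable ((Ioo 0 ℓ).indicator r) volume a b :=
  ((integrable_indicator_iff measurableSet_Ioo).2 hr).intervalIntegrable

@[simp] lemma roadPrimitive_zero : roadPrimitive ℓ r 0 = 0 := by simp [roadPrimitive]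

lemma continuous_roadPrimitive (hr : Integrable r (roadMeasure ℓ)) :
    Continuous (roadPrimitive ℓ r) :=
  intervalIntegral.continuous_primitive (intervalIntegrable_indicator_road hr) 0

lemma roadPrimitive_sub (hr : Integrable r (roadMeasure ℓ)) (hr' : Integrable r' (roadMeasure ℓ))
    (x : ℝ) :
    roadPrimitive ℓ (r - r') x = roadPrimitive ℓ r x - roadPrimitive ℓ r' x := by
  rw [roadPrimitive, indicator_sub']
  exact intervalIntegral.integral_sub (intervalIntegrable_indicator_road hr 0 x)
    (intervalIntegrable_indicator_road hr' 0 x)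

lemma abs_roadPrimitive_le (hr : Integrable r (roadMeasure ℓ)) (x : ℝ) :
    |roadPrimitive ℓ r x| ≤ ∫ y, |r y| ∂(roadMeasure ℓ) :=
  have hi := (integrable_indicator_iff measurableSet_Ioo).2 hr
  calc |roadPrimitive ℓ r x| ≤ ∫ y in uIoc 0 x, |(Ioo 0 ℓ).indicator r y| := by
        rw [roadPrimitive, ← Real.norm_eq_abs]
        exact intervalIntegral.norm_integral_le_integral_norm_uIoc
    _ ≤ ∫ y, |(Ioo 0 ℓ).indicator r y| :=
        setIntegral_le_integral hi.abs (.of_forall fun _ => abs_nonneg _)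
    _ = ∫ y, |r y| ∂(roadMeasure ℓ) := by
        rw [← integral_indicator measurableSet_Ioo]
        congr 1 with y
        by_cases hy : y ∈ Ioo 0 ℓ <;> simp [hy]

lemma absolutelyContinuous_roadPrimitive (hℓ : 0 ≤ ℓ) (hr : Integrable r (roadMeasure ℓ)) :
    AbsolutelyContinuousOnInterval (roadPrimitive ℓ r) 0 ℓ :=
  (intervalIntegrable_indicator_road hr 0 ℓ).absolutelyContinuousOnInterval_intervalIntegral
    (by simp [hℓ])

lemma ae_hasDerivAt_roadPrimitive (hr : Integrable r (roadMeasure ℓ)) :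
    ∀ᵐ x ∂(roadMeasure ℓ), HasDerivAt (roadPrimitive ℓ r) (r x) x := by
  rw [ae_restrict_iff' measurableSet_Ioo]
  filter_upwards [(intervalIntegrable_indicator_road hr 0 ℓ).ae_hasDerivAt_integral]
    with x hx hx_road
  have hx_uIcc : x ∈ uIcc 0 ℓ := Icc_subset_uIcc (Ioo_subset_Icc_self hx_road)
  have hx_deriv := hx hx_uIcc 0 left_mem_uIcc
  rwa [indicator_of_mem hx_road] at hx_deriv

lemma integral_mul_eq_neg_integral_roadPrimitive_mul (hℓ : 0 ≤ ℓ)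
    (hr : Integrable r (roadMeasure ℓ)) {β : ℝ → ℝ} (hβ : ContDiff ℝ 1 β) (hβℓ : β ℓ = 0) :
    ∫ x, r x * β x ∂(roadMeasure ℓ) = -∫ x, roadPrimitive ℓ r x * deriv β x ∂(roadMeasure ℓ) := by
  have hparts := AbsolutelyContinuousOnInterval.integral_mul_deriv_eq_deriv_mul
    hβ.contDiffOn.absolutelyContinuousOnInterval (absolutelyContinuous_roadPrimitive hℓ hr)
  rw [hβℓ, roadPrimitive_zero, zero_mul, mul_zero, sub_zero, zero_sub,
    intervalIntegral_eq_integral_road hℓ, intervalIntegral_eq_integral_road hℓ] at hparts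
  calc ∫ x, r x * β x ∂(roadMeasure ℓ)
      = ∫ x, β x * deriv (roadPrimitive ℓ r) x ∂(roadMeasure ℓ) := by
        refine integral_congr_ae ?_
        filter_upwards [ae_hasDerivAt_roadPrimitive hr] with x hx
        rw [hx.deriv, mul_comm]
    _ = -∫ x, roadPrimitive ℓ r x * deriv β x ∂(roadMeasure ℓ) := by
        rw [hparts]
        simp only [mul_comm]

-- Integration by parts: `2 ∫ r w P = ∫ w (P²)' = w(ℓ) P(ℓ)² - ∫ w' P²`.
lemma neg_integral_flux_le (hℓ : 0 ≤ ℓ) (hr : Integrable r (roadMeasure ℓ)) {w : ℝ → ℝ} {K : ℝ≥0}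
    (hw : LipschitzWith K w) (hwℓ : 0 ≤ w ℓ) :
    -(2 * ∫ x, r x * (w x * roadPrimitive ℓ r x) ∂(roadMeasure ℓ))
      ≤ K * ∫ x, roadPrimitive ℓ r x ^ 2 ∂(roadMeasure ℓ) := by
  set P := roadPrimitive ℓ r with hP
  have hP_cont : Continuous P := continuous_roadPrimitive hr
  have hP_ac := absolutelyContinuous_roadPrimitive hℓ hr
  have hparts := AbsolutelyContinuousOnInterval.integral_mul_deriv_eq_deriv_mul
    (hw.lipschitzOnWith.absolutelyContinuousOnInterval (a := 0) (b := ℓ)) (hP_ac.mul hP_ac)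
  simp only [Pi.mul_apply, ← hP] at hparts
  rw [intervalIntegral_eq_integral_road hℓ, intervalIntegral_eq_integral_road hℓ,
    show P 0 = 0 from roadPrimitive_zero, mul_zero, mul_zero, sub_zero] at hparts
  have hflux : ∫ x, w x * deriv (P * P) x ∂(roadMeasure ℓ)
      = 2 * ∫ x, r x * (w x * P x) ∂(roadMeasure ℓ) := by
    rw [← integral_const_mul]
    refine integral_congr_ae ?_
    filter_upwards [ae_hasDerivAt_roadPrimitive hr] with x hx
    rw [(hx.mul hx).deriv]
    ring
  have hbound (x : ℝ) : ‖deriv w x * (P x * P x)‖ ≤ K * P x ^ 2 := by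
    rw [norm_mul, Real.norm_eq_abs (P x * P x), abs_mul_self, ← pow_two]
    exact mul_le_mul_of_nonneg_right (norm_deriv_le_of_lipschitz hw) (sq_nonneg _)
  have hP_sq : Integrable (fun x => K * P x ^ 2) (roadMeasure ℓ) :=
    integrable_road_of_continuous (by fun_prop)
  have hlip := norm_integral_le_of_norm_le hP_sq (.of_forall hbound)
  rw [integral_const_mul, Real.norm_eq_abs] at hlip
  have := le_of_abs_le hlip
  have hexit : 0 ≤ w ℓ * (P ℓ * P ℓ) := mul_nonneg hwℓ (mul_self_nonneg _)
  linarith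

lemma ae_eq_zero_of_integral_roadPrimitive_sq_eq_zero (hr : Integrable r (roadMeasure ℓ))
    (h : ∫ x, roadPrimitive ℓ r x ^ 2 ∂(roadMeasure ℓ) = 0) : r =ᵐ[roadMeasure ℓ] 0 := by
  have hcont := continuous_roadPrimitive hr
  rw [integral_eq_zero_iff_of_nonneg (fun _ => sq_nonneg _)
    (integrable_road_of_continuous (hcont.pow 2))] at h
  have hzero : EqOn (roadPrimitive ℓ r) (fun _ => 0) (Ioo 0 ℓ) :=
    Measure.eqOn_open_of_ae_eq (h.mono fun x hx => pow_eq_zero_iff two_ne_zero |>.1 hx)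
      isOpen_Ioo hcont.continuousOn continuousOn_const
  filter_upwards [ae_hasDerivAt_roadPrimitive hr, ae_restrict_mem measurableSet_Ioo]
    with x hx hx_road
  exact hx.unique ((hasDerivAt_const x 0).congr_of_eventuallyEq
    (hzero.eventuallyEq_of_mem (isOpen_Ioo.mem_nhds hx_road)))

end Primitive

/-! ### Uniqueness of weak solutions -/

/-- A velocity field on the line that is continuous, bounded between the positive constants `a` and
`B`, and `K`-Lipschitz in space. Only its values on the road matter; prolonging them by constants
to the left of the entrance lets one label a characteristic by its position at time `0` even if it
enters the road later. -/
structure IsForwardVelocity (a B : ℝ) (K : ℝ≥0) (w : ℝ → ℝ → ℝ) : Prop where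
  pos : 0 < a
  continuous : Continuous fun z : ℝ × ℝ => w z.1 z.2
  lower : ∀ t x, a ≤ w t x
  upper : ∀ t x, w t x ≤ B
  lipschitz : ∀ t, LipschitzWith K (w t)
  eq_entrance : ∀ t x, x ≤ 0 → w t x = w t 0

lemma exists_isBoundedL1Curve_of_continuous (T ℓ : ℝ) {g : ℝ → ℝ → ℝ}
    (hg : Continuous fun z : ℝ × ℝ => g z.1 z.2) :
    ∃ G, IsBoundedL1Curve (Icc 0 T) (roadMeasure ℓ) G g := by
  obtain ⟨G, hG⟩ := (isCompact_Icc.prod isCompact_Icc).exists_bound_of_continuousOn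
    (hg.continuousOn (s := Icc 0 T ×ˢ Icc 0 ℓ))
  refine ⟨G, .of_continuousOn (fun t _ => (hg.comp (.prodMk_right t)).aestronglyMeasurable)
    (fun t ht => ?_) (.of_forall fun x => (hg.comp (.prodMk_left x)).continuousOn)⟩
  filter_upwards [ae_restrict_mem measurableSet_Ioo] with x hx
    using hG (t, x) ⟨ht, Ioo_subset_Icc_self hx⟩

section Uniqueness
variable {T ℓ M a B : ℝ} {K : ℝ≥0} {r w : ℝ → ℝ → ℝ}

namespace IsForwardVelocity

lemma nonneg (hw : IsForwardVelocity a B K w) (t x : ℝ) : 0 ≤ w t x :=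
  hw.pos.le.trans (hw.lower t x)

lemma abs_le (hw : IsForwardVelocity a B K w) (t x : ℝ) : |w t x| ≤ B := by
  rw [abs_of_nonneg (hw.nonneg t x)]
  exact hw.upper t x

lemma continuous_time (hw : IsForwardVelocity a B K w) (x : ℝ) : Continuous fun t => w t x :=
  hw.continuous.comp (continuous_id.prodMk continuous_const)

lemma isBoundedL1Curve (hw : IsForwardVelocity a B K w) (S : Set ℝ) (μ : Measure ℝ)
    [IsFiniteMeasure μ] : IsBoundedL1Curve S μ B w :=
  .of_continuousOn (fun t _ => (hw.lipschitz t).continuous.aestronglyMeasurable)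
    (fun t _ => .of_forall (hw.abs_le t)) (.of_forall fun x => (hw.continuous_time x).continuousOn)

end IsForwardVelocity

lemma IsBoundedL1Curve.abs_roadPrimitive_sub_le {τ : Type*} [TopologicalSpace τ] {S : Set τ}
    {r : τ → ℝ → ℝ} (hr : IsBoundedL1Curve S (roadMeasure ℓ) M r) {s t : τ} (hs : s ∈ S)
    (ht : t ∈ S) (x : ℝ) :
    |roadPrimitive ℓ (r t) x - roadPrimitive ℓ (r s) x|
      ≤ ∫ y, |r t y - r s y| ∂(roadMeasure ℓ) := by
  rw [← roadPrimitive_sub (hr.integrable ht) (hr.integrable hs)]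
  exact abs_roadPrimitive_le ((hr.integrable ht).sub (hr.integrable hs)) x

lemma fderiv_mul_apply_of_separated {α β : ℝ → ℝ} {t x : ℝ} (hα : DifferentiableAt ℝ α t)
    (hβ : DifferentiableAt ℝ β x) (z : ℝ × ℝ) :
    fderiv ℝ (fun z : ℝ × ℝ => α z.1 * β z.2) (t, x) z
      = deriv α t * β x * z.1 + α t * deriv β x * z.2 := by
  have hα' : HasFDerivAt (fun z : ℝ × ℝ => α z.1) (deriv α t • ContinuousLinearMap.fst ℝ ℝ ℝ)
      (t, x) := hα.hasDerivAt.comp_hasFDerivAt (t, x) hasFDerivAt_fst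
  have hβ' : HasFDerivAt (fun z : ℝ × ℝ => β z.2) (deriv β x • ContinuousLinearMap.snd ℝ ℝ ℝ)
      (t, x) := hβ.hasDerivAt.comp_hasFDerivAt (t, x) hasFDerivAt_snd
  have hαβ : HasFDerivAt (fun z : ℝ × ℝ => α z.1 * β z.2) _ (t, x) := hα'.mul hβ'
  rw [hαβ.fderiv]
  simp only [add_apply, smul_apply,
    ContinuousLinearMap.coe_fst', ContinuousLinearMap.coe_snd', smul_eq_mul]
  ring

section ZeroData
variable (hT : 0 < T) (hℓ : 0 ≤ ℓ) (hr : IsBoundedL1Curve (Icc 0 T) (roadMeasure ℓ) M r)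
  (hw : IsForwardVelocity a B K w) (h : IsWeakSolution T ℓ w 0 0 r)
include hr hw

lemma continuousOn_integral_flux {γ : ℝ → ℝ} (hγ : Continuous γ) :
    ContinuousOn (fun t => ∫ x, r t x * (w t x * γ x) ∂(roadMeasure ℓ)) (Icc 0 T) := by
  obtain ⟨_, hγ'⟩ := exists_isBoundedL1Curve_of_continuous T ℓ (g := fun _ => γ) (by fun_prop)
  exact (hr.mul ((hw.isBoundedL1Curve _ _).mul hγ')).continuousOn_integral

lemma abs_integral_flux_le {γ : ℝ → ℝ} {δ : ℝ} (hδ : ∀ x, |γ x| ≤ δ) (hγ : Continuous γ) {t : ℝ}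
    (ht : t ∈ Icc 0 T) :
    |∫ x, r t x * (w t x * γ x) ∂(roadMeasure ℓ)| ≤ M * (B * δ) * (roadMeasure ℓ).real univ :=
  (hr.mul ((hw.isBoundedL1Curve _ _).mul
    (.const hγ.aestronglyMeasurable (.of_forall hδ)))).abs_integral_le ht

include hT hℓ h

-- Testing with products `α(t) β(x)` reduces the weak formulation to the fundamental lemma in `t`.
lemma integral_mul_eq_integral_flux {β : ℝ → ℝ} (hβ : ContDiff ℝ 1 β) (hβℓ : β ℓ = 0) :
    EqOn (fun t => ∫ x, r t x * β x ∂(roadMeasure ℓ))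
      (fun t => ∫ s in 0..t, ∫ x, r s x * (w s x * deriv β x) ∂(roadMeasure ℓ)) (Icc 0 T) := by
  have hβ' : Continuous (deriv β) := hβ.continuous_deriv_one
  obtain ⟨_, hβ_curve⟩ := exists_isBoundedL1Curve_of_continuous T ℓ (g := fun _ => β)
    (hβ.continuous.comp continuous_snd)
  obtain ⟨_, hβ'_curve⟩ := exists_isBoundedL1Curve_of_continuous T ℓ (g := fun _ => deriv β)
    (hβ'.comp continuous_snd)
  have hmass := hr.mul hβ_curve
  have hflux := hr.mul ((hw.isBoundedL1Curve _ _).mul hβ'_curve)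
  refine eqOn_primitive_of_forall_test hT hmass.continuousOn_integral hflux.continuousOn_integral
    fun α hα hαT => ?_
  have htest := h (fun z => α z.1 * β z.2) ((hα.comp contDiff_fst).mul (hβ.comp contDiff_snd))
    (fun x _ => by simp [hαT]) (fun t _ => by simp [hβℓ])
  simp only [Pi.zero_apply, zero_mul, intervalIntegral.integral_zero, add_zero] at htest
  refine Eq.trans (intervalIntegral.integral_congr fun t ht => ?_) htest
  rw [uIcc_of_le hT.le] at ht
  rw [intervalIntegral_eq_integral_road hℓ, ← integral_const_mul, ← integral_const_mul,
    ← integral_add ((hmass.integrable ht).const_mul _) ((hflux.integrable ht).const_mul _)]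
  congr 1 with x
  rw [fderiv_mul_apply_of_separated (hα.differentiable one_ne_zero t)
    (hβ.differentiable one_ne_zero x), fderiv_mul_apply_of_separated
    (hα.differentiable one_ne_zero t) (hβ.differentiable one_ne_zero x)]
  ring

lemma integral_roadPrimitive_mul_eq {γ : ℝ → ℝ} (hγ : Continuous γ) {t : ℝ} (ht : t ∈ Icc 0 T) :
    ∫ x, roadPrimitive ℓ (r t) x * γ x ∂(roadMeasure ℓ)
      = -∫ s in 0..t, ∫ x, r s x * (w s x * γ x) ∂(roadMeasure ℓ) := by
  set β : ℝ → ℝ := fun x => ∫ y in ℓ..x, γ y with hβ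
  have hβγ (x : ℝ) : HasDerivAt β (γ x) x := (hγ.integral_hasStrictDerivAt ℓ x).hasDerivAt
  have hβ_deriv : deriv β = γ := funext fun x => (hβγ x).deriv
  have hβ_C1 : ContDiff ℝ 1 β :=
    contDiff_one_iff_deriv.2 ⟨fun x => (hβγ x).differentiableAt, hβ_deriv ▸ hγ⟩
  have hβℓ : β ℓ = 0 := by simp [hβ]
  have hmass := integral_mul_eq_integral_flux hT hℓ hr hw h hβ_C1 hβℓ ht
  beta_reduce at hmass
  rw [integral_mul_eq_neg_integral_roadPrimitive_mul hℓ (hr.integrable ht) hβ_C1 hβℓ,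
    hβ_deriv] at hmass
  rw [← hmass, neg_neg]

lemma hasDerivWithinAt_integral_roadPrimitive_mul {γ : ℝ → ℝ} (hγ : Continuous γ) {s : ℝ}
    (hs : s ∈ Icc 0 T) :
    HasDerivWithinAt (fun t => ∫ x, roadPrimitive ℓ (r t) x * γ x ∂(roadMeasure ℓ))
      (-∫ x, r s x * (w s x * γ x) ∂(roadMeasure ℓ)) (Icc 0 T) s := by
  have hflux := continuousOn_integral_flux hr hw hγ
  have : Fact (s ∈ Icc 0 T) := ⟨hs⟩
  have hprimitive := intervalIntegral.integral_hasDerivWithinAt_right (s := Icc 0 T) (t := Icc 0 T)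
    (hflux.mono (uIcc_subset_Icc (left_mem_Icc.2 hT.le) hs)).intervalIntegrable
    (hflux.stronglyMeasurableAtFilter_nhdsWithin measurableSet_Icc s) (hflux s hs)
  exact hprimitive.neg.congr (fun t ht => integral_roadPrimitive_mul_eq hT hℓ hr hw h hγ ht)
    (integral_roadPrimitive_mul_eq hT hℓ hr hw h hγ hs)

-- Test the equation for the increment of the primitive against the increment itself.
lemma integral_roadPrimitive_sub_sq_le {s t : ℝ} (hs : s ∈ Icc 0 T) (ht : t ∈ Icc 0 T) :
    ∫ x, (roadPrimitive ℓ (r t) x - roadPrimitive ℓ (r s) x) ^ 2 ∂(roadMeasure ℓ)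
      ≤ M * (B * ∫ y, |r t y - r s y| ∂(roadMeasure ℓ)) * (roadMeasure ℓ).real univ * |t - s| := by
  have hPt := continuous_roadPrimitive (hr.integrable ht)
  have hPs := continuous_roadPrimitive (hr.integrable hs)
  set γ : ℝ → ℝ := fun x => roadPrimitive ℓ (r t) x - roadPrimitive ℓ (r s) x
  have hγ : Continuous γ := hPt.sub hPs
  have hflux := continuousOn_integral_flux hr hw hγ
  have h0 : (0 : ℝ) ∈ Icc 0 T := left_mem_Icc.2 hT.le
  have htested : ∫ x, γ x ^ 2 ∂(roadMeasure ℓ)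
      = -∫ τ in s..t, ∫ x, r τ x * (w τ x * γ x) ∂(roadMeasure ℓ) :=
    calc ∫ x, γ x ^ 2 ∂(roadMeasure ℓ)
        = ∫ x, roadPrimitive ℓ (r t) x * γ x - roadPrimitive ℓ (r s) x * γ x
            ∂(roadMeasure ℓ) := by
          congr 1 with x
          rw [← sub_mul, sq]
      _ = _ := by
          rw [integral_sub (integrable_road_of_continuous (by fun_prop))
              (integrable_road_of_continuous (by fun_prop)),
            integral_roadPrimitive_mul_eq hT hℓ hr hw h hγ ht,
            integral_roadPrimitive_mul_eq hT hℓ hr hw h hγ hs,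
            ← intervalIntegral.integral_interval_sub_left (a := 0)
              (hflux.mono (uIcc_subset_Icc h0 ht)).intervalIntegrable
              (hflux.mono (uIcc_subset_Icc h0 hs)).intervalIntegrable]
          ring
  rw [htested]
  refine (neg_le_abs _).trans ?_
  rw [← Real.norm_eq_abs]
  refine intervalIntegral.norm_integral_le_of_norm_le_const fun τ hτ => ?_
  exact abs_integral_flux_le hr hw (hr.abs_roadPrimitive_sub_le hs ht) hγ
    (uIcc_subset_Icc hs ht (uIoc_subset_uIcc hτ))

lemma hasDerivWithinAt_integral_roadPrimitive_sub_sq {s : ℝ} (hs : s ∈ Icc 0 T) :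
    HasDerivWithinAt
      (fun t => ∫ x, (roadPrimitive ℓ (r t) x - roadPrimitive ℓ (r s) x) ^ 2 ∂(roadMeasure ℓ)) 0
      (Icc 0 T) s := by
  have hlim : Tendsto (fun t => M * (B * ∫ y, |r t y - r s y| ∂(roadMeasure ℓ)) *
      (roadMeasure ℓ).real univ) (𝓝[Icc 0 T] s) (𝓝 0) := by
    simpa using (((hr.tendsto s hs).const_mul B).const_mul M).mul_const ((roadMeasure ℓ).real univ)
  rw [hasDerivWithinAt_iff_isLittleO, Asymptotics.isLittleO_iff]
  intro c hc
  filter_upwards [self_mem_nhdsWithin, hlim.eventually_lt_const hc] with t ht htc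
  simp only [sub_self, ne_eq, OfNat.ofNat_ne_zero, not_false_eq_true, zero_pow, integral_zero,
    smul_zero, sub_zero, Real.norm_eq_abs]
  rw [abs_of_nonneg (integral_nonneg fun x => sq_nonneg _)]
  exact (integral_roadPrimitive_sub_sq_le hT hℓ hr hw h hs ht).trans
    (mul_le_mul_of_nonneg_right htc.le (abs_nonneg _))

-- Differentiate `P(t)² = 2 P(t) P(s) - P(s)² + (P(t) - P(s))²` at `t = s`.
lemma hasDerivWithinAt_integral_roadPrimitive_sq {s : ℝ} (hs : s ∈ Icc 0 T) :
    HasDerivWithinAt (fun t => ∫ x, roadPrimitive ℓ (r t) x ^ 2 ∂(roadMeasure ℓ))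
      (-(2 * ∫ x, r s x * (w s x * roadPrimitive ℓ (r s) x) ∂(roadMeasure ℓ))) (Icc 0 T) s := by
  have hP {t : ℝ} (ht : t ∈ Icc 0 T) := continuous_roadPrimitive (hr.integrable ht)
  have hsplit {t : ℝ} (ht : t ∈ Icc 0 T) : ∫ x, roadPrimitive ℓ (r t) x ^ 2 ∂(roadMeasure ℓ)
      = 2 * (∫ x, roadPrimitive ℓ (r t) x * roadPrimitive ℓ (r s) x ∂(roadMeasure ℓ))
        - (∫ x, roadPrimitive ℓ (r s) x ^ 2 ∂(roadMeasure ℓ))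
        + ∫ x, (roadPrimitive ℓ (r t) x - roadPrimitive ℓ (r s) x) ^ 2 ∂(roadMeasure ℓ) := by
    rw [← integral_const_mul, ← integral_sub, ← integral_add]
    · congr 1 with x
      ring
    all_goals
      have := hP ht
      have := hP hs
      exact integrable_road_of_continuous (by fun_prop)
  have hderiv := (((hasDerivWithinAt_integral_roadPrimitive_mul hT hℓ hr hw h (hP hs) hs).const_mul
    2).sub_const (∫ x, roadPrimitive ℓ (r s) x ^ 2 ∂(roadMeasure ℓ))).add
    (hasDerivWithinAt_integral_roadPrimitive_sub_sq hT hℓ hr hw h hs)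
  rw [add_zero, mul_neg] at hderiv
  exact hderiv.congr (fun t ht => hsplit ht) (hsplit hs)

theorem ae_eq_zero_of_isWeakSolution_zero {t : ℝ} (ht : t ∈ Icc 0 T) :
    r t =ᵐ[roadMeasure ℓ] 0 := by
  set E : ℝ → ℝ := fun t => ∫ x, roadPrimitive ℓ (r t) x ^ 2 ∂(roadMeasure ℓ)
  have h0 : (0 : ℝ) ∈ Icc 0 T := left_mem_Icc.2 hT.le
  have hE_zero : E 0 = 0 := by
    simpa [E, pow_two] using integral_roadPrimitive_mul_eq hT hℓ hr hw h
      (continuous_roadPrimitive (hr.integrable h0)) h0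
  have hE_deriv {s : ℝ} (hs : s ∈ Icc 0 T) :=
    hasDerivWithinAt_integral_roadPrimitive_sq hT hℓ hr hw h hs
  have hgronwall := le_gronwallBound_of_liminf_deriv_right_le (f := E) (δ := 0) (K := K) (ε := 0)
    (fun s hs => (hE_deriv hs).continuousWithinAt)
    (fun s hs c hc => by
      have hright := (hE_deriv (Ico_subset_Icc_self hs)).mono_of_mem_nhdsWithin
        (Icc_mem_nhdsGE_of_mem hs)
      simpa [slope_def_field, div_eq_inv_mul] using hright.liminf_right_slope_le hc)
    hE_zero.le
    (fun s hs => by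
      rw [add_zero]
      exact neg_integral_flux_le hℓ (hr.integrable (Ico_subset_Icc_self hs)) (hw.lipschitz s)
        (hw.nonneg s ℓ)) t ht
  rw [gronwallBound_ε0_δ0] at hgronwall
  exact ae_eq_zero_of_integral_roadPrimitive_sq_eq_zero (hr.integrable ht)
    (hgronwall.antisymm (integral_nonneg fun _ => sq_nonneg _))

end ZeroData

/-- The derivative `∂ₜ φ + w ∂ₓ φ` of `φ` along the trajectories of `w`. -/
noncomputable def materialDeriv (w : ℝ → ℝ → ℝ) (φ : ℝ × ℝ → ℝ) (t x : ℝ) : ℝ :=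
  fderiv ℝ φ (t, x) (1, 0) + w t x * fderiv ℝ φ (t, x) (0, 1)

lemma continuous_materialDeriv (hw : Continuous fun z : ℝ × ℝ => w z.1 z.2) {φ : ℝ × ℝ → ℝ}
    (hφ : ContDiff ℝ 1 φ) : Continuous fun z : ℝ × ℝ => materialDeriv w φ z.1 z.2 := by
  have hφ' : Continuous (fderiv ℝ φ) := hφ.continuous_fderiv one_ne_zero
  exact (hφ'.clm_apply continuous_const).add (hw.mul (hφ'.clm_apply continuous_const))

lemma isWeakSolution_iff_materialDeriv {r₀ u : ℝ → ℝ} :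
    IsWeakSolution T ℓ w r₀ u r ↔ ∀ φ : ℝ × ℝ → ℝ, ContDiff ℝ 1 φ →
      (∀ x ∈ Icc 0 ℓ, φ (T, x) = 0) → (∀ t ∈ Icc 0 T, φ (t, ℓ) = 0) →
      (∫ t in 0..T, ∫ x in 0..ℓ, r t x * materialDeriv w φ t x)
        + (∫ x in 0..ℓ, r₀ x * φ (0, x)) + (∫ t in 0..T, u t * φ (t, 0)) = 0 :=
  Iff.rfl

lemma IsWeakSolution.sub (hT : 0 ≤ T) (hℓ : 0 ≤ ℓ) {M' : ℝ} {r' : ℝ → ℝ → ℝ} {r₀ u : ℝ → ℝ}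
    (hw : Continuous fun z : ℝ × ℝ => w z.1 z.2)
    (hr : IsBoundedL1Curve (Icc 0 T) (roadMeasure ℓ) M r)
    (hr' : IsBoundedL1Curve (Icc 0 T) (roadMeasure ℓ) M' r')
    (h : IsWeakSolution T ℓ w r₀ u r) (h' : IsWeakSolution T ℓ w r₀ u r') :
    IsWeakSolution T ℓ w 0 0 fun t x => r t x - r' t x := by
  rw [isWeakSolution_iff_materialDeriv] at h h' ⊢
  intro φ hφ hφT hφℓ
  obtain ⟨_, hφ_curve⟩ := exists_isBoundedL1Curve_of_continuous T ℓ (continuous_materialDeriv hw hφ)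
  have hi {N : ℝ} {f : ℝ → ℝ → ℝ} (hf : IsBoundedL1Curve (Icc 0 T) (roadMeasure ℓ) N f) :
      IntervalIntegrable (fun t => ∫ x, f t x * materialDeriv w φ t x ∂(roadMeasure ℓ))
        volume 0 T :=
    ContinuousOn.intervalIntegrable_of_Icc hT (hf.mul hφ_curve).continuousOn_integral
  have hsub : ∫ t in 0..T, ∫ x in 0..ℓ, (r t x - r' t x) * materialDeriv w φ t x
      = (∫ t in 0..T, ∫ x in 0..ℓ, r t x * materialDeriv w φ t x)
        - ∫ t in 0..T, ∫ x in 0..ℓ, r' t x * materialDeriv w φ t x := by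
    simp only [intervalIntegral_eq_integral_road hℓ]
    rw [← intervalIntegral.integral_sub (hi hr) (hi hr')]
    refine intervalIntegral.integral_congr fun t ht => ?_
    rw [uIcc_of_le hT] at ht
    simp only [sub_mul]
    exact integral_sub ((hr.mul hφ_curve).integrable ht) ((hr'.mul hφ_curve).integrable ht)
  have hφr := h φ hφ hφT hφℓ
  have hφr' := h' φ hφ hφT hφℓ
  simp only [hsub, Pi.zero_apply, zero_mul, intervalIntegral.integral_zero, add_zero]
  linarith

theorem IsWeakSolution.ae_eq (hT : 0 < T) (hℓ : 0 ≤ ℓ) {M' : ℝ} {r' : ℝ → ℝ → ℝ} {r₀ u : ℝ → ℝ}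
    (hw : IsForwardVelocity a B K w) (hr : IsBoundedL1Curve (Icc 0 T) (roadMeasure ℓ) M r)
    (hr' : IsBoundedL1Curve (Icc 0 T) (roadMeasure ℓ) M' r') (h : IsWeakSolution T ℓ w r₀ u r)
    (h' : IsWeakSolution T ℓ w r₀ u r') {t : ℝ} (ht : t ∈ Icc 0 T) :
    r t =ᵐ[roadMeasure ℓ] r' t := by
  filter_upwards [ae_eq_zero_of_isWeakSolution_zero hT hℓ (hr.sub hr') hw
    (h.sub hT.le hℓ hw.continuous hr hr' h') ht] with x hx using sub_eq_zero.1 hx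

lemma IsWeakSolution.congr (hT : 0 ≤ T) (hℓ : 0 ≤ ℓ) {w' r' : ℝ → ℝ → ℝ} {r₀ r₀' u u' : ℝ → ℝ}
    (h : IsWeakSolution T ℓ w r₀ u r) (hw : ∀ t ∈ Icc 0 T, EqOn (w' t) (w t) (Icc 0 ℓ))
    (hr : ∀ t ∈ Icc 0 T, r' t =ᵐ[roadMeasure ℓ] r t) (hr₀ : r₀' =ᵐ[roadMeasure ℓ] r₀)
    (hu : u' =ᵐ[roadMeasure T] u) : IsWeakSolution T ℓ w' r₀' u' r' := by
  intro φ hφ hφT hφℓ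
  refine Eq.trans (congrArg₂ _ (congrArg₂ _ ?_ ?_) ?_) (h φ hφ hφT hφℓ)
  · refine intervalIntegral.integral_congr fun t ht => ?_
    rw [uIcc_of_le hT] at ht
    simp only [intervalIntegral_eq_integral_road hℓ]
    refine integral_congr_ae ?_
    filter_upwards [hr t ht, ae_restrict_mem measurableSet_Ioo] with x hx hx_road
    rw [hx, hw t ht (Ioo_subset_Icc_self hx_road)]
  · simp only [intervalIntegral_eq_integral_road hℓ]
    refine integral_congr_ae ?_
    filter_upwards [hr₀] with x hx
    rw [hx]
  · simp only [intervalIntegral_eq_integral_road hT]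
    refine integral_congr_ae ?_
    filter_upwards [hu] with x hx
    rw [hx]

end Uniqueness

/-! ### Characteristics -/

/-- `X` is an integral curve of the velocity field `w` on `[0,T]`. -/
def IsTrajectory (T : ℝ) (w : ℝ → ℝ → ℝ) (X : ℝ → ℝ) : Prop :=
  ∀ t ∈ Icc 0 T, HasDerivAt X (w t (X t)) t

/-- The integral curve of `w` on `[0,T]` through `y` at time `0`, constant if there is none. -/
noncomputable def flow (T : ℝ) (w : ℝ → ℝ → ℝ) (y : ℝ) : ℝ → ℝ :=
  open Classical in
  if h : ∃ X : ℝ → ℝ, X 0 = y ∧ IsTrajectory T w X then h.choose else fun _ => y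

/-- The position at time `0` of the characteristic with label `y`: labels `y ≥ 0` sit at `y`, a
label `y < 0` enters the road at time `-y`. -/
noncomputable def startPoint (w : ℝ → ℝ → ℝ) (y : ℝ) : ℝ :=
  max y 0 - ∫ s in 0..max (-y) 0, w s 0

/-- The characteristic of `w` with label `y`. Labels run through `(-T, ℓ)`: the nonnegative ones
carry the initial datum, the negative ones the inflow. -/
noncomputable def characteristic (T : ℝ) (w : ℝ → ℝ → ℝ) (t y : ℝ) : ℝ :=
  flow T w (startPoint w y) t

/-- The antilipschitz constant of the characteristics of a velocity field that is bounded below by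
`a` and `K`-Lipschitz in space. -/
noncomputable def charConst (T a : ℝ) (K : ℝ≥0) : ℝ≥0 :=
  Real.toNNReal (Real.exp (K * T) / min 1 a)

variable {T a B : ℝ} {K : ℝ≥0} {w w' : ℝ → ℝ → ℝ}

namespace IsTrajectory
variable {X X' : ℝ → ℝ} {s t : ℝ}

lemma continuousOn (h : IsTrajectory T w X) : ContinuousOn X (Icc 0 T) :=
  fun t ht => (h t ht).continuousAt.continuousWithinAt

lemma mono {T' : ℝ} (h : IsTrajectory T w X) (hT : T' ≤ T) : IsTrajectory T' w X :=
  fun t ht => h t ⟨ht.1, ht.2.trans hT⟩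

lemma dist_le_forward (hw : ∀ t, LipschitzWith K (w t)) (h : IsTrajectory T w X)
    (h' : IsTrajectory T w X') (hs : 0 ≤ s) (hst : s ≤ t) (ht : t ≤ T) :
    |X t - X' t| ≤ Real.exp (K * (t - s)) * |X s - X' s| := by
  rw [mul_comm]
  exact dist_le_of_trajectories_ODE hw (h.continuousOn.mono (Icc_subset_Icc hs ht))
    (fun τ hτ => (h τ ⟨hs.trans hτ.1, hτ.2.le.trans ht⟩).hasDerivWithinAt)
    (h'.continuousOn.mono (Icc_subset_Icc hs ht))
    (fun τ hτ => (h' τ ⟨hs.trans hτ.1, hτ.2.le.trans ht⟩).hasDerivWithinAt) le_rfl t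
    ⟨hst, le_rfl⟩

lemma hasDerivAt_reverse (h : IsTrajectory T w X) (hs : 0 ≤ s) (ht : t ≤ T) {τ : ℝ}
    (hτ : τ ∈ Icc 0 (t - s)) :
    HasDerivAt (fun τ => X (t - τ)) (-w (t - τ) (X (t - τ))) τ := by
  have hX := h (t - τ) ⟨by linarith [hτ.2], by linarith [hτ.1]⟩
  simpa only [Function.comp_def, mul_neg, mul_one] using
    hX.comp τ ((hasDerivAt_id τ).const_sub t)

lemma dist_le_backward (hw : ∀ t, LipschitzWith K (w t)) (h : IsTrajectory T w X)
    (h' : IsTrajectory T w X') (hs : 0 ≤ s) (hst : s ≤ t) (ht : t ≤ T) :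
    |X s - X' s| ≤ Real.exp (K * (t - s)) * |X t - X' t| := by
  have hdist := dist_le_of_trajectories_ODE (v := fun τ x => -w (t - τ) x) (a := 0) (b := t - s)
    (fun τ => (hw (t - τ)).neg)
    (fun τ hτ => (h.hasDerivAt_reverse hs ht hτ).continuousAt.continuousWithinAt)
    (fun τ hτ => (h.hasDerivAt_reverse hs ht (Ico_subset_Icc_self hτ)).hasDerivWithinAt)
    (fun τ hτ => (h'.hasDerivAt_reverse hs ht hτ).continuousAt.continuousWithinAt)
    (fun τ hτ => (h'.hasDerivAt_reverse hs ht (Ico_subset_Icc_self hτ)).hasDerivWithinAt) le_rfl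
    (t - s) ⟨sub_nonneg.2 hst, le_rfl⟩
  simpa [Real.dist_eq, mul_comm] using hdist

lemma dist_le (hw : ∀ t, LipschitzWith K (w t)) (h : IsTrajectory T w X)
    (h' : IsTrajectory T w X') (hs : s ∈ Icc 0 T) (ht : t ∈ Icc 0 T) :
    |X s - X' s| ≤ Real.exp (K * |t - s|) * |X t - X' t| := by
  rcases le_total s t with hst | hts
  · rw [abs_of_nonneg (sub_nonneg.2 hst)]
    exact h.dist_le_backward hw h' hs.1 hst ht.2
  · rw [abs_sub_comm t s, abs_of_nonneg (sub_nonneg.2 hts)]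
    exact h.dist_le_forward hw h' ht.1 hts hs.2

lemma eq_of_eq (hw : ∀ t, LipschitzWith K (w t)) (h : IsTrajectory T w X)
    (h' : IsTrajectory T w X') (hs : s ∈ Icc 0 T) (ht : t ∈ Icc 0 T) (heq : X t = X' t) :
    X s = X' s := by
  have hdist := h.dist_le hw h' hs ht
  rw [heq, sub_self, abs_zero, mul_zero] at hdist
  exact sub_eq_zero.1 (abs_nonpos_iff.1 hdist)

lemma dist_le_of_approx {ε : ℝ} (hw : ∀ t, LipschitzWith K (w t)) (h : IsTrajectory T w X)
    (h' : IsTrajectory T w' X') (hε : ∀ t ∈ Icc 0 T, ∀ x, |w' t x - w t x| ≤ ε)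
    (ht : t ∈ Icc 0 T) : |X t - X' t| ≤ gronwallBound |X 0 - X' 0| K ε t := by
  have hdist := dist_le_of_approx_trajectories_ODE (a := 0) (b := T) (εf := 0) (εg := ε)
    (δ := |X 0 - X' 0|) hw h.continuousOn
    (fun τ hτ => (h τ (Ico_subset_Icc_self hτ)).hasDerivWithinAt)
    (fun τ _ => by simp) h'.continuousOn
    (fun τ hτ => (h' τ (Ico_subset_Icc_self hτ)).hasDerivWithinAt)
    (fun τ hτ => hε τ (Ico_subset_Icc_self hτ) _) le_rfl t ht
  simpa [Real.dist_eq] using hdist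

lemma hasDerivAt_of_mem_interior (h : IsTrajectory T w X) (hs : 0 ≤ s) (ht : t ≤ T) {τ : ℝ}
    (hτ : τ ∈ interior (Icc s t)) : HasDerivAt X (w τ (X τ)) τ :=
  h τ (Icc_subset_Icc hs ht (interior_subset hτ))

lemma mul_sub_le (hw : ∀ t x, a ≤ w t x) (h : IsTrajectory T w X) (hs : 0 ≤ s) (hst : s ≤ t)
    (ht : t ≤ T) : a * (t - s) ≤ X t - X s :=
  (convex_Icc s t).mul_sub_le_image_sub_of_le_deriv
    (h.continuousOn.mono (Icc_subset_Icc hs ht))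
    (fun _ hτ => (h.hasDerivAt_of_mem_interior hs ht hτ).differentiableAt.differentiableWithinAt)
    (fun _ hτ => (hw _ _).trans_eq (h.hasDerivAt_of_mem_interior hs ht hτ).deriv.symm)
    s (left_mem_Icc.2 hst) t (right_mem_Icc.2 hst) hst

lemma sub_le_mul (hw : ∀ t x, w t x ≤ B) (h : IsTrajectory T w X) (hs : 0 ≤ s) (hst : s ≤ t)
    (ht : t ≤ T) : X t - X s ≤ B * (t - s) :=
  (convex_Icc s t).image_sub_le_mul_sub_of_deriv_le
    (h.continuousOn.mono (Icc_subset_Icc hs ht))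
    (fun _ hτ => (h.hasDerivAt_of_mem_interior hs ht hτ).differentiableAt.differentiableWithinAt)
    (fun _ hτ => (h.hasDerivAt_of_mem_interior hs ht hτ).deriv.trans_le (hw _ _))
    s (left_mem_Icc.2 hst) t (right_mem_Icc.2 hst) hst

end IsTrajectory

namespace IsForwardVelocity

lemma upper_nonneg (hw : IsForwardVelocity a B K w) : 0 ≤ B :=
  (abs_nonneg _).trans (hw.abs_le 0 0)

lemma exists_isTrajectory (hw : IsForwardVelocity a B K w) (hT : 0 < T) (y : ℝ) :
    ∃ X : ℝ → ℝ, X 0 = y ∧ IsTrajectory T w X := by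
  have hzero : (0 : ℝ) ∈ Icc (-1) (T + 1) := ⟨by norm_num, by linarith⟩
  have hpicard : IsPicardLindelof w (⟨0, hzero⟩ : Icc (-1 : ℝ) (T + 1)) y
      (⟨B * (T + 1), mul_nonneg hw.upper_nonneg (by linarith)⟩ : ℝ≥0) 0
      ⟨B, hw.upper_nonneg⟩ K := by
    refine ⟨fun t _ => (hw.lipschitz t).lipschitzOnWith,
      fun x _ => (hw.continuous_time x).continuousOn, fun t _ x _ => hw.abs_le t x, ?_⟩
    simp only [NNReal.coe_zero, sub_zero]
    exact mul_le_mul_of_nonneg_left (max_le le_rfl (by linarith)) hw.upper_nonneg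
  obtain ⟨X, hX0, hX⟩ := hpicard.exists_eq_forall_mem_Icc_hasDerivWithinAt (x := y) (by simp)
  exact ⟨X, hX0, fun t ht => (hX t ⟨by linarith [ht.1], by linarith [ht.2]⟩).hasDerivAt
    (Icc_mem_nhds (by linarith [ht.1]) (by linarith [ht.2]))⟩

lemma flow_zero (hw : IsForwardVelocity a B K w) (hT : 0 < T) (y : ℝ) : flow T w y 0 = y := by
  have h := hw.exists_isTrajectory hT y
  rw [flow, dif_pos h]
  exact h.choose_spec.1

lemma isTrajectory_flow (hw : IsForwardVelocity a B K w) (hT : 0 < T) (y : ℝ) :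
    IsTrajectory T w (flow T w y) := by
  have h := hw.exists_isTrajectory hT y
  rw [flow, dif_pos h]
  exact h.choose_spec.2

lemma continuous_flow (hw : IsForwardVelocity a B K w) (hT : 0 < T) {t : ℝ} (ht : t ∈ Icc 0 T) :
    Continuous fun y => flow T w y t := by
  refine (LipschitzWith.of_dist_le_mul (K := Real.toNNReal (Real.exp (K * t)))
    fun y y' => ?_).continuous
  have hdist := (hw.isTrajectory_flow hT y).dist_le_forward hw.lipschitz
    (hw.isTrajectory_flow hT y') le_rfl ht.1 ht.2
  rw [Real.coe_toNNReal _ (Real.exp_nonneg _)]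
  rwa [hw.flow_zero hT, hw.flow_zero hT, sub_zero] at hdist

lemma surjective_flow (hw : IsForwardVelocity a B K w) (hT : 0 < T) {t : ℝ}
    (ht : t ∈ Icc 0 T) : Function.Surjective fun y => flow T w y t := by
  have hlower (y : ℝ) : y ≤ flow T w y t := by
    have h := (hw.isTrajectory_flow hT y).mul_sub_le hw.nonneg le_rfl ht.1 ht.2
    rw [hw.flow_zero hT] at h
    linarith
  have hupper (y : ℝ) : flow T w y t ≤ y + B * t := by
    have h := (hw.isTrajectory_flow hT y).sub_le_mul hw.upper le_rfl ht.1 ht.2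
    rw [hw.flow_zero hT, sub_zero] at h
    linarith
  exact (hw.continuous_flow hT ht).surjective (tendsto_atTop_mono hlower tendsto_id)
    (tendsto_atBot_mono hupper (tendsto_id.atBot_add tendsto_const_nhds))

lemma intervalIntegrable (hw : IsForwardVelocity a B K w) (x s t : ℝ) :
    IntervalIntegrable (fun τ => w τ x) volume s t :=
  (hw.continuous_time x).intervalIntegrable _ _

lemma mul_sub_le_integral (hw : IsForwardVelocity a B K w) (x : ℝ) {s t : ℝ} (hst : s ≤ t) :
    a * (t - s) ≤ ∫ τ in s..t, w τ x := by
  simpa [mul_comm] using intervalIntegral.integral_mono_on hst (intervalIntegrable_const (c := a))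
    (hw.intervalIntegrable x s t) (fun τ _ => hw.lower τ x)

lemma continuous_startPoint (hw : IsForwardVelocity a B K w) : Continuous (startPoint w) := by
  have : Continuous fun s => ∫ τ in 0..s, w τ 0 :=
    intervalIntegral.continuous_primitive (fun s t => hw.intervalIntegrable 0 s t) 0
  exact (continuous_id.max continuous_const).sub
    (this.comp (continuous_neg.max continuous_const))

lemma le_startPoint_sub (hw : IsForwardVelocity a B K w) {y y' : ℝ} (h : y ≤ y') :
    min 1 a * (y' - y) ≤ startPoint w y' - startPoint w y := by
  have hneg : max (-y') 0 ≤ max (-y) 0 := max_le_max (neg_le_neg h) le_rfl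
  have hpos : max y 0 ≤ max y' 0 := max_le_max h le_rfl
  have hinflow : a * (max (-y) 0 - max (-y') 0)
      ≤ (∫ s in 0..max (-y) 0, w s 0) - ∫ s in 0..max (-y') 0, w s 0 := by
    rw [intervalIntegral.integral_interval_sub_left (hw.intervalIntegrable 0 0 _)
      (hw.intervalIntegrable 0 0 _)]
    exact hw.mul_sub_le_integral 0 hneg
  have hparts (z : ℝ) : z = max z 0 - max (-z) 0 := by
    simpa only [posPart_def, negPart_def] using (posPart_sub_negPart z).symm
  calc min 1 a * (y' - y)
      = min 1 a * (max y' 0 - max y 0) + min 1 a * (max (-y) 0 - max (-y') 0) := by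
        nth_rewrite 1 [hparts y', hparts y]
        ring
    _ ≤ 1 * (max y' 0 - max y 0) + a * (max (-y) 0 - max (-y') 0) :=
        add_le_add (mul_le_mul_of_nonneg_right (min_le_left _ _) (sub_nonneg.2 hpos))
          (mul_le_mul_of_nonneg_right (min_le_right _ _) (sub_nonneg.2 hneg))
    _ ≤ startPoint w y' - startPoint w y := by
        unfold startPoint
        linarith

lemma mul_abs_sub_le_abs_startPoint_sub (hw : IsForwardVelocity a B K w) (y y' : ℝ) :
    min 1 a * |y - y'| ≤ |startPoint w y - startPoint w y'| := by
  wlog h : y' ≤ y generalizing y y'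
  · simpa only [abs_sub_comm] using this y' y (le_of_not_ge h)
  · rw [abs_of_nonneg (sub_nonneg.2 h)]
    exact (hw.le_startPoint_sub h).trans (le_abs_self _)

lemma isTrajectory_characteristic (hw : IsForwardVelocity a B K w) (hT : 0 < T) (y : ℝ) :
    IsTrajectory T w fun t => characteristic T w t y :=
  hw.isTrajectory_flow hT _

lemma continuous_characteristic (hw : IsForwardVelocity a B K w) (hT : 0 < T) {t : ℝ}
    (ht : t ∈ Icc 0 T) : Continuous (characteristic T w t) :=
  (hw.continuous_flow hT ht).comp hw.continuous_startPoint

lemma antilipschitz_characteristic (hw : IsForwardVelocity a B K w) (hT : 0 < T) {t : ℝ}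
    (ht : t ∈ Icc 0 T) : AntilipschitzWith (charConst T a K) (characteristic T w t) := by
  have hmin : 0 < min 1 a := lt_min one_pos hw.pos
  refine AntilipschitzWith.of_le_mul_dist fun y y' => ?_
  rw [charConst, Real.coe_toNNReal _ (by positivity), Real.dist_eq, Real.dist_eq,
    div_mul_eq_mul_div, le_div_iff₀ hmin, mul_comm]
  have hback := (hw.isTrajectory_characteristic hT y).dist_le_backward hw.lipschitz
    (hw.isTrajectory_characteristic hT y') le_rfl ht.1 ht.2
  simp only [characteristic, hw.flow_zero hT, sub_zero] at hback
  calc min 1 a * |y - y'| ≤ |startPoint w y - startPoint w y'| :=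
        hw.mul_abs_sub_le_abs_startPoint_sub y y'
    _ ≤ Real.exp (K * t) * |characteristic T w t y - characteristic T w t y'| := hback
    _ ≤ Real.exp (K * T) * |characteristic T w t y - characteristic T w t y'| := by
        gcongr
        exact ht.2

lemma exists_transition (hw : IsForwardVelocity a B K w) (hT : 0 < T) {s t : ℝ}
    (hs : s ∈ Icc 0 T) (ht : t ∈ Icc 0 T) : ∃ Y : ℝ → ℝ, Continuous Y ∧
      AntilipschitzWith (Real.toNNReal (Real.exp (K * |t - s|))) Y ∧
      ∀ y, characteristic T w t y = Y (characteristic T w s y) := by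
  obtain ⟨label, hlabel⟩ := (hw.surjective_flow hT hs).hasRightInverse
  have hdist {s t : ℝ} (hs : s ∈ Icc 0 T) (ht : t ∈ Icc 0 T) (y y' : ℝ) :
      |flow T w y s - flow T w y' s| ≤ Real.exp (K * |t - s|) * |flow T w y t - flow T w y' t| :=
    (hw.isTrajectory_flow hT y).dist_le hw.lipschitz (hw.isTrajectory_flow hT y') hs ht
  refine ⟨fun x => flow T w (label x) t, ?_, ?_, fun y => ?_⟩
  · refine (LipschitzWith.of_dist_le_mul (K := Real.toNNReal (Real.exp (K * |s - t|)))
      fun x x' => ?_).continuous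
    rw [Real.coe_toNNReal _ (Real.exp_nonneg _)]
    simpa only [hlabel _, Real.dist_eq] using hdist ht hs (label x) (label x')
  · refine AntilipschitzWith.of_le_mul_dist fun x x' => ?_
    rw [Real.coe_toNNReal _ (Real.exp_nonneg _)]
    simpa only [hlabel _, Real.dist_eq] using hdist hs ht (label x) (label x')
  · exact (hw.isTrajectory_characteristic hT y).eq_of_eq hw.lipschitz
      (hw.isTrajectory_flow hT _) ht hs (hlabel _).symm

-- Left of the entrance the velocity does not depend on the position, so `t ↦ -∫ τ in t..s, w τ 0`
-- is the characteristic that reaches the entrance at time `s`.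
lemma characteristic_neg_self (hw : IsForwardVelocity a B K w) (hT : 0 < T) {s : ℝ}
    (hs : s ∈ Icc 0 T) : characteristic T w s (-s) = 0 := by
  set X : ℝ → ℝ := fun t => ∫ τ in s..t, w τ 0 with hX
  have hX_nonpos : ∀ t ∈ Icc 0 s, X t ≤ 0 := fun t ht => by
    have h := hw.mul_sub_le_integral 0 ht.2
    rw [intervalIntegral.integral_symm] at h
    linarith [mul_nonneg hw.pos.le (sub_nonneg.2 ht.2)]
  have hX_traj : IsTrajectory s w X := fun t ht => by
    rw [hw.eq_entrance t _ (hX_nonpos t ht)]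
    exact intervalIntegral.integral_hasDerivAt_right (hw.intervalIntegrable 0 s t)
      ((hw.continuous_time 0).stronglyMeasurableAtFilter _ _)
      (hw.continuous_time 0).continuousAt
  have hstart : characteristic T w 0 (-s) = X 0 := by
    have hX0 : X 0 = -∫ τ in 0..s, w τ 0 := intervalIntegral.integral_symm _ _
    rw [characteristic, hw.flow_zero hT, hX0]
    simp [startPoint, hs.1]
  refine (((hw.isTrajectory_characteristic hT (-s)).mono hs.2).eq_of_eq hw.lipschitz hX_traj
    (right_mem_Icc.2 hs.1) (left_mem_Icc.2 hs.1) hstart).trans ?_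
  simp [hX]

lemma characteristic_zero (hw : IsForwardVelocity a B K w) (hT : 0 < T) {y : ℝ} (hy : 0 ≤ y) :
    characteristic T w 0 y = y := by
  rw [characteristic, hw.flow_zero hT]
  simp [startPoint, hy]

lemma characteristic_max_neg (hw : IsForwardVelocity a B K w) (hT : 0 < T) {y : ℝ}
    (hy : -T ≤ y) : characteristic T w (max (-y) 0) y = max y 0 := by
  rcases le_total 0 y with h | h
  · rw [max_eq_right (by linarith), max_eq_left h, hw.characteristic_zero hT h]
  · rw [max_eq_left (by linarith), max_eq_right h]
    simpa only [neg_neg] using hw.characteristic_neg_self hT (s := -y) ⟨by linarith, by linarith⟩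

lemma characteristic_nonpos (hw : IsForwardVelocity a B K w) (hT : 0 < T) {t y : ℝ}
    (ht : 0 ≤ t) (hy : -T ≤ y) (hty : y ≤ -t) : characteristic T w t y ≤ 0 := by
  have hmono := (hw.isTrajectory_characteristic hT y).mul_sub_le hw.nonneg ht
    (le_neg.2 hty) (neg_le.2 hy)
  have hentry := hw.characteristic_neg_self hT (s := -y) ⟨by linarith, by linarith⟩
  rw [neg_neg] at hentry
  linarith

lemma characteristic_pos (hw : IsForwardVelocity a B K w) (hT : 0 < T) {t y : ℝ}
    (ht : t ∈ Icc 0 T) (hy : -T ≤ y) (hty : -t < y) : 0 < characteristic T w t y := by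
  have hentry : max (-y) 0 ≤ t := max_le (by linarith) ht.1
  have hmono := (hw.isTrajectory_characteristic hT y).mul_sub_le hw.lower (le_max_right _ _)
    hentry ht.2
  rw [hw.characteristic_max_neg hT hy] at hmono
  rcases le_or_gt y 0 with h | h
  · have : 0 < a * (t - max (-y) 0) := mul_pos hw.pos <| by
      rw [max_eq_left (by linarith)]
      linarith
    linarith [le_max_right y 0]
  · linarith [le_max_left y 0, mul_nonneg hw.pos.le (sub_nonneg.2 hentry)]

lemma abs_startPoint_sub_le {a' B' : ℝ} {K' : ℝ≥0} (hw : IsForwardVelocity a B K w)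
    (hw' : IsForwardVelocity a' B' K' w') {ε : ℝ}
    (hε : ∀ t ∈ Icc 0 T, ∀ x, |w' t x - w t x| ≤ ε) {y : ℝ} (hy : -T ≤ y) (hT : 0 ≤ T) :
    |startPoint w y - startPoint w' y| ≤ ε * T := by
  have hε_nonneg : 0 ≤ ε := (abs_nonneg _).trans (hε 0 ⟨le_rfl, hT⟩ 0)
  have hentry : 0 ≤ max (-y) 0 := le_max_right _ _
  have hentry_le : max (-y) 0 ≤ T := max_le (by linarith) hT
  have hdiff : startPoint w y - startPoint w' y = ∫ s in 0..max (-y) 0, (w' s 0 - w s 0) := by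
    rw [intervalIntegral.integral_sub (hw'.intervalIntegrable 0 0 _) (hw.intervalIntegrable 0 0 _)]
    unfold startPoint
    ring
  have hbound : ∀ s ∈ uIoc 0 (max (-y) 0), ‖w' s 0 - w s 0‖ ≤ ε := fun s hs => by
    rw [uIoc_of_le hentry] at hs
    exact hε s ⟨hs.1.le, hs.2.trans hentry_le⟩ 0
  rw [hdiff, ← Real.norm_eq_abs]
  refine (intervalIntegral.norm_integral_le_of_norm_le_const hbound).trans ?_
  rw [sub_zero, abs_of_nonneg hentry]
  exact mul_le_mul_of_nonneg_left hentry_le hε_nonneg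

end IsForwardVelocity

lemma gronwallBound_le_of_le {δ δ' K ε x : ℝ} (h : δ ≤ δ') :
    gronwallBound δ K ε x ≤ gronwallBound δ' K ε x := by
  unfold gronwallBound
  split_ifs <;> gcongr

lemma tendsto_characteristic {ι : Type*} {l : Filter ι} {ws : ι → ℝ → ℝ → ℝ} {ε : ι → ℝ}
    (hT : 0 < T) (hw : IsForwardVelocity a B K w) (hws : ∀ n, IsForwardVelocity a B K (ws n))
    (hε : ∀ n, ∀ t ∈ Icc 0 T, ∀ x, |ws n t x - w t x| ≤ ε n) (hε_lim : Tendsto ε l (𝓝 0))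
    {t y : ℝ} (ht : t ∈ Icc 0 T) (hy : -T ≤ y) :
    Tendsto (fun n => characteristic T (ws n) t y) l (𝓝 (characteristic T w t y)) := by
  have hcont : Continuous fun e : ℝ => gronwallBound (e * T) K e t := by
    unfold gronwallBound
    split_ifs <;> fun_prop
  have hlim : Tendsto (fun n => gronwallBound (ε n * T) K (ε n) t) l (𝓝 0) := by
    simpa [Function.comp_def, gronwallBound_ε0_δ0] using (hcont.tendsto 0).comp hε_lim
  rw [tendsto_iff_dist_tendsto_zero]
  refine squeeze_zero (fun _ => dist_nonneg) (fun n => ?_) hlim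
  rw [dist_comm, Real.dist_eq]
  refine ((hw.isTrajectory_characteristic hT y).dist_le_of_approx hw.lipschitz
    ((hws n).isTrajectory_characteristic hT y) (hε n) ht).trans (gronwallBound_le_of_le ?_)
  rw [characteristic, characteristic, hw.flow_zero hT, (hws n).flow_zero hT]
  exact hw.abs_startPoint_sub_le (hws n) (hε n) hy hT.le

/-! ### Strong continuity of push-forwards -/

namespace HasBoundedCompression
variable {α β : Type*} [MeasurableSpace α] [MeasurableSpace β] {μ : Measure α} {ν : Measure β}
  {C : ℝ≥0} {Z : α → β}

lemma memLp_comp (hZ : HasBoundedCompression C μ ν Z) {p : ℝ≥0∞} {h : β → ℝ} (hh : MemLp h p ν) :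
    MemLp (fun y => h (Z y)) p μ :=
  hZ.measurableEmbedding.memLp_map_measure_iff.1
    (hh.of_measure_le_smul ENNReal.coe_ne_top hZ.map_le)

-- With `q`, `q'` the densities along `Z` and `Y ∘ Z`, the identity `∫ q'² = ∫ q · (q' ∘ Y)` lets
-- one absorb half of `∫ q'²` into the left side.
lemma integral_pushDensity_comp_sq_le [SigmaFinite μ] [SigmaFinite ν] {C' e : ℝ≥0}
    {Y : β → β} {f : α → ℝ} (hZ : HasBoundedCompression C μ ν Z)
    (hY : HasBoundedCompression e ν ν Y) (he : 0 < e)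
    (hYZ : HasBoundedCompression C' μ ν (Y ∘ Z)) (hq : MemLp (pushDensity μ ν Z f) 2 ν)
    (hq' : MemLp (pushDensity μ ν (Y ∘ Z) f) 2 ν) :
    ∫ x, pushDensity μ ν (Y ∘ Z) f x ^ 2 ∂ν ≤ e * ∫ x, pushDensity μ ν Z f x ^ 2 ∂ν := by
  set q := pushDensity μ ν Z f
  set q' := pushDensity μ ν (Y ∘ Z) f
  have hqY : MemLp (fun x => q' (Y x)) 2 ν := hY.memLp_comp hq'
  have hduality : ∫ x, q' x ^ 2 ∂ν = ∫ x, q x * q' (Y x) ∂ν := by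
    simp only [pow_two]
    rw [hYZ.integral_pushDensity_mul f q', hZ.integral_pushDensity_mul f fun x => q' (Y x)]
    rfl
  have hyoung (x : β) : q x * q' (Y x) ≤ e / 2 * q x ^ 2 + (2 * e : ℝ)⁻¹ * q' (Y x) ^ 2 := by
    have hsq : 0 ≤ (2 * e : ℝ)⁻¹ * (e * q x - q' (Y x)) ^ 2 := by positivity
    have hexpand : (2 * e : ℝ)⁻¹ * (e * q x - q' (Y x)) ^ 2
        = e / 2 * q x ^ 2 + (2 * e : ℝ)⁻¹ * q' (Y x) ^ 2 - q x * q' (Y x) := by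
      field_simp
      ring
    linarith
  have hmono : ∫ x, q x * q' (Y x) ∂ν
      ≤ e / 2 * (∫ x, q x ^ 2 ∂ν) + (2 * e : ℝ)⁻¹ * ∫ x, q' (Y x) ^ 2 ∂ν := by
    rw [← integral_const_mul, ← integral_const_mul,
      ← integral_add (hq.integrable_sq.const_mul _) (hqY.integrable_sq.const_mul _)]
    exact integral_mono (hq.integrable_mul hqY)
      ((hq.integrable_sq.const_mul _).add (hqY.integrable_sq.const_mul _)) hyoung
  have hcompress : (2 * e : ℝ)⁻¹ * ∫ x, q' (Y x) ^ 2 ∂ν ≤ 1 / 2 * ∫ x, q' x ^ 2 ∂ν :=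
    calc (2 * e : ℝ)⁻¹ * ∫ x, q' (Y x) ^ 2 ∂ν ≤ (2 * e : ℝ)⁻¹ * (e * ∫ x, q' x ^ 2 ∂ν) := by
          gcongr
          exact hY.integral_comp_le hq'.integrable_sq fun x => sq_nonneg _
      _ = 1 / 2 * ∫ x, q' x ^ 2 ∂ν := by field_simp
  linarith

end HasBoundedCompression

section StrongConvergence
variable {ι α : Type*} [MeasurableSpace α] {μ : Measure α} {l : Filter ι}

lemma tendsto_integral_sub_sq_of_weak {q : ι → α → ℝ} {q₀ : α → ℝ} {c : ι → ℝ}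
    (hq : ∀ᶠ i in l, MemLp (q i) 2 μ) (hq₀ : MemLp q₀ 2 μ) (hc : Tendsto c l (𝓝 1))
    (hle : ∀ᶠ i in l, ∫ x, q i x ^ 2 ∂μ ≤ c i * ∫ x, q₀ x ^ 2 ∂μ)
    (hweak : Tendsto (fun i => ∫ x, q i x * q₀ x ∂μ) l (𝓝 (∫ x, q₀ x ^ 2 ∂μ))) :
    Tendsto (fun i => ∫ x, (q i x - q₀ x) ^ 2 ∂μ) l (𝓝 0) := by
  have hlim : Tendsto (fun i => c i * (∫ x, q₀ x ^ 2 ∂μ) - 2 * (∫ x, q i x * q₀ x ∂μ)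
      + ∫ x, q₀ x ^ 2 ∂μ) l (𝓝 0) := by
    convert ((hc.mul_const (∫ x, q₀ x ^ 2 ∂μ)).sub (hweak.const_mul 2)).add_const
      (∫ x, q₀ x ^ 2 ∂μ) using 2
    ring
  refine squeeze_zero' (.of_forall fun i => integral_nonneg fun x => sq_nonneg _) ?_ hlim
  filter_upwards [hq, hle] with i hqi hlei
  have hmul : Integrable (fun x => 2 * (q i x * q₀ x)) μ := (hqi.integrable_mul hq₀).const_mul 2
  have hdiff : Integrable (fun x => q i x ^ 2 - 2 * (q i x * q₀ x)) μ := hqi.integrable_sq.sub hmul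
  have hexpand : ∫ x, (q i x - q₀ x) ^ 2 ∂μ
      = (∫ x, q i x ^ 2 ∂μ) - 2 * (∫ x, q i x * q₀ x ∂μ) + ∫ x, q₀ x ^ 2 ∂μ := by
    rw [← integral_const_mul, ← integral_sub hqi.integrable_sq hmul,
      ← integral_add hdiff hq₀.integrable_sq]
    congr 1 with x
    ring
  linarith

lemma integral_abs_le_sqrt_mul_sqrt [IsFiniteMeasure μ] {g : α → ℝ} (hg : MemLp g 2 μ) :
    ∫ x, |g x| ∂μ ≤ √(∫ x, g x ^ 2 ∂μ) * √(μ.real univ) := by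
  have habs : MemLp (fun x => |g x|) 2 μ := hg.abs
  have h := integral_mul_le_Lp_mul_Lq_of_nonneg .two_two (.of_forall fun x => abs_nonneg (g x))
    (.of_forall fun _ => zero_le_one) (by simpa using habs) (by simpa using memLp_const 1)
  simpa [Real.sqrt_eq_rpow] using h

end StrongConvergence

/-! ### The transported density -/

/-- Initial and boundary data encoded as a function of the label: `f y` is the initial datum at
`y > 0` and `f (-t)` the inflow at time `t`. -/
structure IsLabelData (T ℓ M : ℝ) (f : ℝ → ℝ) : Prop where
  measurable : Measurable f
  abs_le : ∀ y, |f y| ≤ M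
  eq_zero : ∀ y, y ∉ Ioo (-T) ℓ → f y = 0

/-- The solution of the linear transport problem with velocity `w` and label data `f`. -/
noncomputable def transported (T : ℝ) (w : ℝ → ℝ → ℝ) (f : ℝ → ℝ) (t : ℝ) : ℝ → ℝ :=
  pushDensity volume volume (characteristic T w t) f

section Transported
variable {T ℓ M a B : ℝ} {K : ℝ≥0} {w : ℝ → ℝ → ℝ} {f : ℝ → ℝ} {s t : ℝ}

lemma IsLabelData.bound_nonneg (hf : IsLabelData T ℓ M f) : 0 ≤ M :=
  (abs_nonneg _).trans (hf.abs_le 0)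

lemma IsLabelData.integrable (hf : IsLabelData T ℓ M f) : Integrable f := by
  have h : IntegrableOn f (Ioo (-T) ℓ) :=
    Measure.integrableOn_of_bounded measure_Ioo_lt_top.ne hf.measurable.aestronglyMeasurable
      (.of_forall hf.abs_le)
  exact (integrableOn_iff_integrable_of_support_subset
    fun y hy => not_imp_comm.1 (hf.eq_zero y) hy).1 h

lemma IsForwardVelocity.hasBoundedCompression_characteristic (hw : IsForwardVelocity a B K w)
    (hT : 0 < T) (ht : t ∈ Icc 0 T) :
    HasBoundedCompression (charConst T a K) volume volume (characteristic T w t) :=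
  hasBoundedCompression_of_antilipschitz (hw.continuous_characteristic hT ht)
    (hw.antilipschitz_characteristic hT ht)

lemma integral_transported_mul (hw : IsForwardVelocity a B K w) (hT : 0 < T) (f h : ℝ → ℝ)
    (ht : t ∈ Icc 0 T) :
    ∫ x, transported T w f t x * h x = ∫ y, f y * h (characteristic T w t y) :=
  (hw.hasBoundedCompression_characteristic hT ht).integral_pushDensity_mul f h

lemma integral_transported_mul_road (hw : IsForwardVelocity a B K w) (hT : 0 < T) (f h : ℝ → ℝ)
    (ht : t ∈ Icc 0 T) : ∫ x, transported T w f t x * h x ∂(roadMeasure ℓ)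
      = ∫ y, f y * (Ioo 0 ℓ).indicator h (characteristic T w t y) := by
  rw [← integral_transported_mul hw hT f ((Ioo 0 ℓ).indicator h) ht,
    ← integral_indicator measurableSet_Ioo]
  simp only [indicator_mul_right]

lemma transported_nonneg (hw : IsForwardVelocity a B K w) (hT : 0 < T) (ht : t ∈ Icc 0 T)
    (hf : ∀ y, 0 ≤ f y) (x : ℝ) : 0 ≤ transported T w f t x :=
  pushDensity_nonneg (hw.antilipschitz_characteristic hT ht).injective hf x

lemma measurable_transported (hw : IsForwardVelocity a B K w) (hT : 0 < T)
    (hf : IsLabelData T ℓ M f) (ht : t ∈ Icc 0 T) : Measurable (transported T w f t) :=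
  measurable_pushDensity (hw.hasBoundedCompression_characteristic hT ht).measurableEmbedding
    hf.measurable

lemma integrable_transported (hw : IsForwardVelocity a B K w) (hT : 0 < T)
    (hf : IsLabelData T ℓ M f) (ht : t ∈ Icc 0 T) : Integrable (transported T w f t) :=
  (hw.hasBoundedCompression_characteristic hT ht).integrable_pushDensity hf.integrable

lemma ae_abs_transported_le (hw : IsForwardVelocity a B K w) (hT : 0 < T)
    (hf : IsLabelData T ℓ M f) (ht : t ∈ Icc 0 T) :
    ∀ᵐ x, |transported T w f t x| ≤ charConst T a K * M :=
  (hw.hasBoundedCompression_characteristic hT ht).ae_abs_pushDensity_le hf.bound_nonneg hf.abs_le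

lemma memLp_two_transported (hw : IsForwardVelocity a B K w) (hT : 0 < T)
    (hf : IsLabelData T ℓ M f) (ht : t ∈ Icc 0 T) : MemLp (transported T w f t) 2 := by
  have hmeas := (measurable_transported hw hT hf ht).aestronglyMeasurable (μ := volume)
  rw [memLp_two_iff_integrable_sq hmeas]
  simpa only [pow_two] using
    (integrable_transported hw hT hf ht).bdd_mul hmeas (ae_abs_transported_le hw hT hf ht)

lemma integral_transported_sq_le (hw : IsForwardVelocity a B K w) (hT : 0 < T)
    (hf : IsLabelData T ℓ M f) (hs : s ∈ Icc 0 T) (ht : t ∈ Icc 0 T) :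
    ∫ x, transported T w f t x ^ 2
      ≤ Real.exp (K * |t - s|) * ∫ x, transported T w f s x ^ 2 := by
  obtain ⟨Y, hY_cont, hY_anti, hY⟩ := hw.exists_transition hT hs ht
  have hcomp : characteristic T w t = Y ∘ characteristic T w s := funext hY
  have hexp := Real.exp_pos (K * |t - s|)
  have hmem := memLp_two_transported hw hT hf ht
  have hZ := hw.hasBoundedCompression_characteristic hT ht
  unfold transported at hmem ⊢
  rw [hcomp] at hmem hZ ⊢
  have h := (hw.hasBoundedCompression_characteristic hT hs).integral_pushDensity_comp_sq_le
    (hasBoundedCompression_of_antilipschitz hY_cont hY_anti) (Real.toNNReal_pos.2 hexp) hZ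
    (memLp_two_transported hw hT hf hs) hmem
  rwa [Real.coe_toNNReal _ hexp.le] at h

lemma tendsto_integral_transported_sub_sq (hw : IsForwardVelocity a B K w) (hT : 0 < T)
    (hf : IsLabelData T ℓ M f) (ht : t ∈ Icc 0 T) :
    Tendsto (fun s => ∫ x, (transported T w f s x - transported T w f t x) ^ 2) (𝓝[Icc 0 T] t)
      (𝓝 0) := by
  have hexp : Tendsto (fun s => Real.exp (K * |s - t|)) (𝓝[Icc 0 T] t) (𝓝 1) := by
    have hcont : Continuous fun s => Real.exp (K * |s - t|) := by fun_prop
    simpa using (hcont.tendsto t).mono_left nhdsWithin_le_nhds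
  have hweak := tendsto_integral_mul_comp (l := 𝓝[Icc 0 T] t)
    (eventually_mem_nhdsWithin.mono fun s hs => hw.hasBoundedCompression_characteristic hT hs)
    (hw.hasBoundedCompression_characteristic hT ht)
    (.of_forall fun y _ => (hw.isTrajectory_characteristic hT y).continuousOn t ht) hf.integrable
    hf.bound_nonneg (.of_forall hf.abs_le) (integrable_transported hw hT hf ht)
  refine tendsto_integral_sub_sq_of_weak
    (eventually_mem_nhdsWithin.mono fun s hs => memLp_two_transported hw hT hf hs)
    (memLp_two_transported hw hT hf ht) hexp
    (eventually_mem_nhdsWithin.mono fun s hs => integral_transported_sq_le hw hT hf ht hs) ?_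
  simp only [pow_two]
  rw [integral_transported_mul hw hT f _ ht]
  refine hweak.congr' ?_
  filter_upwards [self_mem_nhdsWithin] with s hs
  rw [integral_transported_mul hw hT f _ hs]

lemma isBoundedL1Curve_transported (hw : IsForwardVelocity a B K w) (hT : 0 < T)
    (hf : IsLabelData T ℓ M f) :
    IsBoundedL1Curve (Icc 0 T) (roadMeasure ℓ) (charConst T a K * M) (transported T w f) where
  aestronglyMeasurable t ht := (measurable_transported hw hT hf ht).aestronglyMeasurable
  ae_abs_le t ht := ae_restrict_of_ae (ae_abs_transported_le hw hT hf ht)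
  tendsto t ht := by
    have hlim := ((Real.continuous_sqrt.tendsto _).comp
      (tendsto_integral_transported_sub_sq hw hT hf ht)).mul_const √((roadMeasure ℓ).real univ)
    rw [Real.sqrt_zero, zero_mul] at hlim
    refine squeeze_zero' (.of_forall fun s => integral_nonneg fun x => abs_nonneg _) ?_ hlim
    filter_upwards [self_mem_nhdsWithin] with s hs
    have hmem : MemLp (fun x => transported T w f s x - transported T w f t x) 2 :=
      (memLp_two_transported hw hT hf hs).sub (memLp_two_transported hw hT hf ht)
    refine (integral_abs_le_sqrt_mul_sqrt (hmem.restrict _)).trans ?_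
    refine mul_le_mul_of_nonneg_right (Real.sqrt_le_sqrt ?_) (Real.sqrt_nonneg _)
    exact setIntegral_le_integral hmem.integrable_sq (.of_forall fun x => sq_nonneg _)

end Transported

/-! ### The transported density is a weak solution -/

section Weak
variable {T ℓ M a B : ℝ} {K : ℝ≥0} {w : ℝ → ℝ → ℝ} {f : ℝ → ℝ}

lemma exists_exitTime {X : ℝ → ℝ} (hmono : StrictMonoOn X (Icc 0 T))
    (hcont : ContinuousOn X (Icc 0 T)) {e : ℝ} (he : e ∈ Icc 0 T) (hXe : X e ∈ Ico 0 ℓ)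
    (hentry : e = 0 ∨ X e = 0) :
    ∃ τ ∈ Icc e T, X τ ∈ Icc 0 ℓ ∧ (τ = T ∨ X τ = ℓ) ∧
      ∀ t ∈ Ioo 0 T, X t ∈ Ioo 0 ℓ ↔ t ∈ Ioo e τ := by
  obtain ⟨τ, hτ, hXτ, hexit⟩ : ∃ τ ∈ Icc e T, X τ ≤ ℓ ∧ (τ = T ∨ X τ = ℓ) := by
    rcases le_or_gt (X T) ℓ with h | h
    · exact ⟨T, right_mem_Icc.2 he.2, h, .inl rfl⟩
    · obtain ⟨τ, hτ, hXτ⟩ := intermediate_value_Icc he.2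
        (hcont.mono (Icc_subset_Icc_left he.1)) ⟨hXe.2.le, h.le⟩
      exact ⟨τ, hτ, hXτ.le, .inr hXτ⟩
  have hτ' : τ ∈ Icc 0 T := ⟨he.1.trans hτ.1, hτ.2⟩
  refine ⟨τ, hτ, ⟨hXe.1.trans (hmono.monotoneOn he hτ' hτ.1), hXτ⟩, hexit, fun t ht => ?_⟩
  have ht' := Ioo_subset_Icc_self ht
  refine ⟨fun hXt => ⟨?_, ?_⟩, fun h => ⟨?_, ?_⟩⟩
  · rcases hentry with rfl | h0
    · exact ht.1
    · exact (hmono.lt_iff_lt he ht').1 (h0.trans_lt hXt.1)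
  · rcases hexit with rfl | hℓ
    · exact ht.2
    · exact (hmono.lt_iff_lt ht' hτ').1 (hXt.2.trans_eq hℓ.symm)
  · exact hXe.1.trans_lt (hmono he ht' h.1)
  · exact (hmono ht' hτ' h.2).trans_le hXτ

lemma intervalIntegral_indicator_comp_eq {X : ℝ → ℝ} {A : Set ℝ} {e τ : ℝ} (h0 : 0 ≤ e)
    (he : e ≤ τ) (hτ : τ ≤ T) (hA : ∀ t ∈ Ioo 0 T, X t ∈ A ↔ t ∈ Ioo e τ) (g : ℝ → ℝ → ℝ) :
    ∫ t in 0..T, A.indicator (g t) (X t) = ∫ t in e..τ, g t (X t) := by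
  have hind : EqOn (fun t => A.indicator (g t) (X t))
      ((Ioo e τ).indicator fun t => g t (X t)) (Ioo 0 T) := fun t ht => by
    by_cases h : t ∈ Ioo e τ
    · simp only [indicator_of_mem h, indicator_of_mem ((hA t ht).2 h)]
    · simp only [indicator_of_notMem h, indicator_of_notMem (mt (hA t ht).1 h)]
  rw [intervalIntegral.integral_of_le (h0.trans (he.trans hτ)),
    intervalIntegral.integral_of_le he, integral_Ioc_eq_integral_Ioo, integral_Ioc_eq_integral_Ioo,
    setIntegral_congr_fun measurableSet_Ioo hind, setIntegral_indicator measurableSet_Ioo,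
    inter_eq_right.2 (Ioo_subset_Ioo h0 hτ)]

lemma IsTrajectory.hasDerivAt_comp {X : ℝ → ℝ} (hX : IsTrajectory T w X) {φ : ℝ × ℝ → ℝ}
    (hφ : ContDiff ℝ 1 φ) {t : ℝ} (ht : t ∈ Icc 0 T) :
    HasDerivAt (fun t => φ (t, X t)) (materialDeriv w φ t (X t)) t := by
  have hφ' : HasFDerivAt φ (fderiv ℝ φ (t, X t)) (t, X t) :=
    (hφ.differentiable one_ne_zero (t, X t)).hasFDerivAt
  have hchain := hφ'.comp_hasDerivAt t ((hasDerivAt_id t).prodMk (hX t ht))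
  rw [show ((1, w t (X t)) : ℝ × ℝ) = (1, 0) + w t (X t) • (0, 1) by simp, map_add, map_smul,
    smul_eq_mul] at hchain
  exact hchain

lemma IsTrajectory.strictMonoOn {X : ℝ → ℝ} (hX : IsTrajectory T w X)
    (hw : IsForwardVelocity a B K w) : StrictMonoOn X (Icc 0 T) := fun s hs t ht hst => by
  have hle := hX.mul_sub_le hw.lower hs.1 hst.le ht.2
  linarith [mul_pos hw.pos (sub_pos.2 hst)]

lemma integral_materialDeriv_characteristic (hw : IsForwardVelocity a B K w) (hT : 0 < T)
    (hℓ : 0 < ℓ) {φ : ℝ × ℝ → ℝ} (hφ : ContDiff ℝ 1 φ) (hφT : ∀ x ∈ Icc 0 ℓ, φ (T, x) = 0)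
    (hφℓ : ∀ t ∈ Icc 0 T, φ (t, ℓ) = 0) {y : ℝ} (hy : y ∈ Ioo (-T) ℓ) :
    ∫ t in 0..T, (Ioo 0 ℓ).indicator (materialDeriv w φ t) (characteristic T w t y)
      = -φ (max (-y) 0, max y 0) := by
  have hX := hw.isTrajectory_characteristic hT y
  have he : max (-y) 0 ∈ Icc 0 T := ⟨le_max_right _ _, max_le (by linarith [hy.1]) hT.le⟩
  have hXe := hw.characteristic_max_neg hT hy.1.le
  obtain ⟨τ, hτ, hXτ, hexit, hroad⟩ := exists_exitTime (hX.strictMonoOn hw) hX.continuousOn he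
    (by rw [hXe]; exact ⟨le_max_right _ _, max_lt hy.2 hℓ⟩)
    (by rw [hXe, max_eq_right_iff, max_eq_right_iff, neg_nonpos]; exact le_total 0 y)
  have hsub : Icc (max (-y) 0) τ ⊆ Icc 0 T := Icc_subset_Icc he.1 hτ.2
  have hφτ : φ (τ, characteristic T w τ y) = 0 := by
    rcases hexit with rfl | h
    · exact hφT _ hXτ
    · rw [h]
      exact hφℓ τ (hsub (right_mem_Icc.2 hτ.1))
  have hg : ContinuousOn (fun t => materialDeriv w φ t (characteristic T w t y)) (Icc 0 T) :=
    (continuous_materialDeriv hw.continuous hφ).comp_continuousOn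
      (continuousOn_id.prodMk hX.continuousOn)
  rw [intervalIntegral_indicator_comp_eq he.1 hτ.1 hτ.2 hroad,
    intervalIntegral.integral_eq_sub_of_hasDerivAt
      (fun t ht => hX.hasDerivAt_comp hφ (hsub (uIcc_of_le hτ.1 ▸ ht)))
      ((hg.mono hsub).intervalIntegrable_of_Icc hτ.1), hφτ, hXe, zero_sub]

lemma continuousOn_characteristic (hw : IsForwardVelocity a B K w) (hT : 0 < T) :
    ContinuousOn (fun z : ℝ × ℝ => characteristic T w z.1 z.2) (Icc 0 T ×ˢ univ) := by
  refine continuousOn_prod_of_continuousOn_lipschitzOnWith _ (⟨B, hw.upper_nonneg⟩ : ℝ≥0)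
    (fun t ht => (hw.continuous_characteristic hT ht).continuousOn) fun y _ => ?_
  exact (convex_Icc 0 T).lipschitzOnWith_of_nnnorm_hasDerivWithin_le
    (fun t ht => (hw.isTrajectory_characteristic hT y t ht).hasDerivWithinAt)
    fun t _ => hw.abs_le t _

lemma integrable_prod_mul_indicator_characteristic (hw : IsForwardVelocity a B K w) (hT : 0 < T)
    (hf : IsLabelData T ℓ M f) {g : ℝ → ℝ → ℝ} (hg : Continuous fun z : ℝ × ℝ => g z.1 z.2) :
    Integrable (fun z : ℝ × ℝ => f z.2 * (Ioo 0 ℓ).indicator (g z.1) (characteristic T w z.1 z.2))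
      ((volume.restrict (Icc 0 T)).prod volume) := by
  obtain ⟨G, hG⟩ := (isCompact_Icc.prod isCompact_Icc).exists_bound_of_continuousOn
    (hg.continuousOn (s := Icc 0 T ×ˢ Icc 0 ℓ))
  have hprod : (volume.restrict (Icc 0 T)).prod (volume : Measure ℝ)
      = volume.restrict (Icc 0 T ×ˢ univ) := by
    rw [Measure.volume_eq_prod, ← Measure.prod_restrict, Measure.restrict_univ]
  have hchar : AEMeasurable (fun z : ℝ × ℝ => (z.1, characteristic T w z.1 z.2))
      ((volume.restrict (Icc 0 T)).prod volume) := by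
    rw [hprod]
    exact (continuousOn_fst.prodMk (continuousOn_characteristic hw hT)).aemeasurable
      (measurableSet_Icc.prod .univ)
  have hg_road : Measurable fun z : ℝ × ℝ => (Ioo 0 ℓ).indicator (g z.1) z.2 :=
    hg.measurable.indicator (measurable_snd measurableSet_Ioo)
  have hdom : Integrable (fun z : ℝ × ℝ => max G 0 * |f z.2|)
      ((volume.restrict (Icc 0 T)).prod volume) :=
    (integrable_const (max G 0)).mul_prod hf.integrable.abs
  refine hdom.mono' ((hf.measurable.comp measurable_snd).aemeasurable.mul
    (hg_road.comp_aemeasurable hchar)).aestronglyMeasurable ?_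
  rw [hprod]
  filter_upwards [ae_restrict_mem (measurableSet_Icc.prod .univ)] with z hz
  rw [norm_mul, mul_comm]
  refine mul_le_mul_of_nonneg_right ?_ (norm_nonneg _)
  by_cases hx : characteristic T w z.1 z.2 ∈ Ioo 0 ℓ
  · rw [indicator_of_mem hx]
    exact (hG (z.1, characteristic T w z.1 z.2) ⟨hz.1, Ioo_subset_Icc_self hx⟩).trans
      (le_max_left _ _)
  · rw [indicator_of_notMem hx, norm_zero]
    exact le_max_right _ _

lemma integral_integral_transported_mul (hw : IsForwardVelocity a B K w) (hT : 0 < T)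
    (hℓ : 0 ≤ ℓ) (hf : IsLabelData T ℓ M f) {g : ℝ → ℝ → ℝ}
    (hg : Continuous fun z : ℝ × ℝ => g z.1 z.2) :
    ∫ t in 0..T, ∫ x in 0..ℓ, transported T w f t x * g t x
      = ∫ y, f y * ∫ t in 0..T, (Ioo 0 ℓ).indicator (g t) (characteristic T w t y) := by
  have hlabel : EqOn (fun t => ∫ x in 0..ℓ, transported T w f t x * g t x)
      (fun t => ∫ y, f y * (Ioo 0 ℓ).indicator (g t) (characteristic T w t y)) (uIcc 0 T) := by
    intro t ht
    rw [uIcc_of_le hT.le] at ht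
    beta_reduce
    rw [intervalIntegral_eq_integral_road hℓ, integral_transported_mul_road hw hT f (g t) ht]
  rw [intervalIntegral.integral_congr hlabel]
  simp only [intervalIntegral.integral_of_le hT.le, ← integral_Icc_eq_integral_Ioc]
  rw [integral_integral_swap (integrable_prod_mul_indicator_characteristic hw hT hf hg)]
  simp only [integral_const_mul]

lemma integral_eq_integral_inflow_add_integral_initial (hT : 0 ≤ T) (hℓ : 0 ≤ ℓ) {F : ℝ → ℝ}
    (hF : Integrable F) (hF_zero : ∀ y, y ∉ Ioo (-T) ℓ → F y = 0) :
    ∫ y, F y = (∫ t in 0..T, F (-t)) + ∫ x in 0..ℓ, F x := by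
  have hcompl : ∀ y, y ∉ Ioc (-T) ℓ → F y = 0 :=
    fun y hy => hF_zero y fun h => hy (Ioo_subset_Ioc_self h)
  rw [intervalIntegral.integral_comp_neg, neg_zero,
    intervalIntegral.integral_add_adjacent_intervals hF.intervalIntegrable hF.intervalIntegrable,
    intervalIntegral.integral_of_le (by linarith),
    setIntegral_eq_integral_of_forall_compl_eq_zero hcompl]

theorem isWeakSolution_transported (hw : IsForwardVelocity a B K w) (hT : 0 < T) (hℓ : 0 < ℓ)
    (hf : IsLabelData T ℓ M f) :
    IsWeakSolution T ℓ w f (fun t => f (-t)) (transported T w f) := by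
  rw [isWeakSolution_iff_materialDeriv]
  intro φ hφ hφT hφℓ
  set F : ℝ → ℝ := fun y => f y * φ (max (-y) 0, max y 0) with hF
  have hF_cont : Continuous fun y : ℝ => φ (max (-y) 0, max y 0) :=
    hφ.continuous.comp (by fun_prop)
  have hF_zero : ∀ y, y ∉ Ioo (-T) ℓ → F y = 0 := fun y hy => by
    rw [hF]
    simp only [hf.eq_zero y hy, zero_mul]
  have hF_int : Integrable F := by
    refine (integrableOn_iff_integrable_of_support_subset (s := Icc (-T) ℓ) fun y hy =>
      Ioo_subset_Icc_self (not_imp_comm.1 (hF_zero y) hy)).1 ?_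
    exact hf.integrable.integrableOn.mul_continuousOn hF_cont.continuousOn isCompact_Icc
  have hlabels : ∫ t in 0..T, ∫ x in 0..ℓ, transported T w f t x * materialDeriv w φ t x
      = -∫ y, F y := by
    rw [integral_integral_transported_mul hw hT hℓ.le hf
      (continuous_materialDeriv hw.continuous hφ), ← integral_neg]
    congr 1 with y
    by_cases hy : y ∈ Ioo (-T) ℓ
    · rw [integral_materialDeriv_characteristic hw hT hℓ hφ hφT hφℓ hy, mul_neg]
    · rw [hF_zero y hy, hf.eq_zero y hy, zero_mul, neg_zero]
  have hinflow : ∫ t in 0..T, F (-t) = ∫ t in 0..T, f (-t) * φ (t, 0) :=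
    intervalIntegral.integral_congr fun t ht => by
      rw [uIcc_of_le hT.le] at ht
      simp only [hF, neg_neg, max_eq_left ht.1, max_eq_right (neg_nonpos.2 ht.1)]
  have hinitial : ∫ x in 0..ℓ, F x = ∫ x in 0..ℓ, f x * φ (0, x) :=
    intervalIntegral.integral_congr fun x hx => by
      rw [uIcc_of_le hℓ.le] at hx
      simp only [hF, max_eq_left hx.1, max_eq_right (neg_nonpos.2 hx.1)]
  rw [hlabels, integral_eq_integral_inflow_add_integral_initial hT.le hℓ.le hF_int hF_zero,
    hinflow, hinitial]
  ring

end Weak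

/-! ### Densities as curves in `L^p` -/

section Density
variable {T ℓ M : ℝ} {p : ℝ≥0∞} {r : ℝ → Lp ℝ p (roadMeasure ℓ)}

lemma ofReal_integral_abs_eq_eLpNorm_one {α : Type*} [MeasurableSpace α] {μ : Measure α}
    {g : α → ℝ} (hg : Integrable g μ) : ENNReal.ofReal (∫ x, |g x| ∂μ) = eLpNorm g 1 μ := by
  rw [eLpNorm_one_eq_lintegral_enorm]
  exact ofReal_integral_norm_eq_lintegral_enorm hg

lemma eLpNorm_rpow_le_mul_eLpNorm_one {α : Type*} [MeasurableSpace α] {μ : Measure α}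
    {g : α → ℝ} (hp : 1 ≤ p) (hp_top : p ≠ ∞) (hg : ∀ᵐ x ∂μ, |g x| ≤ M) :
    eLpNorm g p μ ^ p.toReal ≤ ENNReal.ofReal M ^ (p.toReal - 1) * eLpNorm g 1 μ := by
  have hp_real : 1 ≤ p.toReal := by simpa using ENNReal.toReal_mono hp_top hp
  have hp_pos : 0 < p.toReal := one_pos.trans_le hp_real
  rw [eLpNorm_eq_lintegral_rpow_enorm_toReal (one_pos.trans_le hp).ne' hp_top, ← ENNReal.rpow_mul,
    one_div_mul_cancel hp_pos.ne', ENNReal.rpow_one, eLpNorm_one_eq_lintegral_enorm,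
    ← lintegral_const_mul' _ _
      (ENNReal.rpow_ne_top_of_nonneg (sub_nonneg.2 hp_real) ENNReal.ofReal_ne_top)]
  refine lintegral_mono_ae (hg.mono fun x hx => ?_)
  have henorm : ‖g x‖ₑ ≤ ENNReal.ofReal M := by
    rw [Real.enorm_eq_ofReal_abs]
    exact ENNReal.ofReal_le_ofReal hx
  calc ‖g x‖ₑ ^ p.toReal = ‖g x‖ₑ ^ (p.toReal - 1) * ‖g x‖ₑ := by
        conv_rhs => rw [← ENNReal.rpow_one ‖g x‖ₑ, ← ENNReal.rpow_mul, one_mul,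
          ← ENNReal.rpow_add_of_nonneg _ _ (sub_nonneg.2 hp_real) zero_le_one, sub_add_cancel]
    _ ≤ ENNReal.ofReal M ^ (p.toReal - 1) * ‖g x‖ₑ := by
        gcongr

lemma tendsto_eLpNorm_zero_of_tendsto_one {ι α : Type*} [MeasurableSpace α] {μ : Measure α}
    {l : Filter ι} {g : ι → α → ℝ} (hp : 1 ≤ p) (hp_top : p ≠ ∞)
    (hg : ∀ᶠ i in l, ∀ᵐ x ∂μ, |g i x| ≤ M)
    (hlim : Tendsto (fun i => eLpNorm (g i) 1 μ) l (𝓝 0)) :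
    Tendsto (fun i => eLpNorm (g i) p μ) l (𝓝 0) := by
  have hp_real : 1 ≤ p.toReal := by simpa using ENNReal.toReal_mono hp_top hp
  have hp_pos : 0 < p.toReal := one_pos.trans_le hp_real
  have hbound : Tendsto (fun i => (ENNReal.ofReal M ^ (p.toReal - 1) * eLpNorm (g i) 1 μ)
      ^ p.toReal⁻¹) l (𝓝 0) := by
    have hmul := ENNReal.Tendsto.const_mul (a := ENNReal.ofReal M ^ (p.toReal - 1)) hlim
      (.inr (ENNReal.rpow_ne_top_of_nonneg (sub_nonneg.2 hp_real) ENNReal.ofReal_ne_top))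
    rw [mul_zero] at hmul
    simpa [Function.comp_def, hp_pos] using
      ((ENNReal.continuous_rpow_const (y := p.toReal⁻¹)).tendsto _).comp hmul
  refine tendsto_of_tendsto_of_tendsto_of_le_of_le' tendsto_const_nhds hbound
    (.of_forall fun _ => bot_le) (hg.mono fun i hgi => ?_)
  exact (ENNReal.le_rpow_inv_iff hp_pos).2 (eLpNorm_rpow_le_mul_eLpNorm_one hp hp_top hgi)

lemma IsDensity.exists_isBoundedL1Curve [Fact (1 ≤ p)] (h : IsDensity T ℓ p r) :
    ∃ M, IsBoundedL1Curve (Icc 0 T) (roadMeasure ℓ) M fun t => r t := by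
  obtain ⟨M, hM⟩ := h.essBounded
  refine ⟨M, fun t _ => Lp.aestronglyMeasurable (r t), hM, fun t ht => ?_⟩
  have hmemLp (s : ℝ) : MemLp (⇑(r s) - ⇑(r t)) 1 (roadMeasure ℓ) :=
    ((Lp.memLp (r s)).sub (Lp.memLp (r t))).mono_exponent Fact.out
  set c := (roadMeasure ℓ) univ ^ (1 / (1 : ℝ≥0∞).toReal - 1 / p.toReal)
  have hbound : Tendsto (fun s => edist (r s) (r t) * c) (𝓝[Icc 0 T] t) (𝓝 0) := by
    have hc : c ≠ ∞ := by
      refine ENNReal.rpow_ne_top_of_nonneg ?_ (measure_ne_top _ _)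
      rcases eq_or_ne p ∞ with rfl | hp
      · simp
      · have hp_real : 1 ≤ p.toReal := by simpa using ENNReal.toReal_mono hp (Fact.out : 1 ≤ p)
        simpa using inv_le_one_of_one_le₀ hp_real
    simpa using ENNReal.Tendsto.mul_const
      (tendsto_iff_edist_tendsto_0.1 (h.continuousOn t ht)) (.inr hc)
  have hL1 : Tendsto (fun s => eLpNorm (⇑(r s) - ⇑(r t)) 1 (roadMeasure ℓ)) (𝓝[Icc 0 T] t)
      (𝓝 0) := by
    refine tendsto_of_tendsto_of_tendsto_of_le_of_le tendsto_const_nhds hbound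
      (fun _ => bot_le) fun s => ?_
    rw [Lp.edist_def]
    exact eLpNorm_le_eLpNorm_mul_rpow_measure_univ Fact.out
      ((Lp.aestronglyMeasurable _).sub (Lp.aestronglyMeasurable _))
  refine ((ENNReal.tendsto_toReal ENNReal.zero_ne_top).comp hL1).congr fun s => ?_
  rw [Function.comp_apply, ← ofReal_integral_abs_eq_eLpNorm_one ((hmemLp s).integrable le_rfl),
    ENNReal.toReal_ofReal (integral_nonneg fun x => abs_nonneg _)]
  rfl

lemma IsBoundedL1Curve.isDensity [Fact (1 ≤ p)] (hp : p ≠ ∞)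
    (h : IsBoundedL1Curve (Icc 0 T) (roadMeasure ℓ) M fun t => r t) : IsDensity T ℓ p r where
  essBounded := ⟨M, h.ae_abs_le⟩
  continuousOn t ht := by
    rw [ContinuousWithinAt, tendsto_iff_edist_tendsto_0]
    simp only [Lp.edist_def]
    refine tendsto_eLpNorm_zero_of_tendsto_one (M := M + M) Fact.out hp ?_ ?_
    · filter_upwards [self_mem_nhdsWithin] with s hs
      filter_upwards [h.ae_abs_le s hs, h.ae_abs_le t ht] with x hxs hxt
      exact (abs_sub _ _).trans (add_le_add hxs hxt)
    · have hlim := ENNReal.tendsto_ofReal (h.tendsto t ht)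
      rw [ENNReal.ofReal_zero] at hlim
      refine hlim.congr' ?_
      filter_upwards [self_mem_nhdsWithin] with s hs
      exact ofReal_integral_abs_eq_eLpNorm_one ((h.integrable hs).sub (h.integrable ht))

lemma IsBoundedL1Curve.exists_isDensity_ae_eq [Fact (1 ≤ p)] (hp : p ≠ ∞) {r : ℝ → ℝ → ℝ}
    (h : IsBoundedL1Curve (Icc 0 T) (roadMeasure ℓ) M r) :
    ∃ r' : ℝ → Lp ℝ p (roadMeasure ℓ), IsDensity T ℓ p r' ∧
      ∀ t ∈ Icc 0 T, r' t =ᵐ[roadMeasure ℓ] r t := by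
  have hlift (t : ℝ) : ∃ g : Lp ℝ p (roadMeasure ℓ), t ∈ Icc 0 T → g =ᵐ[roadMeasure ℓ] r t := by
    by_cases ht : t ∈ Icc 0 T
    · have hmem := MemLp.of_bound (p := p) (h.aestronglyMeasurable t ht) M (h.ae_abs_le t ht)
      exact ⟨hmem.toLp, fun _ => hmem.coeFn_toLp⟩
    · exact ⟨0, fun ht' => absurd ht' ht⟩
  choose r' hr' using hlift
  exact ⟨r', IsBoundedL1Curve.isDensity hp (h.congr fun t ht => (hr' t ht).symm), hr'⟩

end Density

section LabelData
variable {T ℓ m M : ℝ} {r₀ u : ℝ → ℝ}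

lemma exists_isLabelData (hT : 0 < T) (hℓ : 0 < ℓ) (hm : m ≤ 0) (hM : 0 ≤ M)
    (hr₀ : AEMeasurable r₀ (roadMeasure ℓ)) (hu : AEMeasurable u (roadMeasure T))
    (hr₀_mem : ∀ᵐ x ∂(roadMeasure ℓ), r₀ x ∈ Icc m M)
    (hu_mem : ∀ᵐ t ∂(roadMeasure T), u t ∈ Icc m M) :
    ∃ f, IsLabelData T ℓ (max (-m) M) f ∧ (∀ y, m ≤ f y) ∧
      (r₀ =ᵐ[roadMeasure ℓ] f) ∧ u =ᵐ[roadMeasure T] fun t => f (-t) := by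
  obtain ⟨g₀, hg₀, hg₀_mem, hg₀_eq⟩ := hr₀.exists_ae_eq_range_subset hr₀_mem ⟨0, hm, hM⟩
  obtain ⟨g₁, hg₁, hg₁_mem, hg₁_eq⟩ := hu.exists_ae_eq_range_subset hu_mem ⟨0, hm, hM⟩
  set f : ℝ → ℝ := (Ioo 0 ℓ).piecewise g₀ ((Ioo (-T) 0).indicator fun y => g₁ (-y)) with hf
  have hf_mem (y : ℝ) : f y ∈ Icc m M := by
    rw [hf, piecewise, indicator]
    split_ifs
    exacts [hg₀_mem (mem_range_self y), hg₁_mem (mem_range_self (-y)), ⟨hm, hM⟩]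
  refine ⟨f, ⟨?_, fun y => ?_, fun y hy => ?_⟩, fun y => (hf_mem y).1, ?_, ?_⟩
  · exact hg₀.piecewise measurableSet_Ioo
      ((hg₁.comp measurable_neg).indicator measurableSet_Ioo)
  · exact abs_le'.2 ⟨(hf_mem y).2.trans (le_max_right _ _),
      (neg_le_neg (hf_mem y).1).trans (le_max_left _ _)⟩
  · rw [hf, piecewise_eq_of_notMem _ _ _ fun h => hy (Ioo_subset_Ioo_left (by linarith) h),
      indicator_of_notMem fun h => hy (Ioo_subset_Ioo_right hℓ.le h)]
  · filter_upwards [hg₀_eq, ae_restrict_mem measurableSet_Ioo] with x hx hx_mem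
    rw [hf, piecewise_eq_of_mem _ _ _ hx_mem, hx]
  · filter_upwards [hg₁_eq, ae_restrict_mem measurableSet_Ioo] with t htg ht
    rw [hf, piecewise_eq_of_notMem _ _ _ fun h => by linarith [h.1, ht.1],
      indicator_of_mem (mem_Ioo.2 ⟨neg_lt_neg ht.2, neg_lt_zero.2 ht.1⟩), neg_neg, htg]

end LabelData

/-! ### The load of the road as a fixed point -/

-- In the sup norm weighted by `exp (-c τ)`, `Φ` is `C / c`-Lipschitz; take `c` large.
lemma existsUnique_fixedPoint_of_exp_bound {X : Type*} [TopologicalSpace X] [CompactSpace X]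
    (τ : C(X, ℝ)) (Φ : C(X, ℝ) → C(X, ℝ)) {C : ℝ} (hC : 0 ≤ C)
    (hΦ : ∀ (V V' : C(X, ℝ)) (D c : ℝ), 0 ≤ D → 0 < c →
      (∀ x, |V x - V' x| ≤ D * Real.exp (c * τ x)) →
      ∀ x, |Φ V x - Φ V' x| ≤ C * (D / c * Real.exp (c * τ x))) :
    ∃! V, Φ V = V := by
  set c : ℝ := 2 * C + 1 with hc
  have hc_pos : 0 < c := by positivity
  set E : C(X, ℝ) := ⟨fun x => Real.exp (c * τ x), by fun_prop⟩
  set E' : C(X, ℝ) := ⟨fun x => Real.exp (-(c * τ x)), by fun_prop⟩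
  have hE : E * E' = 1 := by
    ext x
    simp [E, E', ← Real.exp_add]
  have hcancel (V : C(X, ℝ)) : E * (E' * V) = V := by
    rw [← mul_assoc, hE, one_mul]
  set Ψ : C(X, ℝ) → C(X, ℝ) := fun V => E' * Φ (E * V)
  have hΨ : ContractingWith (1 / 2 : ℝ≥0) Ψ := by
    refine ⟨by norm_num [← NNReal.coe_lt_coe], LipschitzWith.of_dist_le_mul fun V V' => ?_⟩
    rw [ContinuousMap.dist_le (by positivity)]
    intro x
    have hdist : ∀ x, |(E * V) x - (E * V') x| ≤ dist V V' * Real.exp (c * τ x) := fun x => by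
      rw [ContinuousMap.mul_apply, ContinuousMap.mul_apply, ← mul_sub, abs_mul, mul_comm,
        show E x = Real.exp (c * τ x) from rfl, Real.abs_exp]
      gcongr
      exact V.dist_apply_le_dist x
    calc dist (Ψ V x) (Ψ V' x)
        = Real.exp (-(c * τ x)) * |Φ (E * V) x - Φ (E * V') x| := by
          rw [Real.dist_eq, ← Real.abs_exp, ← abs_mul, mul_sub]
          rfl
      _ ≤ Real.exp (-(c * τ x)) * (C * (dist V V' / c * Real.exp (c * τ x))) := by
          gcongr
          exact hΦ _ _ _ _ dist_nonneg hc_pos hdist x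
      _ = C / c * dist V V' := by
          rw [Real.exp_neg]
          field_simp
      _ ≤ (1 / 2 : ℝ≥0) * dist V V' := by
          gcongr
          rw [div_le_iff₀ hc_pos, hc]
          push_cast
          linarith
  refine ⟨E * hΨ.fixedPoint Ψ, ?_, fun V hV => ?_⟩
  · have hfixed : E' * Φ (E * hΨ.fixedPoint Ψ) = hΨ.fixedPoint Ψ := hΨ.fixedPoint_isFixedPt
    exact (hcancel _).symm.trans (congrArg (E * ·) hfixed)
  · have hfixed : Function.IsFixedPt Ψ (E' * V) := by
      rw [Function.IsFixedPt]
      simp only [Ψ, hcancel, hV]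
    rw [← hΨ.fixedPoint_unique hfixed, hcancel]

section RoadMass
variable {T ℓ M a B : ℝ} {K : ℝ≥0} {f : ℝ → ℝ} {w w' : ℝ → ℝ → ℝ} {t : ℝ}

/-- The mass on the road at time `t` when the label data `f` are transported with velocity `w`. -/
noncomputable def roadMass (T ℓ : ℝ) (f : ℝ → ℝ) (w : ℝ → ℝ → ℝ) (t : ℝ) : ℝ :=
  ∫ x, transported T w f t x ∂(roadMeasure ℓ)

lemma roadMass_eq_integral_indicator (hw : IsForwardVelocity a B K w) (hT : 0 < T)
    (ht : t ∈ Icc 0 T) :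
    roadMass T ℓ f w t = ∫ y, f y * (Ioo 0 ℓ).indicator 1 (characteristic T w t y) := by
  rw [← integral_transported_mul_road hw hT f 1 ht]
  simp [roadMass]

lemma integrable_mul_indicator_characteristic (hw : IsForwardVelocity a B K w) (hT : 0 < T)
    (hf : IsLabelData T ℓ M f) (ht : t ∈ Icc 0 T) :
    Integrable fun y => f y * (Ioo 0 ℓ).indicator (1 : ℝ → ℝ) (characteristic T w t y) := by
  refine hf.integrable.mul_bdd (c := 1) ?_ (.of_forall fun y => ?_)
  · exact ((measurable_one.indicator measurableSet_Ioo).comp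
      (hw.continuous_characteristic hT ht).measurable).aestronglyMeasurable
  · exact (norm_indicator_le_norm_self _ _).trans (by simp)

lemma roadMass_mem_Icc (hw : IsForwardVelocity a B K w) (hT : 0 < T) (hf : IsLabelData T ℓ M f)
    (hf_nonneg : ∀ y, 0 ≤ f y) (ht : t ∈ Icc 0 T) : roadMass T ℓ f w t ∈ Icc 0 (∫ y, f y) := by
  rw [roadMass_eq_integral_indicator hw hT ht]
  have hone (z : ℝ) : (Ioo 0 ℓ).indicator (1 : ℝ → ℝ) z ∈ Icc 0 1 :=
    ⟨indicator_nonneg (fun _ _ => zero_le_one) z, indicator_le_self' (fun _ _ => zero_le_one) z⟩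
  exact ⟨integral_nonneg fun y => mul_nonneg (hf_nonneg y) (hone _).1,
    integral_mono (integrable_mul_indicator_characteristic hw hT hf ht) hf.integrable
      fun y => mul_le_of_le_one_right (hf_nonneg y) (hone _).2⟩

lemma continuousOn_roadMass (hw : IsForwardVelocity a B K w) (hT : 0 < T)
    (hf : IsLabelData T ℓ M f) : ContinuousOn (roadMass T ℓ f w) (Icc 0 T) :=
  (isBoundedL1Curve_transported hw hT hf).continuousOn_integral

lemma abs_indicator_Ioo_sub_le {z z' δ : ℝ} (hz : 0 < z) (hz' : 0 < z') (h : |z - z'| ≤ δ) :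
    |(Ioo 0 ℓ).indicator (1 : ℝ → ℝ) z - (Ioo 0 ℓ).indicator 1 z'|
      ≤ (Icc (ℓ - δ) (ℓ + δ)).indicator 1 z := by
  have hδ := abs_le.1 h
  simp only [indicator_apply, mem_Ioo, mem_Icc, hz, hz', true_and, Pi.one_apply]
  split_ifs with h₁ h₂ hI hI h₂ hI <;> first | norm_num; done | (exfalso; grind)

-- Only labels whose characteristic ends up within `δ` of the exit can be counted differently.
lemma abs_mul_indicator_characteristic_sub_le (hw : IsForwardVelocity a B K w)
    (hw' : IsForwardVelocity a B K w') (hT : 0 < T) (hf : IsLabelData T ℓ M f) (ht : t ∈ Icc 0 T)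
    {δ : ℝ} (h : ∀ y, -T ≤ y → -t < y → |characteristic T w t y - characteristic T w' t y| ≤ δ)
    (y : ℝ) :
    |f y * (Ioo 0 ℓ).indicator (1 : ℝ → ℝ) (characteristic T w t y)
        - f y * (Ioo 0 ℓ).indicator 1 (characteristic T w' t y)|
      ≤ M * (Icc (ℓ - δ) (ℓ + δ)).indicator 1 (characteristic T w t y) := by
  have hind_nonneg (x : ℝ) : 0 ≤ (Icc (ℓ - δ) (ℓ + δ)).indicator (1 : ℝ → ℝ) x :=
    indicator_nonneg (fun _ _ => zero_le_one) x
  rw [← mul_sub, abs_mul]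
  by_cases hy : y ∈ Ioo (-T) ℓ
  · refine mul_le_mul (hf.abs_le y) ?_ (abs_nonneg _) hf.bound_nonneg
    rcases le_or_gt y (-t) with hyt | hyt
    · rw [indicator_of_notMem fun hmem => hmem.1.not_ge
          (hw.characteristic_nonpos hT ht.1 hy.1.le hyt),
        indicator_of_notMem fun hmem => hmem.1.not_ge
          (hw'.characteristic_nonpos hT ht.1 hy.1.le hyt), sub_zero, abs_zero]
      exact hind_nonneg _
    · exact abs_indicator_Ioo_sub_le (hw.characteristic_pos hT ht hy.1.le hyt)
        (hw'.characteristic_pos hT ht hy.1.le hyt) (h y hy.1.le hyt)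
  · rw [hf.eq_zero y hy, abs_zero, zero_mul]
    exact mul_nonneg hf.bound_nonneg (hind_nonneg _)

lemma abs_roadMass_sub_le (hw : IsForwardVelocity a B K w) (hw' : IsForwardVelocity a B K w')
    (hT : 0 < T) (hf : IsLabelData T ℓ M f) (ht : t ∈ Icc 0 T) {δ : ℝ} (hδ : 0 ≤ δ)
    (h : ∀ y, -T ≤ y → -t < y → |characteristic T w t y - characteristic T w' t y| ≤ δ) :
    |roadMass T ℓ f w t - roadMass T ℓ f w' t| ≤ M * (charConst T a K * (2 * δ)) := by
  set χ : ℝ → ℝ := (Icc (ℓ - δ) (ℓ + δ)).indicator 1 with hχ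
  have hχ_integrable : Integrable χ :=
    (integrable_indicator_iff measurableSet_Icc).2 (integrableOn_const (by simp))
  have hχ_nonneg : ∀ x, 0 ≤ χ x := indicator_nonneg fun _ _ => zero_le_one
  have hχ_integral : ∫ x, χ x = 2 * δ := by
    rw [hχ, integral_indicator_one measurableSet_Icc, Real.volume_real_Icc_of_le (by linarith)]
    ring
  have hcompression := hw.hasBoundedCompression_characteristic hT ht
  have hint := integrable_mul_indicator_characteristic hw hT hf ht
  have hint' := integrable_mul_indicator_characteristic hw' hT hf ht
  rw [roadMass_eq_integral_indicator hw hT ht, roadMass_eq_integral_indicator hw' hT ht,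
    ← integral_sub hint hint', ← hχ_integral]
  calc _ ≤ ∫ y, M * χ (characteristic T w t y) :=
        abs_integral_le_integral_abs.trans (integral_mono (hint.sub hint').abs
          ((hcompression.integrable_comp hχ_integrable).const_mul M)
          (abs_mul_indicator_characteristic_sub_le hw hw' hT hf ht h))
    _ ≤ M * (charConst T a K * ∫ x, χ x) := by
        rw [integral_const_mul]
        exact mul_le_mul_of_nonneg_left (hcompression.integral_comp_le hχ_integrable hχ_nonneg)
          hf.bound_nonneg

lemma abs_characteristic_sub_le_exp {g g' : ℝ → ℝ} (hT : 0 < T)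
    (hg : IsForwardVelocity a B 0 fun t _ => g t) (hg' : IsForwardVelocity a B 0 fun t _ => g' t)
    {D c : ℝ} (hc : 0 < c) (hD : 0 ≤ D)
    (h : ∀ s ∈ Icc 0 T, |g s - g' s| ≤ D * Real.exp (c * s)) {y : ℝ} (ht : t ∈ Icc 0 T)
    (hy : -T ≤ y) (hty : -t < y) :
    |characteristic T (fun t _ => g t) t y - characteristic T (fun t _ => g' t) t y|
      ≤ D / c * Real.exp (c * t) := by
  have hX := hg.isTrajectory_characteristic hT y
  have hX' := hg'.isTrajectory_characteristic hT y
  have hstart : max (-y) 0 ≤ t := max_le (by linarith) ht.1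
  have hsub : Icc (max (-y) 0) t ⊆ Icc 0 T := Icc_subset_Icc (le_max_right _ _) ht.2
  refine image_norm_le_of_norm_deriv_right_le_deriv_boundary (a := max (-y) 0) (b := t)
    (f := fun s => characteristic T (fun t _ => g t) s y - characteristic T (fun t _ => g' t) s y)
    (f' := fun s => g s - g' s) (B := fun s => D / c * Real.exp (c * s))
    (B' := fun s => D * Real.exp (c * s)) ?_ (fun s hs => ?_) ?_ (fun s => ?_) (fun s hs => ?_)
    ⟨hstart, le_rfl⟩
  · exact (hX.continuousOn.mono hsub).sub (hX'.continuousOn.mono hsub)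
  · have hs_mem := hsub (Ico_subset_Icc_self hs)
    exact ((hX s hs_mem).sub (hX' s hs_mem)).hasDerivWithinAt
  · rw [hg.characteristic_max_neg hT hy, hg'.characteristic_max_neg hT hy, sub_self, norm_zero]
    positivity
  · refine (((hasDerivAt_id' s).const_mul c).exp.const_mul (D / c)).congr_deriv ?_
    field_simp
  · exact h s (hsub (Ico_subset_Icc_self hs))

end RoadMass

section TrafficLoad
variable {T ℓ M a B : ℝ} {K : ℝ≥0} {f : ℝ → ℝ} {v v' : ℝ → ℝ → ℝ}

/-- The velocity of the traffic under the load `W`, frozen in time outside `[0,T]`. -/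
noncomputable def trafficVelocity (hT : 0 ≤ T) (v : ℝ → ℝ → ℝ) (W : C(Icc 0 T, ℝ)) (t _x : ℝ) : ℝ :=
  v (projIcc 0 T hT t) (W (projIcc 0 T hT t))

/-- `W` is the mass on the road of the traffic that it governs: a solution of the fixed point
problem to which the traffic equation reduces. -/
def IsTrafficLoad (hT : 0 ≤ T) (ℓ : ℝ) (f : ℝ → ℝ) (v : ℝ → ℝ → ℝ) (W : C(Icc 0 T, ℝ)) : Prop :=
  ∀ t : Icc 0 T, roadMass T ℓ f (trafficVelocity hT v W) t = W t

lemma trafficVelocity_of_mem (hT : 0 ≤ T) (W : C(Icc 0 T, ℝ)) {t : ℝ} (ht : t ∈ Icc 0 T) (x : ℝ) :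
    trafficVelocity hT v W t x = v t (W ⟨t, ht⟩) := by
  rw [trafficVelocity, projIcc_of_mem hT ht]

lemma isForwardVelocity_of_time {g : ℝ → ℝ} (ha : 0 < a) (hg : Continuous g)
    (hg_mem : ∀ t, g t ∈ Icc a B) : IsForwardVelocity a B 0 fun t _ => g t where
  pos := ha
  continuous := hg.comp continuous_fst
  lower t _ := (hg_mem t).1
  upper t _ := (hg_mem t).2
  lipschitz _ := LipschitzWith.const _
  eq_entrance _ _ _ := rfl

lemma isForwardVelocity_trafficVelocity (hT : 0 ≤ T)
    (hv : ContinuousOn (fun z : ℝ × ℝ => v z.1 z.2) (Icc 0 T ×ˢ univ)) (ha : 0 < a)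
    {W : C(Icc 0 T, ℝ)} (hv_mem : ∀ t : Icc 0 T, v t (W t) ∈ Icc a B) :
    IsForwardVelocity a B 0 (trafficVelocity hT v W) := by
  refine isForwardVelocity_of_time ha ?_ fun t => hv_mem _
  have hgraph : Continuous fun t : Icc 0 T => ((t : ℝ), W t) := by fun_prop
  exact hv.comp_continuous (hgraph.comp continuous_projIcc)
    fun t => ⟨(projIcc 0 T hT t).2, mem_univ _⟩

lemma exists_isForwardVelocity_trafficVelocity (hT : 0 ≤ T)
    (hv : ContinuousOn (fun z : ℝ × ℝ => v z.1 z.2) (Icc 0 T ×ˢ univ))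
    (hv_pos : ∀ t ∈ Icc 0 T, ∀ y, 0 < v t y) (W : C(Icc 0 T, ℝ)) :
    ∃ a B, IsForwardVelocity a B 0 (trafficVelocity hT v W) := by
  have hcont : Continuous fun t : Icc 0 T => v t (W t) :=
    hv.comp_continuous (by fun_prop : Continuous fun t : Icc 0 T => ((t : ℝ), W t))
      fun t => ⟨t.2, mem_univ _⟩
  have hne : (univ : Set (Icc 0 T)).Nonempty := ⟨⟨0, le_rfl, hT⟩, mem_univ _⟩
  obtain ⟨s, -, hs⟩ := isCompact_univ.exists_isMinOn hne hcont.continuousOn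
  obtain ⟨s', -, hs'⟩ := isCompact_univ.exists_isMaxOn hne hcont.continuousOn
  exact ⟨v s (W s), v s' (W s'), isForwardVelocity_trafficVelocity hT hv (hv_pos s s.2 _)
    fun t => ⟨hs (mem_univ t), hs' (mem_univ t)⟩⟩

lemma IsTrafficLoad.mem_Icc (hT : 0 < T) {W : C(Icc 0 T, ℝ)} (hW : IsTrafficLoad hT.le ℓ f v W)
    (hw : IsForwardVelocity a B K (trafficVelocity hT.le v W)) (hf : IsLabelData T ℓ M f)
    (hf_nonneg : ∀ y, 0 ≤ f y) (t : Icc 0 T) : W t ∈ Icc 0 (∫ y, f y) :=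
  hW t ▸ roadMass_mem_Icc hw hT hf hf_nonneg t.2

lemma IsTrafficLoad.congr (hT : 0 ≤ T) {W : C(Icc 0 T, ℝ)} (hW : IsTrafficLoad hT ℓ f v W)
    (h : ∀ t : Icc 0 T, v t (W t) = v' t (W t)) : IsTrafficLoad hT ℓ f v' W := by
  have hvel : trafficVelocity hT v' W = trafficVelocity hT v W := funext₂ fun t _ => (h _).symm
  rwa [IsTrafficLoad, hvel]

lemma existsUnique_isTrafficLoad_of_lipschitzWith (hT : 0 < T) (hf : IsLabelData T ℓ M f)
    (hv : ContinuousOn (fun z : ℝ × ℝ => v z.1 z.2) (Icc 0 T ×ˢ univ)) (ha : 0 < a)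
    (hv_mem : ∀ t ∈ Icc 0 T, ∀ y, v t y ∈ Icc a B)
    (hv_lip : ∀ t ∈ Icc 0 T, LipschitzWith K (v t)) :
    ∃! W, IsTrafficLoad hT.le ℓ f v W := by
  have hM := hf.bound_nonneg
  have hw (W : C(Icc 0 T, ℝ)) : IsForwardVelocity a B 0 (trafficVelocity hT.le v W) :=
    isForwardVelocity_trafficVelocity hT.le hv ha fun t => hv_mem t t.2 _
  set Φ : C(Icc 0 T, ℝ) → C(Icc 0 T, ℝ) := fun W =>
    ⟨fun t => roadMass T ℓ f (trafficVelocity hT.le v W) t,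
      continuousOn_iff_continuous_domRestrict.1 (continuousOn_roadMass (hw W) hT hf)⟩
  have hfixed (W : C(Icc 0 T, ℝ)) : Φ W = W ↔ IsTrafficLoad hT.le ℓ f v W :=
    ContinuousMap.ext_iff
  simp_rw [← hfixed]
  refine existsUnique_fixedPoint_of_exp_bound (C := M * charConst T a 0 * 2 * K)
    ⟨Subtype.val, continuous_subtype_val⟩ Φ (by positivity) fun V V' D c hD hc hVV' t => ?_
  have hvel : ∀ s ∈ Icc 0 T, |trafficVelocity hT.le v V s 0 - trafficVelocity hT.le v V' s 0|
      ≤ K * D * Real.exp (c * s) := fun s hs => by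
    rw [trafficVelocity_of_mem hT.le V hs, trafficVelocity_of_mem hT.le V' hs, mul_assoc]
    exact ((hv_lip s hs).dist_le_mul _ _).trans (mul_le_mul_of_nonneg_left (hVV' ⟨s, hs⟩) K.2)
  refine (abs_roadMass_sub_le (hw V) (hw V') hT hf t.2 (by positivity) fun y hy hty =>
    abs_characteristic_sub_le_exp hT (hw V) (hw V') hc (by positivity) hvel t.2 hy hty).trans_eq ?_
  simp only [ContinuousMap.coe_mk]
  ring

-- The total mass of `f` bounds every load a priori, so only `v` on `[0,T] × [0,∫ f]` matters.
lemma existsUnique_isTrafficLoad (hT : 0 < T) (hf : IsLabelData T ℓ M f)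
    (hf_nonneg : ∀ y, 0 ≤ f y)
    (hv : ContinuousOn (fun z : ℝ × ℝ => v z.1 z.2) (Icc 0 T ×ˢ univ))
    (hv_pos : ∀ t ∈ Icc 0 T, ∀ y, 0 < v t y)
    (hv_lip : ∃ K, ∀ t ∈ Icc 0 T, LipschitzOnWith K (v t) (Icc 0 (∫ y, f y))) :
    ∃! W, IsTrafficLoad hT.le ℓ f v W := by
  obtain ⟨K, hK⟩ := hv_lip
  set m := ∫ y, f y
  have hm : 0 ≤ m := integral_nonneg hf_nonneg
  have hsub : Icc 0 T ×ˢ Icc 0 m ⊆ Icc 0 T ×ˢ univ := prod_mono_right (subset_univ _)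
  have hne : (Icc 0 T ×ˢ Icc 0 m).Nonempty := ⟨(0, 0), ⟨le_rfl, hT.le⟩, ⟨le_rfl, hm⟩⟩
  have hcompact : IsCompact (Icc 0 T ×ˢ Icc 0 m) := isCompact_Icc.prod isCompact_Icc
  obtain ⟨z, hz, hz_min⟩ := hcompact.exists_isMinOn hne (hv.mono hsub)
  obtain ⟨z', -, hz_max⟩ := hcompact.exists_isMaxOn hne (hv.mono hsub)
  set vm : ℝ → ℝ → ℝ := fun t y => v t (projIcc 0 m hm y)
  have hvm : ContinuousOn (fun z : ℝ × ℝ => vm z.1 z.2) (Icc 0 T ×ˢ univ) := by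
    have hproj : Continuous fun z : ℝ × ℝ => (z.1, (projIcc 0 m hm z.2 : ℝ)) :=
      continuous_fst.prodMk (continuous_subtype_val.comp (continuous_projIcc.comp continuous_snd))
    exact hv.comp hproj.continuousOn fun z hz => ⟨hz.1, mem_univ _⟩
  have hvm_mem : ∀ t ∈ Icc 0 T, ∀ y, vm t y ∈ Icc (v z.1 z.2) (v z'.1 z'.2) := fun t ht y =>
    have hmem : (t, (projIcc 0 m hm y : ℝ)) ∈ Icc 0 T ×ˢ Icc 0 m := ⟨ht, Subtype.prop _⟩
    ⟨hz_min hmem, hz_max hmem⟩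
  have hvm_lip : ∀ t ∈ Icc 0 T, LipschitzWith K (vm t) := fun t ht =>
    LipschitzWith.of_dist_le_mul fun y y' => ((hK t ht).dist_le_mul _ (Subtype.prop _) _
      (Subtype.prop _)).trans (mul_le_mul_of_nonneg_left (abs_projIcc_sub_projIcc hm) K.2)
  have hvm_eq {W : C(Icc 0 T, ℝ)} (hW : ∀ t, W t ∈ Icc 0 m) (t : Icc 0 T) :
      vm t (W t) = v t (W t) := by
    simp only [vm, projIcc_of_mem hm (hW t)]
  have hz_pos : 0 < v z.1 z.2 := hv_pos _ hz.1 _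
  obtain ⟨W, hW, hW_unique⟩ :=
    existsUnique_isTrafficLoad_of_lipschitzWith hT hf hvm hz_pos hvm_mem hvm_lip
  have hW_mem := hW.mem_Icc hT
    (isForwardVelocity_trafficVelocity hT.le hvm hz_pos fun t => hvm_mem t t.2 _) hf hf_nonneg
  refine ⟨W, hW.congr hT.le (hvm_eq hW_mem), fun W' hW' => hW_unique W' ?_⟩
  obtain ⟨a, B, hw'⟩ := exists_isForwardVelocity_trafficVelocity hT.le hv hv_pos W'
  exact hW'.congr hT.le fun t => (hvm_eq (hW'.mem_Icc hT hw' hf hf_nonneg) t).symm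

end TrafficLoad

section Traffic
variable {T ℓ M a B : ℝ} {K : ℝ≥0} {f ρ₀ u₁ : ℝ → ℝ} {v ρ : ℝ → ℝ → ℝ}

lemma IsTrafficLoad.solvesTraffic (hT : 0 < T) (hℓ : 0 < ℓ) {W : C(Icc 0 T, ℝ)}
    (hW : IsTrafficLoad hT.le ℓ f v W) (hf : IsLabelData T ℓ M f)
    (hw : IsForwardVelocity a B K (trafficVelocity hT.le v W))
    (hρ : ∀ t ∈ Icc 0 T, ρ t =ᵐ[roadMeasure ℓ] transported T (trafficVelocity hT.le v W) f t)
    (hρ₀ : ρ₀ =ᵐ[roadMeasure ℓ] f) (hu₁ : u₁ =ᵐ[roadMeasure T] fun t => f (-t)) :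
    SolvesTraffic T ℓ v ρ₀ u₁ ρ := by
  refine (isWeakSolution_transported hw hT hℓ hf).congr hT.le hℓ.le (fun t ht x _ => ?_) hρ hρ₀ hu₁
  rw [trafficVelocity_of_mem hT.le W ht, intervalIntegral_eq_integral_road hℓ.le,
    integral_congr_ae (hρ t ht)]
  exact congrArg (v t) (hW ⟨t, ht⟩)

lemma SolvesTraffic.exists_isTrafficLoad (hT : 0 < T) (hℓ : 0 < ℓ)
    (h : SolvesTraffic T ℓ v ρ₀ u₁ ρ) (hρ : IsBoundedL1Curve (Icc 0 T) (roadMeasure ℓ) M ρ)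
    {N : ℝ} (hf : IsLabelData T ℓ N f)
    (hv : ContinuousOn (fun z : ℝ × ℝ => v z.1 z.2) (Icc 0 T ×ˢ univ))
    (hv_pos : ∀ t ∈ Icc 0 T, ∀ y, 0 < v t y)
    (hρ₀ : ρ₀ =ᵐ[roadMeasure ℓ] f) (hu₁ : u₁ =ᵐ[roadMeasure T] fun t => f (-t)) :
    ∃ W, IsTrafficLoad hT.le ℓ f v W ∧
      ∀ t ∈ Icc 0 T, ρ t =ᵐ[roadMeasure ℓ] transported T (trafficVelocity hT.le v W) f t := by
  set W : C(Icc 0 T, ℝ) := ⟨fun t => ∫ x, ρ t x ∂(roadMeasure ℓ),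
    continuousOn_iff_continuous_domRestrict.1 hρ.continuousOn_integral⟩
  obtain ⟨a, B, hw⟩ := exists_isForwardVelocity_trafficVelocity hT.le hv hv_pos W
  have hweak : IsWeakSolution T ℓ (trafficVelocity hT.le v W) f (fun t => f (-t)) ρ := by
    refine IsWeakSolution.congr hT.le hℓ.le h (fun t ht x _ => ?_) (fun _ _ => ae_eq_rfl)
      hρ₀.symm hu₁.symm
    rw [trafficVelocity_of_mem hT.le W ht, intervalIntegral_eq_integral_road hℓ.le]
    rfl
  have hae : ∀ t ∈ Icc 0 T,
      ρ t =ᵐ[roadMeasure ℓ] transported T (trafficVelocity hT.le v W) f t := fun t ht =>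
    hweak.ae_eq hT hℓ.le hw hρ (isBoundedL1Curve_transported hw hT hf)
      (isWeakSolution_transported hw hT hℓ hf) ht
  exact ⟨W, fun t => (integral_congr_ae (hae t t.2)).symm, hae⟩

theorem exists_unique_isDensity_solvesTraffic (hT : 0 < T) (hℓ : 0 < ℓ) {p : ℝ≥0∞} [Fact (1 ≤ p)]
    (hp : p ≠ ∞) (hv : ContinuousOn (fun z : ℝ × ℝ => v z.1 z.2) (Icc 0 T ×ˢ univ))
    (hv_lip : ∀ m, ∃ K, ∀ t ∈ Icc 0 T, LipschitzOnWith K (v t) (Icc 0 m))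
    (hv_pos : ∀ t ∈ Icc 0 T, ∀ y, 0 < v t y)
    (hρ₀ : MemLp ρ₀ ∞ (roadMeasure ℓ)) (hρ₀_nonneg : ∀ᵐ x ∂(roadMeasure ℓ), 0 ≤ ρ₀ x)
    (hu₁ : MemLp u₁ ∞ (roadMeasure T)) (hu₁_nonneg : ∀ᵐ t ∂(roadMeasure T), 0 ≤ u₁ t) :
    ∃ ρ : ℝ → Lp ℝ p (roadMeasure ℓ), IsDensity T ℓ p ρ ∧
      SolvesTraffic T ℓ v ρ₀ u₁ (fun t => ρ t) ∧
      (∀ t ∈ Icc 0 T, ∀ᵐ x ∂(roadMeasure ℓ), 0 ≤ ρ t x) ∧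
      ∀ ρ' : ℝ → Lp ℝ p (roadMeasure ℓ), IsDensity T ℓ p ρ' →
        SolvesTraffic T ℓ v ρ₀ u₁ (fun t => ρ' t) → ∀ t ∈ Icc 0 T, ρ' t = ρ t := by
  set M := max (lpNorm ρ₀ ∞ (roadMeasure ℓ)) (lpNorm u₁ ∞ (roadMeasure T))
  obtain ⟨f, hf, hf_nonneg, hfρ, hfu⟩ := exists_isLabelData (m := 0) (M := M) hT hℓ le_rfl
    (lpNorm_nonneg.trans (le_max_left _ _)) hρ₀.1.aemeasurable hu₁.1.aemeasurable
    (by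
      filter_upwards [ae_le_lpNorm_exponent_top hρ₀, hρ₀_nonneg] with x hx hx_nonneg
      exact ⟨hx_nonneg, (le_abs_self _).trans (hx.trans (le_max_left _ _))⟩)
    (by
      filter_upwards [ae_le_lpNorm_exponent_top hu₁, hu₁_nonneg] with t ht ht_nonneg
      exact ⟨ht_nonneg, (le_abs_self _).trans (ht.trans (le_max_right _ _))⟩)
  obtain ⟨W, hW, hW_unique⟩ := existsUnique_isTrafficLoad hT hf hf_nonneg hv hv_pos (hv_lip _)
  obtain ⟨a, B, hw⟩ := exists_isForwardVelocity_trafficVelocity hT.le hv hv_pos W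
  obtain ⟨ρ, hρ, hρ_eq⟩ := (isBoundedL1Curve_transported hw hT hf).exists_isDensity_ae_eq hp
  refine ⟨ρ, hρ, hW.solvesTraffic hT hℓ hf hw hρ_eq hfρ hfu, fun t ht => ?_,
    fun ρ' hρ' hsol t ht => ?_⟩
  · filter_upwards [hρ_eq t ht] with x hx
    rw [hx]
    exact transported_nonneg hw hT ht hf_nonneg x
  · obtain ⟨N, hN⟩ := hρ'.exists_isBoundedL1Curve
    obtain ⟨W', hW', hρ'_eq⟩ := hsol.exists_isTrafficLoad hT hℓ hN hf hv hv_pos hfρ hfu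
    obtain rfl := hW_unique W' hW'
    exact Lp.ext ((hρ'_eq t ht).trans (hρ_eq t ht).symm)

end Traffic

/-! ### The local traffic load -/

section LocalLoad
variable {T ℓ : ℝ}

lemma roadPrimitive_sub_eq_integral {r : ℝ → ℝ} (hr : Integrable r (roadMeasure ℓ)) (x x' : ℝ) :
    roadPrimitive ℓ r x' - roadPrimitive ℓ r x = ∫ y in x..x', (Ioo 0 ℓ).indicator r y :=
  intervalIntegral.integral_interval_sub_left (intervalIntegrable_indicator_road hr 0 x')
    (intervalIntegrable_indicator_road hr 0 x)

lemma integral_eq_roadPrimitive_sub {r : ℝ → ℝ} (hr : Integrable r (roadMeasure ℓ)) {x x' : ℝ}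
    (hx : x ∈ Icc 0 ℓ) (hx' : x' ∈ Icc 0 ℓ) :
    ∫ s in x..x', r s = roadPrimitive ℓ r x' - roadPrimitive ℓ r x := by
  rw [roadPrimitive_sub_eq_integral hr]
  refine intervalIntegral.integral_congr_ae ?_
  filter_upwards [Measure.ae_ne volume 0, Measure.ae_ne volume ℓ] with y hy₀ hyℓ hy
  have hy_mem : y ∈ Icc 0 ℓ := ordConnected_Icc.uIcc_subset hx hx' (uIoc_subset_uIcc hy)
  have hy_road : y ∈ Ioo 0 ℓ := ⟨hy_mem.1.lt_of_ne' hy₀, hy_mem.2.lt_of_ne hyℓ⟩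
  rw [indicator_of_mem hy_road]

lemma lipschitzWith_roadPrimitive {r : ℝ → ℝ} {M : ℝ≥0} (hr : Integrable r (roadMeasure ℓ))
    (hM : ∀ᵐ x ∂(roadMeasure ℓ), |r x| ≤ M) : LipschitzWith M (roadPrimitive ℓ r) := by
  refine LipschitzWith.of_dist_le_mul fun x x' => ?_
  rw [Real.dist_eq, Real.dist_eq, roadPrimitive_sub_eq_integral hr, ← Real.norm_eq_abs]
  refine intervalIntegral.norm_integral_le_of_norm_le_const_ae ?_
  rw [ae_restrict_iff' measurableSet_Ioo] at hM
  filter_upwards [hM] with y hy _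
  by_cases hy_road : y ∈ Ioo 0 ℓ
  · rw [indicator_of_mem hy_road]
    exact hy hy_road
  · rw [indicator_of_notMem hy_road, norm_zero]
    exact M.2

lemma IsBoundedL1Curve.continuousOn_roadPrimitive {τ : Type*} [TopologicalSpace τ] {S : Set τ}
    {M : ℝ} {r : τ → ℝ → ℝ} (hr : IsBoundedL1Curve S (roadMeasure ℓ) M r) (x : ℝ) :
    ContinuousOn (fun t => roadPrimitive ℓ (r t) x) S := by
  intro t ht
  rw [ContinuousWithinAt, tendsto_iff_dist_tendsto_zero]
  refine squeeze_zero' (.of_forall fun _ => dist_nonneg) ?_ (hr.tendsto t ht)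
  filter_upwards [self_mem_nhdsWithin] with s hs
  exact hr.abs_roadPrimitive_sub_le ht hs x

/-- The traffic on the stretch `[b(x), d(x)]` which the trucks at `x` observe. -/
noncomputable def localLoad (b d : ℝ → ℝ) (ρ : ℝ → ℝ → ℝ) (t x : ℝ) : ℝ :=
  ∫ s in (b x)..(d x), ρ t s

/-- The properties of the local load on which the truck equation depends: joint continuity,
Lipschitz continuity in space and values between `0` and `Y`. -/
structure IsLocalLoad (T ℓ Y : ℝ) (N : ℝ≥0) (P : ℝ → ℝ → ℝ) : Prop where
  continuousOn : ContinuousOn (fun z : ℝ × ℝ => P z.1 z.2) (Icc 0 T ×ˢ Icc 0 ℓ)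
  lipschitzOnWith : ∀ t ∈ Icc 0 T, LipschitzOnWith N (P t) (Icc 0 ℓ)
  mem_Icc : ∀ t ∈ Icc 0 T, ∀ x ∈ Icc 0 ℓ, P t x ∈ Icc 0 Y

lemma isLocalLoad_localLoad {b d : ℝ → ℝ} {ρ : ℝ → ℝ → ℝ} {M Kb Kd : ℝ≥0}
    (hρ : IsBoundedL1Curve (Icc 0 T) (roadMeasure ℓ) M ρ)
    (hρ_nonneg : ∀ t ∈ Icc 0 T, ∀ᵐ x ∂(roadMeasure ℓ), 0 ≤ ρ t x)
    (hb : LipschitzOnWith Kb b (Icc 0 ℓ)) (hb_maps : MapsTo b (Icc 0 ℓ) (Icc 0 ℓ))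
    (hd : LipschitzOnWith Kd d (Icc 0 ℓ)) (hd_maps : MapsTo d (Icc 0 ℓ) (Icc 0 ℓ))
    (hbd : ∀ x ∈ Icc 0 ℓ, b x ≤ d x) :
    IsLocalLoad T ℓ (M * ℓ) (M * Kd + M * Kb) (localLoad b d ρ) := by
  have heq : ∀ t ∈ Icc 0 T, EqOn (localLoad b d ρ t)
      (fun x => roadPrimitive ℓ (ρ t) (d x) - roadPrimitive ℓ (ρ t) (b x)) (Icc 0 ℓ) :=
    fun t ht x hx => integral_eq_roadPrimitive_sub (hρ.integrable ht) (hb_maps hx) (hd_maps hx)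
  have hprim_lip (t : ℝ) (ht : t ∈ Icc 0 T) : LipschitzWith M (roadPrimitive ℓ (ρ t)) :=
    lipschitzWith_roadPrimitive (hρ.integrable ht) (hρ.ae_abs_le t ht)
  have hlip : ∀ t ∈ Icc 0 T, LipschitzOnWith (M * Kd + M * Kb) (localLoad b d ρ t) (Icc 0 ℓ) :=
    fun t ht x hx x' hx' => by
      rw [heq t ht hx, heq t ht hx']
      exact (((hprim_lip t ht).comp_lipschitzOnWith hd).sub
        ((hprim_lip t ht).comp_lipschitzOnWith hb)) hx hx'
  refine ⟨continuousOn_prod_of_continuousOn_lipschitzOnWith' _ _ hlip fun x hx => ?_, hlip,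
    fun t ht x hx => ⟨?_, ?_⟩⟩
  · exact ((hρ.continuousOn_roadPrimitive (d x)).sub (hρ.continuousOn_roadPrimitive (b x))).congr
      fun t ht => heq t ht hx
  · have hnonneg : ∀ᵐ s ∂(volume.restrict (Icc 0 ℓ)), 0 ≤ ρ t s := by
      rw [← restrict_Ioo_eq_restrict_Icc]
      exact hρ_nonneg t ht
    exact intervalIntegral.integral_nonneg_of_ae_restrict (hbd x hx)
      (ae_restrict_of_ae_restrict_of_subset (Icc_subset_Icc (hb_maps hx).1 (hd_maps hx).2) hnonneg)
  · rw [heq t ht hx]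
    refine (le_abs_self _).trans (((hprim_lip t ht).dist_le_mul (d x) (b x)).trans
      (mul_le_mul_of_nonneg_left ?_ M.2))
    exact (Real.dist_le_of_mem_Icc (hd_maps hx) (hb_maps hx)).trans_eq (sub_zero ℓ)

end LocalLoad

/-! ### Admissible speeds on a compact box -/

section CompactSpeeds
variable {X : Type*} [PseudoMetricSpace X] [CompactSpace X] {a c C : ℝ} {m : X → X → ℝ}

lemma isCompact_setOf_mem_Icc_of_abs_sub_le (hm : ∀ z z', m z z' ≤ C * dist z z') :
    IsCompact {g : X →ᵇ ℝ | (∀ z, g z ∈ Icc a c) ∧ ∀ z z', |g z - g z'| ≤ m z z'} := by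
  refine BoundedContinuousFunction.arzela_ascoli₂ (Icc a c) isCompact_Icc _ ?_
    (fun g z hg => hg.1 z) ?_
  · have heval (z : X) : Continuous fun g : X →ᵇ ℝ => g z :=
      (BoundedContinuousFunction.lipschitz_eval_const z).continuous
    simp only [ofPred_and, ofPred_forall]
    exact (isClosed_iInter fun z => isClosed_Icc.preimage (heval z)).inter
      (isClosed_iInter fun z => isClosed_iInter fun z' =>
        isClosed_le ((heval z).sub (heval z')).abs continuous_const)
  · refine Metric.equicontinuous_of_continuity_modulus (fun δ => C * δ) ?_ _
      fun z z' g => (g.2.2 z z').trans (hm z z')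
    exact (continuous_const_mul C).tendsto' 0 0 (mul_zero C)

end CompactSpeeds

/-- The compact part of `[0,T] × [0,ℓ] × [0,∞)` on which the truck speed is evaluated, for loads
up to `Y`. -/
abbrev SpeedBox (T ℓ Y : ℝ) : Type := Icc 0 T × Icc 0 ℓ × Icc 0 Y

/-- The admissible speeds on the box, as a subset of the space of bounded continuous functions with
the sup norm. -/
def boxSpeeds (T ℓ Y lmin lmax L : ℝ) : Set (SpeedBox T ℓ Y →ᵇ ℝ) :=
  {g | (∀ z, g z ∈ Icc lmin lmax) ∧ ∀ z z', |g z - g z'|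
    ≤ L * (|(z.2.1 : ℝ) - z'.2.1| + |(z.2.2 : ℝ) - z'.2.2| + |(z.1 : ℝ) - z'.1|)}

/-- The extension of a function on the box by its values at the nearest points of the box. -/
noncomputable def boxExtend {T ℓ Y : ℝ} (hT : 0 ≤ T) (hℓ : 0 ≤ ℓ) (hY : 0 ≤ Y)
    (g : SpeedBox T ℓ Y → ℝ) (t x y : ℝ) : ℝ :=
  g (projIcc 0 T hT t, projIcc 0 ℓ hℓ x, projIcc 0 Y hY y)

/-- The truck velocity for a speed `g` on the box and a local load `P`, extended by constants beyond
`[0,T] × [0,ℓ]`. -/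
noncomputable def truckVelocity {T ℓ Y : ℝ} (hT : 0 ≤ T) (hℓ : 0 ≤ ℓ) (hY : 0 ≤ Y)
    (P : ℝ → ℝ → ℝ) (g : SpeedBox T ℓ Y → ℝ) (t x : ℝ) : ℝ :=
  boxExtend hT hℓ hY g t x (P (projIcc 0 T hT t) (projIcc 0 ℓ hℓ x))

section Box
variable {T ℓ Y lmin lmax L : ℝ}

lemma isCompact_boxSpeeds (hL : 0 ≤ L) : IsCompact (boxSpeeds T ℓ Y lmin lmax L) := by
  refine isCompact_setOf_mem_Icc_of_abs_sub_le (C := 3 * L) fun z z' => ?_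
  have ht : |(z.1 : ℝ) - z'.1| ≤ dist z z' := le_max_left _ _
  have hx : |(z.2.1 : ℝ) - z'.2.1| ≤ dist z z' := (le_max_left _ _).trans (le_max_right _ _)
  have hy : |(z.2.2 : ℝ) - z'.2.2| ≤ dist z z' := (le_max_right _ _).trans (le_max_right _ _)
  rw [mul_comm 3 L, mul_assoc]
  exact mul_le_mul_of_nonneg_left (by linarith) hL

lemma nonempty_boxSpeeds (hl : lmin ≤ lmax) (hL : 0 ≤ L) :
    (boxSpeeds T ℓ Y lmin lmax L).Nonempty :=
  ⟨BoundedContinuousFunction.const _ lmin, fun _ => ⟨le_rfl, hl⟩, fun z z' => by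
    simp only [BoundedContinuousFunction.const_apply, sub_self, abs_zero]
    positivity⟩

lemma isAdmissibleSpeed_boxExtend (hT : 0 ≤ T) (hℓ : 0 ≤ ℓ) (hY : 0 ≤ Y) (hL : 0 ≤ L)
    {g : SpeedBox T ℓ Y →ᵇ ℝ} (hg : g ∈ boxSpeeds T ℓ Y lmin lmax L) :
    IsAdmissibleSpeed T ℓ lmin lmax L (boxExtend hT hℓ hY g) where
  continuousOn := by
    have hproj : Continuous fun z : ℝ × ℝ × ℝ =>
        (projIcc 0 T hT z.1, projIcc 0 ℓ hℓ z.2.1, projIcc 0 Y hY z.2.2) :=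
      continuous_projIcc.prodMap (continuous_projIcc.prodMap continuous_projIcc)
    exact (g.continuous.comp hproj).continuousOn
  mem_Icc _ _ _ _ _ _ := hg.1 _
  lipschitz _ _ _ _ _ _ _ _ _ _ _ _ := (hg.2 _ _).trans <| mul_le_mul_of_nonneg_left
    (add_le_add (add_le_add (abs_projIcc_sub_projIcc hℓ) (abs_projIcc_sub_projIcc hY))
      (abs_projIcc_sub_projIcc hT)) hL

lemma IsAdmissibleSpeed.exists_boxSpeed {lam : ℝ → ℝ → ℝ → ℝ}
    (h : IsAdmissibleSpeed T ℓ lmin lmax L lam) (hT : 0 ≤ T) (hℓ : 0 ≤ ℓ) (hY : 0 ≤ Y) :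
    ∃ g ∈ boxSpeeds T ℓ Y lmin lmax L, ∀ t ∈ Icc 0 T, ∀ x ∈ Icc 0 ℓ, ∀ y ∈ Icc 0 Y,
      boxExtend hT hℓ hY g t x y = lam t x y := by
  have hcont : Continuous fun z : SpeedBox T ℓ Y => lam z.1 z.2.1 z.2.2 :=
    h.continuousOn.comp_continuous (f := fun z : SpeedBox T ℓ Y =>
      ((z.1 : ℝ), (z.2.1 : ℝ), (z.2.2 : ℝ))) (by fun_prop)
      fun z => ⟨z.1.2, z.2.1.2, z.2.2.2.1⟩
  refine ⟨BoundedContinuousFunction.mkOfCompact ⟨_, hcont⟩, ⟨fun z => ?_, fun z z' => ?_⟩,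
    fun t ht x hx y hy => ?_⟩
  · exact h.mem_Icc _ z.1.2 _ z.2.1.2 _ z.2.2.2.1
  · exact h.lipschitz _ z.1.2 _ z'.1.2 _ z.2.1.2 _ z'.2.1.2 _ _ z.2.2.2.1 z'.2.2.2.1
  · rw [boxExtend, projIcc_of_mem hT ht, projIcc_of_mem hℓ hx, projIcc_of_mem hY hy]
    rfl

lemma truckVelocity_of_mem (hT : 0 ≤ T) (hℓ : 0 ≤ ℓ) (hY : 0 ≤ Y) {P : ℝ → ℝ → ℝ}
    (g : SpeedBox T ℓ Y → ℝ) {t x : ℝ} (ht : t ∈ Icc 0 T) (hx : x ∈ Icc 0 ℓ) :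
    truckVelocity hT hℓ hY P g t x = boxExtend hT hℓ hY g t x (P t x) := by
  rw [truckVelocity, projIcc_of_mem hT ht, projIcc_of_mem hℓ hx]

lemma continuous_truckVelocity (hT : 0 ≤ T) (hℓ : 0 ≤ ℓ) (hY : 0 ≤ Y) {P : ℝ → ℝ → ℝ}
    (hP : ContinuousOn (fun z : ℝ × ℝ => P z.1 z.2) (Icc 0 T ×ˢ Icc 0 ℓ))
    (g : SpeedBox T ℓ Y →ᵇ ℝ) :
    Continuous fun z : ℝ × ℝ => truckVelocity hT hℓ hY P g z.1 z.2 := by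
  have hproj : Continuous fun z : ℝ × ℝ => (projIcc 0 T hT z.1, projIcc 0 ℓ hℓ z.2) :=
    continuous_projIcc.prodMap continuous_projIcc
  have hload : Continuous fun z : ℝ × ℝ => P (projIcc 0 T hT z.1) (projIcc 0 ℓ hℓ z.2) :=
    hP.comp_continuous (f := fun z : ℝ × ℝ =>
      ((projIcc 0 T hT z.1 : ℝ), (projIcc 0 ℓ hℓ z.2 : ℝ)))
      ((continuous_subtype_val.prodMap continuous_subtype_val).comp hproj)
      fun z => ⟨(projIcc 0 T hT z.1).2, (projIcc 0 ℓ hℓ z.2).2⟩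
  exact g.continuous.comp (hproj.fst.prodMk (hproj.snd.prodMk (continuous_projIcc.comp hload)))

lemma isForwardVelocity_truckVelocity (hT : 0 ≤ T) (hℓ : 0 ≤ ℓ) (hY : 0 ≤ Y) (hL : 0 ≤ L)
    (hlmin : 0 < lmin) {P : ℝ → ℝ → ℝ} {N : ℝ≥0} (hP : IsLocalLoad T ℓ Y N P)
    {g : SpeedBox T ℓ Y →ᵇ ℝ} (hg : g ∈ boxSpeeds T ℓ Y lmin lmax L) :
    IsForwardVelocity lmin lmax (Real.toNNReal (L * (1 + N))) (truckVelocity hT hℓ hY P g) where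
  pos := hlmin
  continuous := continuous_truckVelocity hT hℓ hY hP.continuousOn g
  lower _ _ := (hg.1 _).1
  upper _ _ := (hg.1 _).2
  lipschitz t := by
    refine LipschitzWith.of_dist_le_mul fun x x' => ?_
    have hx : |(projIcc 0 ℓ hℓ x : ℝ) - projIcc 0 ℓ hℓ x'| ≤ |x - x'| := abs_projIcc_sub_projIcc hℓ
    have hload := (hP.lipschitzOnWith _ (projIcc 0 T hT t).2).dist_le_mul _ (projIcc 0 ℓ hℓ x).2 _
      (projIcc 0 ℓ hℓ x').2
    rw [Real.coe_toNNReal _ (by positivity), mul_assoc]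
    refine (hg.2 _ _).trans (mul_le_mul_of_nonneg_left ?_ hL)
    simp only [sub_self, abs_zero, add_zero, Real.dist_eq, add_mul, one_mul]
    exact add_le_add hx ((abs_projIcc_sub_projIcc hY).trans
      (hload.trans (mul_le_mul_of_nonneg_left hx N.2)))
  eq_entrance t x hx := by
    rw [truckVelocity, truckVelocity, boxExtend, boxExtend, projIcc_of_le_left hℓ hx,
      projIcc_of_le_left hℓ le_rfl]

end Box

/-! ### The cost functional -/

/-- The variance functional of `q` with weight `m₂` for the second and `m₁` for the first moment.
The costs `J₁` and `J₂` are the cases `m₂ = x²`, `m₁ = x` and `m₂ = x² (1 + ρ)`,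
`m₁ = x (1 + ρ)`. -/
noncomputable def momentVariance (T ℓ : ℝ) (m₂ m₁ q : ℝ → ℝ → ℝ) : ℝ :=
  ∫ t in 0..T, ((∫ x, q t x * m₂ t x ∂(roadMeasure ℓ))
    - (∫ x, q t x * m₁ t x ∂(roadMeasure ℓ)) ^ 2)

section MomentVariance
variable {T ℓ M a B : ℝ} {K : ℝ≥0} {m₂ m₁ : ℝ → ℝ → ℝ}

lemma momentVariance_congr (hT : 0 ≤ T) {q q' : ℝ → ℝ → ℝ}
    (h : ∀ t ∈ Icc 0 T, q t =ᵐ[roadMeasure ℓ] q' t) :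
    momentVariance T ℓ m₂ m₁ q = momentVariance T ℓ m₂ m₁ q' := by
  refine intervalIntegral.integral_congr fun t ht => ?_
  rw [uIcc_of_le hT] at ht
  have hmoment (m : ℝ → ℝ) :
      ∫ x, q t x * m x ∂(roadMeasure ℓ) = ∫ x, q' t x * m x ∂(roadMeasure ℓ) :=
    integral_congr_ae ((h t ht).mono fun x hx => by simp only [hx])
  simp only [hmoment]

lemma tendsto_momentVariance {ι : Type*} {l : Filter ι} [l.IsCountablyGenerated] {N₂ N₁ : ℝ}
    (hT : 0 ≤ T) (hm₂ : IsBoundedL1Curve (Icc 0 T) (roadMeasure ℓ) N₂ m₂)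
    (hm₁ : IsBoundedL1Curve (Icc 0 T) (roadMeasure ℓ) N₁ m₁) {qs : ι → ℝ → ℝ → ℝ}
    {q : ℝ → ℝ → ℝ} (hqs : ∀ n, IsBoundedL1Curve (Icc 0 T) (roadMeasure ℓ) M (qs n))
    (hlim : ∀ t ∈ Icc 0 T, ∀ h, Integrable h (roadMeasure ℓ) →
      Tendsto (fun n => ∫ x, qs n t x * h x ∂(roadMeasure ℓ)) l
        (𝓝 (∫ x, q t x * h x ∂(roadMeasure ℓ)))) :
    Tendsto (fun n => momentVariance T ℓ m₂ m₁ (qs n)) l (𝓝 (momentVariance T ℓ m₂ m₁ q)) := by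
  have hmem {t : ℝ} (ht : t ∈ uIoc 0 T) : t ∈ Icc 0 T := Ioc_subset_Icc_self (uIoc_of_le hT ▸ ht)
  have hsecond (n : ι) := (hqs n).mul hm₂
  have hfirst (n : ι) := (hqs n).mul hm₁
  refine intervalIntegral.tendsto_integral_filter_of_dominated_convergence
    (fun _ => M * N₂ * (roadMeasure ℓ).real univ + (M * N₁ * (roadMeasure ℓ).real univ) ^ 2)
    (.of_forall fun n => ?_) (.of_forall fun n => .of_forall fun t ht => ?_)
    intervalIntegrable_const (.of_forall fun t ht => ?_)
  · exact (((hsecond n).continuousOn_integral.sub ((hfirst n).continuousOn_integral.pow 2)).mono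
      fun t ht => hmem ht).aestronglyMeasurable measurableSet_uIoc
  · refine (norm_sub_le _ _).trans (add_le_add ((hsecond n).abs_integral_le (hmem ht)) ?_)
    rw [norm_pow]
    exact pow_le_pow_left₀ (norm_nonneg _) ((hfirst n).abs_integral_le (hmem ht)) 2
  · exact (hlim t (hmem ht) _ (hm₂.integrable (hmem ht))).sub
      ((hlim t (hmem ht) _ (hm₁.integrable (hmem ht))).pow 2)

lemma tendsto_integral_transported_mul {ι : Type*} {l : Filter ι} [l.IsCountablyGenerated]
    (hT : 0 < T) {f : ℝ → ℝ} (hf : IsLabelData T ℓ M f) {w : ℝ → ℝ → ℝ} {ws : ι → ℝ → ℝ → ℝ}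
    {ε : ι → ℝ} (hw : IsForwardVelocity a B K w) (hws : ∀ n, IsForwardVelocity a B K (ws n))
    (hε : ∀ n, ∀ t ∈ Icc 0 T, ∀ x, |ws n t x - w t x| ≤ ε n) (hε_lim : Tendsto ε l (𝓝 0))
    {t : ℝ} (ht : t ∈ Icc 0 T) {h : ℝ → ℝ} (hh : Integrable h (roadMeasure ℓ)) :
    Tendsto (fun n => ∫ x, transported T (ws n) f t x * h x ∂(roadMeasure ℓ)) l
      (𝓝 (∫ x, transported T w f t x * h x ∂(roadMeasure ℓ))) := by
  rw [integral_transported_mul_road hw hT f h ht]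
  simp only [fun n => integral_transported_mul_road (ℓ := ℓ) (hws n) hT f h ht]
  refine tendsto_integral_mul_comp
    (.of_forall fun n => (hws n).hasBoundedCompression_characteristic hT ht)
    (hw.hasBoundedCompression_characteristic hT ht) (.of_forall fun y hy => ?_) hf.integrable
    hf.bound_nonneg (.of_forall hf.abs_le) ((integrable_indicator_iff measurableSet_Ioo).2 hh)
  have hy_mem : y ∈ Ioo (-T) ℓ := by_contra fun hy_notMem => hy (hf.eq_zero y hy_notMem)
  exact tendsto_characteristic hT hw hws hε hε_lim ht hy_mem.1.le

end MomentVariance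

/-! ### Optimal truck speeds -/

section OptimalSpeed
variable {T ℓ Y lmin lmax L M N₂ N₁ : ℝ} {N : ℝ≥0} {P m₂ m₁ : ℝ → ℝ → ℝ} {q₀ u₂ f : ℝ → ℝ}

lemma exists_optimal_boxSpeed (hT : 0 < T) (hℓ : 0 ≤ ℓ) (hY : 0 ≤ Y) (hL : 0 ≤ L)
    (hlmin : 0 < lmin) (hlmax : lmin ≤ lmax) (hP : IsLocalLoad T ℓ Y N P)
    (hf : IsLabelData T ℓ M f) (hm₂ : IsBoundedL1Curve (Icc 0 T) (roadMeasure ℓ) N₂ m₂)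
    (hm₁ : IsBoundedL1Curve (Icc 0 T) (roadMeasure ℓ) N₁ m₁) :
    ∃ g ∈ boxSpeeds T ℓ Y lmin lmax L, ∀ g' ∈ boxSpeeds T ℓ Y lmin lmax L,
      momentVariance T ℓ m₂ m₁ (transported T (truckVelocity hT.le hℓ hY P g) f)
        ≤ momentVariance T ℓ m₂ m₁ (transported T (truckVelocity hT.le hℓ hY P g') f) := by
  have hvel (g : boxSpeeds T ℓ Y lmin lmax L) :=
    isForwardVelocity_truckVelocity hT.le hℓ hY hL hlmin hP g.2
  refine (isCompact_boxSpeeds hL).exists_isMinOn (nonempty_boxSpeeds hlmax hL)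
    (f := fun g => momentVariance T ℓ m₂ m₁ (transported T (truckVelocity hT.le hℓ hY P g) f)) ?_
  rw [continuousOn_iff_continuous_domRestrict, continuous_iff_continuousAt]
  intro g
  refine tendsto_momentVariance hT.le hm₂ hm₁
    (fun g' => isBoundedL1Curve_transported (hvel g') hT hf) fun t ht h hh =>
      tendsto_integral_transported_mul (ε := fun g' => dist g' g) hT hf (hvel g) hvel
        (fun g' t _ x => ?_) (tendsto_iff_dist_tendsto_zero.1 tendsto_id) ht hh
  exact BoundedContinuousFunction.dist_coe_le_dist (f := g'.1) (g := g.1) _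

lemma exists_isLabelData_of_memLp (hT : 0 < T) (hℓ : 0 < ℓ) (hq₀ : MemLp q₀ ∞ (roadMeasure ℓ))
    (hu₂ : MemLp u₂ ∞ (roadMeasure T)) :
    ∃ M f, IsLabelData T ℓ M f ∧ (q₀ =ᵐ[roadMeasure ℓ] f) ∧
      u₂ =ᵐ[roadMeasure T] fun t => f (-t) := by
  set R := max (lpNorm q₀ ∞ (roadMeasure ℓ)) (lpNorm u₂ ∞ (roadMeasure T))
  have hR : 0 ≤ R := lpNorm_nonneg.trans (le_max_left _ _)
  obtain ⟨f, hf, -, hfq, hfu⟩ := exists_isLabelData hT hℓ (neg_nonpos.2 hR) hR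
    hq₀.1.aemeasurable hu₂.1.aemeasurable
    ((ae_le_lpNorm_exponent_top hq₀).mono fun x hx => abs_le.1 (hx.trans (le_max_left _ _)))
    ((ae_le_lpNorm_exponent_top hu₂).mono fun t ht => abs_le.1 (ht.trans (le_max_right _ _)))
  exact ⟨_, f, hf, hfq, hfu⟩

lemma isWeakSolution_of_boxSpeed (hT : 0 < T) (hℓ : 0 < ℓ) (hY : 0 ≤ Y) (hL : 0 ≤ L)
    (hlmin : 0 < lmin) (hP : IsLocalLoad T ℓ Y N P) (hf : IsLabelData T ℓ M f)
    (hq₀ : q₀ =ᵐ[roadMeasure ℓ] f) (hu₂ : u₂ =ᵐ[roadMeasure T] fun t => f (-t))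
    {g : SpeedBox T ℓ Y →ᵇ ℝ} (hg : g ∈ boxSpeeds T ℓ Y lmin lmax L) {q : ℝ → ℝ → ℝ}
    (hq : ∀ t ∈ Icc 0 T,
      q t =ᵐ[roadMeasure ℓ] transported T (truckVelocity hT.le hℓ.le hY P g) f t) :
    IsWeakSolution T ℓ (fun t x => boxExtend hT.le hℓ.le hY g t x (P t x)) q₀ u₂ q := by
  have hvel := isForwardVelocity_truckVelocity hT.le hℓ.le hY hL hlmin hP hg
  exact (isWeakSolution_transported hvel hT hℓ hf).congr hT.le hℓ.le
    (fun t ht x hx => (truckVelocity_of_mem hT.le hℓ.le hY g ht hx).symm) hq hq₀ hu₂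

lemma IsAdmissibleSpeed.exists_boxSpeed_ae_eq_transported {lam : ℝ → ℝ → ℝ → ℝ}
    (hlam : IsAdmissibleSpeed T ℓ lmin lmax L lam) (hT : 0 < T) (hℓ : 0 < ℓ) (hY : 0 ≤ Y)
    (hL : 0 ≤ L) (hlmin : 0 < lmin) (hP : IsLocalLoad T ℓ Y N P) (hf : IsLabelData T ℓ M f)
    (hq₀ : q₀ =ᵐ[roadMeasure ℓ] f) (hu₂ : u₂ =ᵐ[roadMeasure T] fun t => f (-t))
    {M' : ℝ} {q : ℝ → ℝ → ℝ} (hq : IsBoundedL1Curve (Icc 0 T) (roadMeasure ℓ) M' q)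
    (hsol : IsWeakSolution T ℓ (fun t x => lam t x (P t x)) q₀ u₂ q) :
    ∃ g ∈ boxSpeeds T ℓ Y lmin lmax L, ∀ t ∈ Icc 0 T,
      q t =ᵐ[roadMeasure ℓ] transported T (truckVelocity hT.le hℓ.le hY P g) f t := by
  obtain ⟨g, hg, hg_eq⟩ := hlam.exists_boxSpeed hT.le hℓ.le hY
  have hvel := isForwardVelocity_truckVelocity hT.le hℓ.le hY hL hlmin hP hg
  have hsol_box : IsWeakSolution T ℓ (truckVelocity hT.le hℓ.le hY P g) f (fun t => f (-t)) q :=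
    hsol.congr hT.le hℓ.le (fun t ht x hx => (truckVelocity_of_mem hT.le hℓ.le hY g ht hx).trans
      (hg_eq t ht x hx _ (hP.mem_Icc t ht x hx))) (fun _ _ => .rfl) hq₀.symm hu₂.symm
  exact ⟨g, hg, fun t ht => hsol_box.ae_eq hT hℓ.le hvel hq
    (isBoundedL1Curve_transported hvel hT hf) (isWeakSolution_transported hvel hT hℓ hf) ht⟩

theorem exists_optimal_truckSpeed {p : ℝ≥0∞} [Fact (1 ≤ p)] (hp : p ≠ ∞) (hT : 0 < T) (hℓ : 0 < ℓ)
    (hY : 0 ≤ Y) (hL : 0 ≤ L) (hlmin : 0 < lmin) (hlmax : lmin ≤ lmax)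
    (hP : IsLocalLoad T ℓ Y N P) (hq₀ : MemLp q₀ ∞ (roadMeasure ℓ))
    (hu₂ : MemLp u₂ ∞ (roadMeasure T)) (hm₂ : IsBoundedL1Curve (Icc 0 T) (roadMeasure ℓ) N₂ m₂)
    (hm₁ : IsBoundedL1Curve (Icc 0 T) (roadMeasure ℓ) N₁ m₁) :
    ∃ (lam : ℝ → ℝ → ℝ → ℝ) (q : ℝ → Lp ℝ p (roadMeasure ℓ)),
      IsAdmissibleSpeed T ℓ lmin lmax L lam ∧ IsDensity T ℓ p q ∧
      IsWeakSolution T ℓ (fun t x => lam t x (P t x)) q₀ u₂ (fun t => q t) ∧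
      ∀ (lam' : ℝ → ℝ → ℝ → ℝ) (q' : ℝ → Lp ℝ p (roadMeasure ℓ)),
        IsAdmissibleSpeed T ℓ lmin lmax L lam' → IsDensity T ℓ p q' →
        IsWeakSolution T ℓ (fun t x => lam' t x (P t x)) q₀ u₂ (fun t => q' t) →
        momentVariance T ℓ m₂ m₁ (fun t => q t) ≤ momentVariance T ℓ m₂ m₁ (fun t => q' t) := by
  obtain ⟨M, f, hf, hfq, hfu⟩ := exists_isLabelData_of_memLp hT hℓ hq₀ hu₂
  obtain ⟨g, hg, hmin⟩ := exists_optimal_boxSpeed hT hℓ.le hY hL hlmin hlmax hP hf hm₂ hm₁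
  have hvel := isForwardVelocity_truckVelocity hT.le hℓ.le hY hL hlmin hP hg
  obtain ⟨q, hq, hq_eq⟩ := (isBoundedL1Curve_transported hvel hT hf).exists_isDensity_ae_eq hp
  refine ⟨boxExtend hT.le hℓ.le hY g, q, isAdmissibleSpeed_boxExtend hT.le hℓ.le hY hL hg, hq,
    isWeakSolution_of_boxSpeed hT hℓ hY hL hlmin hP hf hfq hfu hg hq_eq,
    fun lam' q' hlam' hq' hsol' => ?_⟩
  obtain ⟨_, hq'_bdd⟩ := hq'.exists_isBoundedL1Curve
  obtain ⟨g', hg', hq'_eq⟩ := hlam'.exists_boxSpeed_ae_eq_transported hT hℓ hY hL hlmin hP hf hfq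
    hfu hq'_bdd hsol'
  rw [momentVariance_congr hT.le hq_eq, momentVariance_congr hT.le hq'_eq]
  exact hmin g' hg'

end OptimalSpeed

/-! ### Optimal candidates -/

section OptimalCandidate
variable {T ℓ : ℝ}

lemma SolvesTruck.congr (hT : 0 ≤ T) (hℓ : 0 ≤ ℓ) {b d q₀ u₂ : ℝ → ℝ} {lam : ℝ → ℝ → ℝ → ℝ}
    {ρ ρ' q : ℝ → ℝ → ℝ} (h : SolvesTruck T ℓ b d lam q₀ u₂ ρ q)
    (hρ : ∀ t ∈ Icc 0 T, ρ' t = ρ t) : SolvesTruck T ℓ b d lam q₀ u₂ ρ' q :=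
  IsWeakSolution.congr hT hℓ h (fun t ht x _ => by simp only [hρ t ht]) (fun _ _ => .rfl) .rfl .rfl

theorem exists_isMinOn_feasible {p : ℝ≥0∞} [Fact (1 ≤ p)] (hp : p ≠ ∞) (hT : 0 < T) (hℓ : 0 < ℓ)
    {v : ℝ → ℝ → ℝ} {b d : ℝ → ℝ}
    (hb : ∃ K, LipschitzOnWith K b (Icc 0 ℓ)) (hb_maps : MapsTo b (Icc 0 ℓ) (Icc 0 ℓ))
    (hd : ∃ K, LipschitzOnWith K d (Icc 0 ℓ)) (hd_maps : MapsTo d (Icc 0 ℓ) (Icc 0 ℓ))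
    (hbd : ∀ x ∈ Icc 0 ℓ, b x ≤ d x) {lmin lmax L : ℝ} (hlmin : 0 < lmin) (hlmax : lmin ≤ lmax)
    (hL : 0 ≤ L) {ρ₀ u₁ q₀ u₂ : ℝ → ℝ} (hq₀ : MemLp q₀ ∞ (roadMeasure ℓ))
    (hu₂ : MemLp u₂ ∞ (roadMeasure T)) {ρ : ℝ → Lp ℝ p (roadMeasure ℓ)}
    (hρ : IsDensity T ℓ p ρ) (hρ_sol : SolvesTraffic T ℓ v ρ₀ u₁ fun t => ρ t)
    (hρ_nonneg : ∀ t ∈ Icc 0 T, ∀ᵐ x ∂(roadMeasure ℓ), 0 ≤ ρ t x)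
    (hρ_unique : ∀ ρ' : ℝ → Lp ℝ p (roadMeasure ℓ), IsDensity T ℓ p ρ' →
      SolvesTraffic T ℓ v ρ₀ u₁ (fun t => ρ' t) → ∀ t ∈ Icc 0 T, ρ' t = ρ t)
    {N₂ N₁ : ℝ} {m₂ m₁ : ℝ → ℝ → ℝ} (hm₂ : IsBoundedL1Curve (Icc 0 T) (roadMeasure ℓ) N₂ m₂)
    (hm₁ : IsBoundedL1Curve (Icc 0 T) (roadMeasure ℓ) N₁ m₁) {J : Candidate ℓ p → ℝ}
    (hJ : ∀ c : Candidate ℓ p, (∀ t ∈ Icc 0 T, c.ρ t = ρ t) →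
      J c = momentVariance T ℓ m₂ m₁ fun t => c.q t) :
    ∃ c ∈ feasible T ℓ p v b d lmin lmax L ρ₀ u₁ q₀ u₂,
      IsMinOn J (feasible T ℓ p v b d lmin lmax L ρ₀ u₁ q₀ u₂) c := by
  obtain ⟨Kb, hKb⟩ := hb
  obtain ⟨Kd, hKd⟩ := hd
  obtain ⟨M, hM⟩ := hρ.exists_isBoundedL1Curve
  have hload := isLocalLoad_localLoad (hM.mono_bound (Real.le_coe_toNNReal M)) hρ_nonneg hKb
    hb_maps hKd hd_maps hbd
  obtain ⟨lam, q, hlam, hq, hq_sol, hmin⟩ := exists_optimal_truckSpeed hp hT hℓ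
    (by positivity) hL hlmin hlmax hload hq₀ hu₂ hm₂ hm₁
  refine ⟨⟨lam, ρ, q⟩, ⟨hlam, hρ, hρ_sol, hq, hq_sol⟩, fun c hc => ?_⟩
  obtain ⟨hc_lam, hcρ, hcρ_sol, hcq, hcq_sol⟩ := hc
  have hcρ_eq : ∀ t ∈ Icc 0 T, c.ρ t = ρ t := hρ_unique c.ρ hcρ hcρ_sol
  change J _ ≤ J c
  rw [hJ _ fun _ _ => rfl, hJ c hcρ_eq]
  exact hmin c.lam c.q hc_lam hcq (hcq_sol.congr hT.le hℓ.le fun t ht => by rw [hcρ_eq t ht])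

lemma isBoundedL1Curve_pow (S : Set ℝ) (n : ℕ) :
    IsBoundedL1Curve S (roadMeasure ℓ) (ℓ ^ n) fun _ x => x ^ n := by
  refine .const (by fun_prop) ?_
  filter_upwards [ae_restrict_mem measurableSet_Ioo] with x hx
  rw [abs_pow, abs_of_pos hx.1]
  exact pow_le_pow_left₀ hx.1.le hx.2.le n

lemma J₁_eq_momentVariance (hℓ : 0 ≤ ℓ) (q : ℝ → ℝ → ℝ) :
    J₁ T ℓ q = momentVariance T ℓ (fun _ x => x ^ 2) (fun _ x => x ^ 1) q := by
  simp only [J₁, momentVariance, intervalIntegral_eq_integral_road hℓ, pow_one, mul_comm]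

lemma J₂_eq_momentVariance (hT : 0 ≤ T) (hℓ : 0 ≤ ℓ) (q : ℝ → ℝ → ℝ) {ρ ρ' : ℝ → ℝ → ℝ}
    (h : ∀ t ∈ Icc 0 T, ρ t = ρ' t) :
    J₂ T ℓ q ρ = momentVariance T ℓ (fun t x => x ^ 2 * (1 + ρ' t x))
      (fun t x => x ^ 1 * (1 + ρ' t x)) q := by
  refine intervalIntegral.integral_congr fun t ht => ?_
  rw [uIcc_of_le hT] at ht
  simp only [intervalIntegral_eq_integral_road hℓ, h t ht, pow_one, mul_left_comm (q t _),
    mul_assoc]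

lemma exists_lipschitzOnWith_of_contDiffOn {v : ℝ → ℝ → ℝ}
    (hv : ContDiffOn ℝ 1 (fun z : ℝ × ℝ => v z.1 z.2) (Icc 0 T ×ˢ univ)) (m : ℝ) :
    ∃ K, ∀ t ∈ Icc 0 T, LipschitzOnWith K (v t) (Icc 0 m) := by
  obtain ⟨K, hK⟩ := (hv.mono (prod_mono_right (subset_univ (Icc 0 m)))).exists_lipschitzOnWith
    one_ne_zero ((convex_Icc 0 T).prod (convex_Icc 0 m)) (isCompact_Icc.prod isCompact_Icc)
  refine ⟨K, fun t ht => LipschitzOnWith.of_dist_le_mul fun y hy y' hy' => ?_⟩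
  exact (hK.dist_le_mul (t, y) ⟨ht, hy⟩ (t, y') ⟨ht, hy'⟩).trans_eq (by rw [dist_prod_same_left])

end OptimalCandidate

end Platooning

open Platooning in
theorem mainTheorem6_general {T ℓ : ℝ} (hT : 0 < T) (hℓ : 0 < ℓ)
    {p : ℝ≥0∞} [Fact (1 ≤ p)] (hp : p ≠ ∞) {v : ℝ → ℝ → ℝ}
    (hv : ContinuousOn (fun z : ℝ × ℝ => v z.1 z.2) (Icc 0 T ×ˢ univ))
    (hv_lip : ∀ m, ∃ K, ∀ t ∈ Icc 0 T, LipschitzOnWith K (v t) (Icc 0 m))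
    (hv_pos : ∀ t ∈ Icc 0 T, ∀ y, 0 < v t y) {b d : ℝ → ℝ}
    (hb : ∃ K, LipschitzOnWith K b (Icc 0 ℓ)) (hb_maps : MapsTo b (Icc 0 ℓ) (Icc 0 ℓ))
    (hd : ∃ K, LipschitzOnWith K d (Icc 0 ℓ)) (hd_maps : MapsTo d (Icc 0 ℓ) (Icc 0 ℓ))
    (hbd : ∀ x ∈ Icc 0 ℓ, b x ≤ d x) {lmin lmax L : ℝ} (hlmin : 0 < lmin) (hlmax : lmin ≤ lmax)
    (hL : 0 ≤ L) {ρ₀ u₁ q₀ u₂ : ℝ → ℝ}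
    (hρ₀ : MemLp ρ₀ ∞ (roadMeasure ℓ)) (hρ₀_nonneg : ∀ᵐ x ∂(roadMeasure ℓ), 0 ≤ ρ₀ x)
    (hu₁ : MemLp u₁ ∞ (roadMeasure T)) (hu₁_nonneg : ∀ᵐ t ∂(roadMeasure T), 0 ≤ u₁ t)
    (hq₀ : MemLp q₀ ∞ (roadMeasure ℓ)) (hu₂ : MemLp u₂ ∞ (roadMeasure T)) :
    (∃ c ∈ feasible T ℓ p v b d lmin lmax L ρ₀ u₁ q₀ u₂,
      IsMinOn (fun c => J₁ T ℓ (fun t => c.q t))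
        (feasible T ℓ p v b d lmin lmax L ρ₀ u₁ q₀ u₂) c) ∧
    (∃ c ∈ feasible T ℓ p v b d lmin lmax L ρ₀ u₁ q₀ u₂,
      IsMinOn (fun c => J₂ T ℓ (fun t => c.q t) (fun t => c.ρ t))
        (feasible T ℓ p v b d lmin lmax L ρ₀ u₁ q₀ u₂) c) := by
  obtain ⟨ρ, hρ, hρ_sol, hρ_nonneg, hρ_unique⟩ := exists_unique_isDensity_solvesTraffic (p := p)
    hT hℓ hp hv hv_lip hv_pos hρ₀ hρ₀_nonneg hu₁ hu₁_nonneg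
  obtain ⟨M, hM⟩ := hρ.exists_isBoundedL1Curve
  have hone_add : IsBoundedL1Curve (Icc 0 T) (roadMeasure ℓ) (ℓ ^ 0 + M) fun t x => 1 + ρ t x := by
    simpa only [pow_zero] using (isBoundedL1Curve_pow (Icc 0 T) 0).add hM
  constructor
  · exact exists_isMinOn_feasible hp hT hℓ hb hb_maps hd hd_maps hbd hlmin hlmax hL hq₀ hu₂ hρ
      hρ_sol hρ_nonneg hρ_unique (isBoundedL1Curve_pow _ 2) (isBoundedL1Curve_pow _ 1)
      fun c _ => J₁_eq_momentVariance hℓ.le _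
  · exact exists_isMinOn_feasible hp hT hℓ hb hb_maps hd hd_maps hbd hlmin hlmax hL hq₀ hu₂ hρ
      hρ_sol hρ_nonneg hρ_unique ((isBoundedL1Curve_pow _ 2).mul hone_add)
      ((isBoundedL1Curve_pow _ 1).mul hone_add)
      fun c hc => J₂_eq_momentVariance hT.le hℓ.le _ fun t ht => by rw [hc t ht]

theorem mainTheorem6 (T ℓ : ℝ) (hT : 0 < T) (hℓ : 0 < ℓ)
    (p : ℝ≥0∞) [Fact (1 ≤ p)] (hp : p ≠ ∞)
    (v : ℝ → ℝ → ℝ)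
    (hv : ContDiffOn ℝ 1 (fun z : ℝ × ℝ => v z.1 z.2) (Icc 0 T ×ˢ univ))
    (hv_pos : ∀ t ∈ Icc 0 T, ∀ y, 0 < v t y)
    (b d : ℝ → ℝ)
    (hb : ContDiffOn ℝ 1 b (Icc 0 ℓ)) (hb_maps : MapsTo b (Icc 0 ℓ) (Icc 0 ℓ))
    (hd : ContDiffOn ℝ 1 d (Icc 0 ℓ)) (hd_maps : MapsTo d (Icc 0 ℓ) (Icc 0 ℓ))
    (hbd : ∀ x ∈ Icc 0 ℓ, b x ≤ d x)
    (lmin lmax L : ℝ) (hlmin : 0 < lmin) (hlmax : lmin ≤ lmax) (hL : 0 ≤ L)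
    (ρ₀ u₁ q₀ u₂ : ℝ → ℝ)
    (hρ₀ : MemLp ρ₀ ∞ (volume.restrict (Ioo 0 ℓ)))
    (hρ₀_nonneg : ∀ᵐ x ∂(volume.restrict (Ioo 0 ℓ)), 0 ≤ ρ₀ x)
    (hu₁ : MemLp u₁ ∞ (volume.restrict (Ioo 0 T)))
    (hu₁_nonneg : ∀ᵐ t ∂(volume.restrict (Ioo 0 T)), 0 ≤ u₁ t)
    (hq₀ : MemLp q₀ ∞ (volume.restrict (Ioo 0 ℓ)))
    (hu₂ : MemLp u₂ ∞ (volume.restrict (Ioo 0 T))) :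
    (∃ c ∈ Platooning.feasible T ℓ p v b d lmin lmax L ρ₀ u₁ q₀ u₂,
      IsMinOn (fun c => Platooning.J₁ T ℓ (fun t => c.q t))
        (Platooning.feasible T ℓ p v b d lmin lmax L ρ₀ u₁ q₀ u₂) c) ∧
    (∃ c ∈ Platooning.feasible T ℓ p v b d lmin lmax L ρ₀ u₁ q₀ u₂,
      IsMinOn (fun c => Platooning.J₂ T ℓ (fun t => c.q t) (fun t => c.ρ t))
        (Platooning.feasible T ℓ p v b d lmin lmax L ρ₀ u₁ q₀ u₂) c) := by
  exact mainTheorem6_general hT hℓ hp hv.continuousOn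
    (Platooning.exists_lipschitzOnWith_of_contDiffOn hv) hv_pos
    (hb.exists_lipschitzOnWith one_ne_zero (convex_Icc 0 ℓ) isCompact_Icc) hb_maps
    (hd.exists_lipschitzOnWith one_ne_zero (convex_Icc 0 ℓ) isCompact_Icc) hd_maps hbd
    hlmin hlmax hL hρ₀ hρ₀_nonneg hu₁ hu₁_nonneg hq₀ hu₂
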